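/- Two firms $i\in\{X,Y\}$ independently draw a privately known type, $G$ (good) with probability $\mu_0\in(0,1)$ or $B$ (bad) with probability $1-\mu_0$. The marginal costs are $c_G=0<c_B$. A unit mass of consumers has valuations $v\in[0,\overline v]$, distributed independently of the firms' types with a continuous, strictly positive density $f_v$ and cdf $F_v$. A consumer of valuation $v$ values the product of a bad firm at $v$ and that of a good firm at $h(v)\ge v$, where $h$ is differentiable, $h'\ge 1$ and $h(\overline v)>\overline v$. Assume $h(0)\le c_B<\overline v$ and that the good type's complete-information monopoly profit $P\,[1-F_v(h^{-1}(P))]$ is strictly increasing on $[0,c_B]$, where $h^{-1}(P):=\inf\{v\in[0,\overline v]:h(v)\ge P\}$. The firms simultaneously set prices in $[0,P_{\max}]$, $P_{\max}>h(\overline v)$; mixed pricing is allowed. Consumers see both prices, form a belief $\mu_i(P_i)\in[0,1]$ that firm $i$ is good, and buy at most one unit, the surplus from firm $i$ being $\mu_i(P_i)h(v)+(1-\mu_i(P_i))v-P_i$ and that from not buying $0$; consumers who are indifferent between the two firms split equally. A type $\theta$ firm that sells to a mass $D$ of consumers at price $P$ earns $(P-c_\theta)D$. A perfect Bayesian equilibrium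 consists of a price distribution $\sigma_i^\theta$ for each type $\theta$ of each firm $i$, beliefs $\mu_i(\cdot)$ and consumer behaviour such that no type of any firm can raise its expected profit with another price, consumers optimise given the beliefs for every valuation and every pair of prices, and the belief $\mu_i(P)$ is the conditional probability of $G$ given firm $i$'s price (Bayes' rule). An equilibrium passes the Intuitive Criterion if there are no firm $i$, price $P$ outside the support of firm $i$'s price distribution, and type $\theta$ such that, if the consumers respond to $P$ with the belief that firm $i$ is surely of type $\theta$, then type $\theta$ of firm $i$ strictly prefers $P$ to its equilibrium profit while the other type of firm $i$ strictly prefers its equilibrium profit to $P$. Theorem. There is a perfect Bayesian equilibrium that passes the Intuitive Criterion, and it is unique: any two such equilibria have the same price distributions, and their beliefs and consumer behaviour coincide almost surely on the equilibrium path. In this equilibrium the bad type of each firm sets the price $c_B$, and the good types of both firms use the same atomless price distribution $\sigma^G$, which is concentrated on $[\underline P_G,c_B)$, has support $[\underline P_G,c_B]$, and has the cdf $$\sigma^G(P)=\frac1{\mu_0}-\frac{c_B(1-\mu_0)[1-F_v(h^{-1}(c_B))]}{\mu_0P[1-F_v(h^{-1}(P))]},\qquad P\in[\underline P_G,c_B),$$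 where $\underline P_G\in(0,c_B)$ is the unique solution in $[0,c_B]$ of $$\underline P_G[1-F_v(h^{-1}(\underline P_G))]=c_B(1-\mu_0)[1-F_v(h^{-1}(c_B))].$$ -/

import Mathlib

open MeasureTheory

/-- The two firms. -/
inductive Firm
  | X
  | Y
  deriving DecidableEq

/-- The competitor of a firm. -/
def Firm.other : Firm → Firm
  | .X => .Y
  | .Y => .X

/-- The type of a firm: good or bad. -/
inductive Quality
  | G
  | B
  deriving DecidableEq

/-- The other type. -/
def Quality.other : Quality → Quality
  | .G => .B
  | .B => .G

/-- The primitives of the price competition game. -/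
structure Market where
  /-- prior probability that a firm is of the good type -/
  prior : ℝ
  /-- highest consumer valuation -/
  vbar : ℝ
  /-- highest feasible price -/
  Pmax : ℝ
  /-- marginal cost of each type -/
  cost : Quality → ℝ
  /-- density of consumer valuations on `[0, vbar]` -/
  f : ℝ → ℝ
  /-- value of the good product to a consumer who values the bad product at `v` -/
  h : ℝ → ℝ

/-- A consumer's behavioural strategy: `s v p a` is the probability with which a consumer of
valuation `v` who sees the prices `p` takes action `a`; `some i` means to buy from firm `i`, and
`none` means not to buy. -/
abbrev ConsumerStrategy := ℝ → (Firm → ℝ) → Option Firm → ℝ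

/-- A (behavioural) strategy profile together with the consumers' beliefs. -/
structure Assessment where
  /-- price distribution of each type of each firm -/
  price : Firm → Quality → Measure ℝ
  /-- `belief i P`: probability consumers assign to firm `i` being good when its price is `P` -/
  belief : Firm → ℝ → ℝ
  /-- behaviour of the consumers -/
  buy : ConsumerStrategy

/-- The price profile in which firm `i` sets `P` and the other firm sets `Q`. -/
def priceProfile (i : Firm) (P Q : ℝ) : Firm → ℝ := fun k => if k = i then P else Q

/-- The probability that consumers assign to "good" when they are sure of the type `θ`. -/
def Quality.sure : Quality → ℝ
  | .G => 1
  | .B => 0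

/-- The belief system `μ` with the belief about firm `i` at the single price `P` replaced by `m`. -/
noncomputable def replaceBelief (μ : Firm → ℝ → ℝ) (i : Firm) (P m : ℝ) : Firm → ℝ → ℝ :=
  fun k Q => if k = i ∧ Q = P then m else μ k Q

namespace Market

/-- The distribution of consumer valuations. -/
noncomputable def valuation (M : Market) : Measure ℝ :=
  (volume.restrict (Set.Icc 0 M.vbar)).withDensity (fun v => ENNReal.ofReal (M.f v))

/-- The cdf of consumer valuations. -/
noncomputable def F (M : Market) (x : ℝ) : ℝ := M.valuation.real (Set.Iic x)

/-- `h⁻¹(P) = inf {v ∈ [0, vbar] : h v ≥ P}`, for `P ≤ h vbar`. -/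
noncomputable def hInv (M : Market) (P : ℝ) : ℝ := sInf {v ∈ Set.Icc 0 M.vbar | P ≤ M.h v}

/-- The standing assumptions with negatively correlated cost and quality. -/
structure NegCorr (M : Market) : Prop where
  prior_pos : 0 < M.prior
  prior_lt_one : M.prior < 1
  cost_G : M.cost .G = 0
  cost_B_pos : 0 < M.cost .B
  cost_B_lt : M.cost .B < M.vbar
  f_cont : ContinuousOn M.f (Set.Icc 0 M.vbar)
  f_pos : ∀ v ∈ Set.Icc 0 M.vbar, 0 < M.f v
  f_int : ∫ v in (0 : ℝ)..M.vbar, M.f v = 1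
  h_diff : DifferentiableOn ℝ M.h (Set.Icc 0 M.vbar)
  h_deriv : ∀ v ∈ Set.Icc 0 M.vbar, 1 ≤ derivWithin M.h (Set.Icc 0 M.vbar) v
  h_ge : ∀ v ∈ Set.Icc 0 M.vbar, v ≤ M.h v
  h_vbar : M.vbar < M.h M.vbar
  h_zero : M.h 0 ≤ M.cost .B
  Pmax_gt : M.h M.vbar < M.Pmax
  /-- the good type's complete-information monopoly profit increases up to the bad type's cost -/
  profit_mono : StrictMonoOn (fun P => P * (1 - M.F (M.hInv P))) (Set.Icc 0 (M.cost .B))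

/-- Expected surplus from each action of a consumer of valuation `v` at prices `p`. -/
def surplus (M : Market) (μ : Firm → ℝ → ℝ) (v : ℝ) (p : Firm → ℝ) : Option Firm → ℝ
  | none => 0
  | some i => μ i (p i) * M.h v + (1 - μ i (p i)) * v - p i

/-- `s` is a consumer strategy that is optimal given the beliefs `μ` for every valuation and every
pair of prices, and in which consumers who are indifferent between the two firms split equally. -/
structure IsConsumerBR (M : Market) (μ : Firm → ℝ → ℝ) (s : ConsumerStrategy) : Prop where
  measurable : ∀ a, Measurable (fun x : ℝ × (Firm → ℝ) => s x.1 x.2 a)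
  nonneg : ∀ v p a, 0 ≤ s v p a
  sum_one : ∀ v p, s v p none + s v p (some .X) + s v p (some .Y) = 1
  optimal : ∀ v ∈ Set.Icc 0 M.vbar, ∀ p : Firm → ℝ, (∀ i, p i ∈ Set.Icc 0 M.Pmax) →
    ∀ a, 0 < s v p a → ∀ b, M.surplus μ v p b ≤ M.surplus μ v p a
  split : ∀ v ∈ Set.Icc 0 M.vbar, ∀ p : Firm → ℝ, (∀ i, p i ∈ Set.Icc 0 M.Pmax) →
    M.surplus μ v p (some .X) = M.surplus μ v p (some .Y) →
    s v p (some .X) = s v p (some .Y)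

/-- The mass of consumers who buy from firm `i` at prices `p`. -/
noncomputable def demand (M : Market) (s : ConsumerStrategy) (i : Firm) (p : Firm → ℝ) : ℝ :=
  ∫ v, s v p (some i) ∂M.valuation

/-- The ex ante distribution of firm `i`'s price, averaged over its type. -/
noncomputable def mix (M : Market) (σ : Firm → Quality → Measure ℝ) (i : Firm) : Measure ℝ :=
  ENNReal.ofReal M.prior • σ i .G + ENNReal.ofReal (1 - M.prior) • σ i .B

/-- Expected profit of type `θ` of firm `i` from the price `P`, when the other firm follows `σ` and
the consumers follow `s`. -/
noncomputable def profit (M : Market) (σ : Firm → Quality → Measure ℝ) (s : ConsumerStrategy)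
    (i : Firm) (θ : Quality) (P : ℝ) : ℝ :=
  (P - M.cost θ) * ∫ Q, M.demand s i (priceProfile i P Q) ∂(M.mix σ i.other)

/-- Expected profit of type `θ` of firm `i` in the assessment `A`. -/
noncomputable def eqProfit (M : Market) (A : Assessment) (i : Firm) (θ : Quality) : ℝ :=
  ∫ P, M.profit A.price A.buy i θ P ∂(A.price i θ)

/-- Perfect Bayesian equilibrium. -/
structure IsPBE (M : Market) (A : Assessment) : Prop where
  /-- firms use probability distributions over feasible prices -/
  price_prob : ∀ i θ, IsProbabilityMeasure (A.price i θ)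
  price_feasible : ∀ i θ, A.price i θ (Set.Icc 0 M.Pmax)ᶜ = 0
  /-- no type of any firm gains from any feasible price -/
  firm_optimal : ∀ i θ, ∀ P ∈ Set.Icc 0 M.Pmax,
    M.profit A.price A.buy i θ P ≤ M.eqProfit A i θ
  belief_measurable : ∀ i, Measurable (A.belief i)
  belief_mem : ∀ i P, A.belief i P ∈ Set.Icc (0 : ℝ) 1
  /-- Bayes' rule: the belief is the conditional probability of the good type given the price -/
  bayes : ∀ i, ∀ S : Set ℝ, MeasurableSet S →
    ∫ P in S, A.belief i P ∂(M.mix A.price i) = M.prior * (A.price i .G).real S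
  /-- consumers optimise given their beliefs -/
  consumer_optimal : M.IsConsumerBR A.belief A.buy

/-- The Intuitive Criterion: there are no firm `i`, price `P` off the equilibrium path, and type `θ`
such that, if the consumers respond to `P` with the belief that firm `i` is surely of type `θ`, then
type `θ` strictly prefers `P` to the equilibrium and the other type strictly prefers the
equilibrium to `P`. -/
def PassesIntuitiveCriterion (M : Market) (A : Assessment) : Prop :=
  ∀ (i : Firm) (θ : Quality), ∀ P ∈ Set.Icc 0 M.Pmax, P ∉ (M.mix A.price i).support →
    ∀ s : ConsumerStrategy, M.IsConsumerBR (replaceBelief A.belief i P θ.sure) s →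
      ¬ (M.eqProfit A i θ < M.profit A.price s i θ P ∧
        M.profit A.price s i θ.other P < M.eqProfit A i θ.other)

/-- Two assessments are the same equilibrium: the firms' strategies coincide, and beliefs and
consumer behaviour coincide almost surely on the equilibrium path. -/
structure SameOnPath (M : Market) (A A' : Assessment) : Prop where
  price_eq : A'.price = A.price
  belief_eq : ∀ i, ∀ᵐ P ∂(M.mix A.price i), A'.belief i P = A.belief i P
  buy_eq : ∀ᵐ P ∂(M.mix A.price .X), ∀ᵐ Q ∂(M.mix A.price .Y), ∀ᵐ v ∂M.valuation,
    A'.buy v (priceProfile .X P Q) = A.buy v (priceProfile .X P Q)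

end Market

/-! Uniqueness. Optimal consumer choices are determined up to null sets of valuations, so an
equilibrium reduces to prices, beliefs and expected demands (`OfferEquilibrium`). Only the good-type
half of the Intuitive Criterion is needed, in the form of `not_separating_interval`: no interval of
prices can be free of bad types if belief one on it would attract the good type alone.

Suppose that both types are willing to charge `t`. If belief one just below `t` raised demand
discontinuously, the cheaper good type could separate: walking up from the bad type's cost to the
point where imitation starts to pay, the good type strictly gains there, because a price cut
accompanied by higher demand favours the lower cost (`not_demand_jump`). Hence belief one gains no
customers, which forces the quality premium to vanish at the marginal valuation
(`gap_eq_zero_of_no_gain`). So a pooled price loses everything to lower prices and takes everything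
from higher ones (`pooled_price`), and a bad price with belief zero also loses everything to lower
prices. Bad types therefore compete as Bertrand sellers: both cannot earn positive profit
(`not_bad_profits_pos_of_le`), and if one earns zero, both charge `c_B` (`bad_eq_dirac`).

Prices below `c_B` then carry belief one on the path, and by the Intuitive Criterion a good type
earns at least what belief one would give it at any price there. With `π(P) = P [1 - F_v(h⁻¹(P))]`,
the good types play an undercutting game in which `π(P)` is earned against a bad rival and against a
dearer good one (`MixedPricing`). It has no atoms below `c_B`, both firms earn the same profit, and
indifference determines the cdf (`cdf_eq`). Monotonicity of `π` on `[0, c_B]` is essential here.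
Letting the price tend to `c_B` gives the profit `(1 - μ₀) π(c_B)`, hence the lower end of the
support.

Existence. The distribution so obtained, with belief one exactly below `c_B`, is checked directly.
Beliefs are unique on the path as conditional probabilities, and they determine consumer behaviour
almost surely. -/

open Set Filter Topology

/-! ### Valuations, offers and the demand they generate -/

namespace Market

/-- The quality premium `h v - v`, extended from `[0, vbar]` to the line by constants. -/
noncomputable def gap (M : Market) (v : ℝ) : ℝ :=
  M.h (max 0 (min v M.vbar)) - max 0 (min v M.vbar)

/-- Surplus of valuation `v` from an offer with price `P` and belief `m`. -/
noncomputable def net (M : Market) (P m v : ℝ) : ℝ := m * M.gap v + v - P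

/-- Probability of taking an option worth `x` when the alternatives are worth `y` and `0`. -/
noncomputable def take (x y : ℝ) : ℝ :=
  if x < 0 then 0 else if y < x then 1 else if x = y then 1 / 2 else 0

/-- Mass of consumers that accept the offer `(P, m)` when the rival offer is `(Q, m')`. -/
noncomputable def share (M : Market) (P m Q m' : ℝ) : ℝ :=
  ∫ v, take (M.net P m v) (M.net Q m' v) ∂M.valuation

/-- Mass of consumers that weakly prefer the offer `(P, m)` to not buying. -/
noncomputable def reach (M : Market) (P m : ℝ) : ℝ := M.valuation.real {v | 0 ≤ M.net P m v}

theorem take_nonneg (x y : ℝ) : 0 ≤ take x y := by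
  unfold take; split_ifs <;> norm_num

theorem take_le_one (x y : ℝ) : take x y ≤ 1 := by
  unfold take; split_ifs <;> norm_num

theorem take_mono {x x' y y' : ℝ} (hx : x ≤ x') (hy : y' ≤ y) : take x y ≤ take x' y' := by
  unfold take; split_ifs <;> first | (norm_num; done) | grind

theorem take_add (x y : ℝ) : take x y + take y x = if 0 ≤ max x y then 1 else 0 := by
  unfold take
  grind

theorem take_eq_one {x y : ℝ} (hx : 0 ≤ x) (hy : y < x) : take x y = 1 := by
  simp [take, hx.not_gt, hy]

theorem take_eq_zero_of_neg {x y : ℝ} (hx : x < 0) : take x y = 0 := by simp [take, hx]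

theorem take_eq_zero_of_lt {x y : ℝ} (h : x < y) : take x y = 0 := by
  simp [take, h.not_gt, h.ne]

theorem measurable_take : Measurable fun z : ℝ × ℝ => take z.1 z.2 := by
  unfold take
  refine Measurable.ite (measurableSet_lt measurable_fst measurable_const) measurable_const ?_
  refine Measurable.ite (measurableSet_lt measurable_snd measurable_fst) measurable_const ?_
  exact Measurable.ite (measurableSet_eq_fun measurable_fst measurable_snd) measurable_const
    measurable_const

variable {M : Market}

theorem NegCorr.vbar_pos (hM : M.NegCorr) : 0 < M.vbar := hM.cost_B_pos.trans hM.cost_B_lt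

theorem NegCorr.clamp_mem (hM : M.NegCorr) (v : ℝ) : max 0 (min v M.vbar) ∈ Icc 0 M.vbar :=
  ⟨le_max_left _ _, max_le hM.vbar_pos.le (min_le_right _ _)⟩

theorem gap_eq {v : ℝ} (hv : v ∈ Icc 0 M.vbar) : M.gap v = M.h v - v := by
  simp [gap, min_eq_left hv.2, max_eq_right hv.1]

theorem NegCorr.gap_continuous (hM : M.NegCorr) : Continuous M.gap := by
  have hc : Continuous fun v : ℝ => max 0 (min v M.vbar) := by fun_prop
  exact (hM.h_diff.continuousOn.comp_continuous hc hM.clamp_mem).sub hc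

/-- The condition `h' ≥ 1` makes the derivative of `h v - v` nonnegative, and clamping preserves
monotonicity. Sets of consumers attracted by a better belief are up-sets for this reason. -/
theorem NegCorr.gap_mono (hM : M.NegCorr) : Monotone M.gap := by
  have hI : MonotoneOn (fun v => M.h v - v) (Icc 0 M.vbar) := by
    refine monotoneOn_of_deriv_nonneg (convex_Icc _ _)
      (hM.h_diff.continuousOn.sub continuousOn_id) ?_ ?_
    · rw [interior_Icc]
      exact (hM.h_diff.mono Ioo_subset_Icc_self).sub differentiableOn_id
    · rw [interior_Icc]
      intro x hx
      have hn : Icc 0 M.vbar ∈ 𝓝 x := Icc_mem_nhds hx.1 hx.2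
      have hd : DifferentiableAt ℝ M.h x := (hM.h_diff x (Ioo_subset_Icc_self hx)).differentiableAt hn
      have h1 := hM.h_deriv x (Ioo_subset_Icc_self hx)
      rw [derivWithin_of_mem_nhds hn] at h1
      have : deriv (fun v => M.h v - v) x = deriv M.h x - 1 := by
        simpa using deriv_fun_sub hd differentiableAt_fun_id
      rw [this]; linarith
  intro a b hab
  exact hI (hM.clamp_mem a) (hM.clamp_mem b) (max_le_max le_rfl (min_le_min_right _ hab))

theorem NegCorr.gap_nonneg (hM : M.NegCorr) (v : ℝ) : 0 ≤ M.gap v := by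
  have := hM.h_ge _ (hM.clamp_mem v)
  unfold gap; linarith

theorem NegCorr.gap_zero_le (hM : M.NegCorr) : M.gap 0 ≤ M.cost .B := by
  rw [gap_eq ⟨le_rfl, hM.vbar_pos.le⟩]; simpa using hM.h_zero

theorem NegCorr.vbar_lt_Pmax (hM : M.NegCorr) : M.vbar < M.Pmax := hM.h_vbar.trans hM.Pmax_gt

theorem NegCorr.net_continuous (hM : M.NegCorr) (P m : ℝ) : Continuous (M.net P m) := by
  have := hM.gap_continuous
  unfold net; fun_prop

theorem NegCorr.measurable_net (hM : M.NegCorr) :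
    Measurable fun z : ℝ × ℝ × ℝ => M.net z.1 z.2.1 z.2.2 := by
  have := hM.gap_continuous.measurable
  unfold net; fun_prop

theorem NegCorr.net_strictMono (hM : M.NegCorr) (P : ℝ) {m : ℝ} (hm : 0 ≤ m) :
    StrictMono (M.net P m) := by
  intro a b hab
  have := mul_le_mul_of_nonneg_left (hM.gap_mono hab.le) hm
  unfold net; linarith

theorem NegCorr.net_le_net (hM : M.NegCorr) {P Q m m' : ℝ} (hP : Q ≤ P) (hm : m ≤ m') (v : ℝ) :
    M.net P m v ≤ M.net Q m' v := by
  have := mul_le_mul_of_nonneg_right hm (hM.gap_nonneg v)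
  unfold net; linarith

theorem NegCorr.net_lt_net (hM : M.NegCorr) {P Q m m' : ℝ} (hP : Q < P) (hm : m ≤ m') (v : ℝ) :
    M.net P m v < M.net Q m' v := by
  have := mul_le_mul_of_nonneg_right hm (hM.gap_nonneg v)
  unfold net; linarith

theorem NegCorr.valuation_univ (hM : M.NegCorr) : M.valuation univ = 1 := by
  have hint : IntegrableOn M.f (Icc 0 M.vbar) := hM.f_cont.integrableOn_Icc
  rw [valuation, withDensity_apply _ MeasurableSet.univ, Measure.restrict_univ,
    ← ofReal_integral_eq_lintegral_ofReal hint, integral_Icc_eq_integral_Ioc,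
    ← intervalIntegral.integral_of_le hM.vbar_pos.le, hM.f_int, ENNReal.ofReal_one]
  exact (ae_restrict_iff' measurableSet_Icc).2 (ae_of_all _ fun v hv => (hM.f_pos v hv).le)

theorem NegCorr.isProbabilityMeasure (hM : M.NegCorr) : IsProbabilityMeasure M.valuation :=
  ⟨hM.valuation_univ⟩

theorem valuation_absolutelyContinuous : M.valuation ≪ volume :=
  (withDensity_absolutelyContinuous _ _).trans Measure.restrict_le_self.absolutelyContinuous

theorem valuation_singleton (v : ℝ) : M.valuation {v} = 0 :=
  valuation_absolutelyContinuous (by simp)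

theorem ae_mem_Icc : ∀ᵐ v ∂M.valuation, v ∈ Icc 0 M.vbar :=
  (withDensity_absolutelyContinuous _ _).ae_le (ae_restrict_mem measurableSet_Icc)

theorem ae_ne (a : ℝ) : ∀ᵐ v ∂M.valuation, v ≠ a := by
  simpa [ae_iff] using valuation_singleton (M := M) a

theorem NegCorr.valuation_Ioo_pos (hM : M.NegCorr) {a b : ℝ} (ha : 0 ≤ a) (hab : a < b)
    (hb : b ≤ M.vbar) : 0 < M.valuation (Ioo a b) := by
  rw [pos_iff_ne_zero]
  intro h0
  have hsub : Ioo a b ⊆ Icc 0 M.vbar := fun x hx => ⟨ha.trans hx.1.le, hx.2.le.trans hb⟩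
  have hae : ∀ᵐ v ∂M.valuation, v ∉ Ioo a b := measure_eq_zero_iff_ae_notMem.1 h0
  have hint : AEMeasurable (fun v => ENNReal.ofReal (M.f v)) (volume.restrict (Icc 0 M.vbar)) :=
    (hM.f_cont.aemeasurable measurableSet_Icc).ennreal_ofReal
  rw [valuation, ae_withDensity_iff' hint, ae_restrict_iff' measurableSet_Icc] at hae
  have : ∀ᵐ v ∂(volume : Measure ℝ), v ∉ Ioo a b := by
    filter_upwards [hae] with v hv hmem
    exact hv (hsub hmem) (by simpa using hM.f_pos v (hsub hmem)) hmem
  have h2 : volume (Ioo a b) = 0 := measure_eq_zero_iff_ae_notMem.2 this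
  simp [hab.not_ge] at h2

theorem NegCorr.valuation_pos_of_isOpen (hM : M.NegCorr) {U : Set ℝ} (hU : IsOpen U) {v : ℝ}
    (hv : v ∈ Icc 0 M.vbar) (hvU : v ∈ U) : 0 < M.valuation U := by
  obtain ⟨ε, hε, hb⟩ := Metric.isOpen_iff.1 hU v hvU
  rw [Real.ball_eq_Ioo] at hb
  have hvb := hM.vbar_pos
  refine lt_of_lt_of_le (hM.valuation_Ioo_pos (a := max 0 (v - ε)) (b := min M.vbar (v + ε))
    (le_max_left _ _) ?_ (min_le_left _ _)) (measure_mono fun x hx => hb ?_)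
  · rw [max_lt_iff, lt_min_iff, lt_min_iff]
    exact ⟨⟨hvb, by linarith [hv.1]⟩, by linarith [hv.2], by linarith⟩
  · exact ⟨(le_max_right _ _).trans_lt hx.1, hx.2.trans_le (min_le_right _ _)⟩

/-- A property that holds almost surely and is closed holds for every valuation. -/
theorem NegCorr.forall_of_ae_isClosed (hM : M.NegCorr) {C : Set ℝ} (hC : IsClosed C)
    (h : ∀ᵐ v ∂M.valuation, v ∈ C) {v : ℝ} (hv : v ∈ Icc 0 M.vbar) : v ∈ C := by
  by_contra hvC
  exact (hM.valuation_pos_of_isOpen hC.isOpen_compl hv hvC).ne' h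

/-- Surplus is strictly increasing in the valuation, so at most one valuation is indifferent to not
buying, and valuations have no atoms. The tie with the outside option, which the model leaves open,
thus never matters. -/
theorem NegCorr.ae_net_ne_zero (hM : M.NegCorr) (P : ℝ) {m : ℝ} (hm : 0 ≤ m) :
    ∀ᵐ v ∂M.valuation, M.net P m v ≠ 0 := by
  by_cases h : ∃ a, M.net P m a = 0
  · obtain ⟨a, ha⟩ := h
    filter_upwards [ae_ne a] with v hv h0
    exact hv ((hM.net_strictMono P hm).injective (h0.trans ha.symm))
  · exact ae_of_all _ fun v hv => h ⟨v, hv⟩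

theorem NegCorr.measurable_take_net (hM : M.NegCorr) (P m Q m' : ℝ) :
    Measurable fun v => take (M.net P m v) (M.net Q m' v) :=
  measurable_take.comp ((hM.net_continuous P m).measurable.prodMk (hM.net_continuous Q m').measurable)

theorem NegCorr.integrable_take_net (hM : M.NegCorr) (P m Q m' : ℝ) :
    Integrable (fun v => take (M.net P m v) (M.net Q m' v)) M.valuation := by
  have := hM.isProbabilityMeasure
  refine Integrable.of_bound (hM.measurable_take_net P m Q m').aestronglyMeasurable 1
    (ae_of_all _ fun v => ?_)
  rw [Real.norm_of_nonneg (take_nonneg _ _)]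
  exact take_le_one _ _

theorem share_nonneg (P m Q m' : ℝ) : 0 ≤ M.share P m Q m' :=
  integral_nonneg fun _ => take_nonneg _ _

theorem NegCorr.share_le_one (hM : M.NegCorr) (P m Q m' : ℝ) : M.share P m Q m' ≤ 1 := by
  have := hM.isProbabilityMeasure
  calc M.share P m Q m' ≤ ∫ _, (1 : ℝ) ∂M.valuation :=
        integral_mono (hM.integrable_take_net _ _ _ _) (integrable_const _) fun _ => take_le_one _ _
    _ = 1 := by simp

theorem NegCorr.measurable_share (hM : M.NegCorr) :
    Measurable fun z : ℝ × ℝ × ℝ × ℝ => M.share z.1 z.2.1 z.2.2.1 z.2.2.2 := by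
  have := hM.isProbabilityMeasure
  have hm : Measurable fun w : (ℝ × ℝ × ℝ × ℝ) × ℝ =>
      take (M.net w.1.1 w.1.2.1 w.2) (M.net w.1.2.2.1 w.1.2.2.2 w.2) := by
    refine measurable_take.comp (Measurable.prodMk ?_ ?_)
    · exact hM.measurable_net.comp (by fun_prop :
        Measurable fun w : (ℝ × ℝ × ℝ × ℝ) × ℝ => (w.1.1, w.1.2.1, w.2))
    · exact hM.measurable_net.comp (by fun_prop :
        Measurable fun w : (ℝ × ℝ × ℝ × ℝ) × ℝ => (w.1.2.2.1, w.1.2.2.2, w.2))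
  exact (hm.stronglyMeasurable.integral_prod_right').measurable

theorem NegCorr.share_mono (hM : M.NegCorr) {P P' m m₁ Q Q' m' m₁' : ℝ} (hP : P' ≤ P) (hm : m ≤ m₁)
    (hQ : Q ≤ Q') (hm' : m₁' ≤ m') : M.share P m Q m' ≤ M.share P' m₁ Q' m₁' :=
  integral_mono (hM.integrable_take_net _ _ _ _) (hM.integrable_take_net _ _ _ _) fun v =>
    take_mono (hM.net_le_net hP hm v) (hM.net_le_net hQ hm' v)

theorem NegCorr.measurableSet_reach (hM : M.NegCorr) (P m : ℝ) :
    MeasurableSet {v | 0 ≤ M.net P m v} :=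
  (isClosed_le continuous_const (hM.net_continuous P m)).measurableSet

theorem NegCorr.reach_eq_integral (hM : M.NegCorr) (P m : ℝ) :
    M.reach P m = ∫ v, (if 0 ≤ M.net P m v then 1 else 0 : ℝ) ∂M.valuation := by
  rw [reach, ← integral_indicator_one (hM.measurableSet_reach P m)]
  rfl

theorem NegCorr.share_of_lt (hM : M.NegCorr) {P Q m m' : ℝ} (hP : P < Q) (hm : m' ≤ m) :
    M.share P m Q m' = M.reach P m := by
  rw [hM.reach_eq_integral, share]
  congr 1; ext v
  split_ifs with h
  · exact take_eq_one h (hM.net_lt_net hP hm v)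
  · exact take_eq_zero_of_neg (not_le.1 h)

theorem NegCorr.share_eq_zero_of_lt (hM : M.NegCorr) {P Q m m' : ℝ} (hP : Q < P) (hm : m ≤ m') :
    M.share P m Q m' = 0 := by
  rw [share]
  simp [take_eq_zero_of_lt (hM.net_lt_net hP hm _)]

theorem NegCorr.share_self (hM : M.NegCorr) (P m : ℝ) : M.share P m P m = M.reach P m / 2 := by
  rw [hM.reach_eq_integral, share, ← integral_div]
  congr 1; ext v
  split_ifs with h
  · simp [take, h]
  · simp [take, not_le.1 h]

theorem NegCorr.share_add_share (hM : M.NegCorr) (P m Q m' : ℝ) :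
    M.share P m Q m' + M.share Q m' P m =
      M.valuation.real {v | 0 ≤ max (M.net P m v) (M.net Q m' v)} := by
  have hs : MeasurableSet {v | 0 ≤ max (M.net P m v) (M.net Q m' v)} :=
    (isClosed_le continuous_const
      ((hM.net_continuous P m).max (hM.net_continuous Q m'))).measurableSet
  rw [← integral_indicator_one hs, share, share,
    ← integral_add (hM.integrable_take_net _ _ _ _) (hM.integrable_take_net _ _ _ _)]
  congr 1; ext v
  rw [take_add]; rfl

theorem NegCorr.share_pos (hM : M.NegCorr) {P m Q m' v : ℝ} (hv : v ∈ Icc 0 M.vbar)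
    (h0 : 0 < M.net P m v) (h1 : M.net Q m' v < M.net P m v) : 0 < M.share P m Q m' := by
  have := hM.isProbabilityMeasure
  set U : Set ℝ := {v | 0 < M.net P m v} ∩ {v | M.net Q m' v < M.net P m v}
  have hU : IsOpen U := (isOpen_lt continuous_const (hM.net_continuous P m)).inter
    (isOpen_lt (hM.net_continuous Q m') (hM.net_continuous P m))
  have hpos : 0 < M.valuation.real U :=
    ENNReal.toReal_pos (hM.valuation_pos_of_isOpen hU hv ⟨h0, h1⟩).ne' (measure_ne_top _ _)
  refine hpos.trans_le ?_
  rw [← integral_indicator_one hU.measurableSet]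
  refine integral_mono ((integrable_const 1).indicator hU.measurableSet)
    (hM.integrable_take_net _ _ _ _) fun w => ?_
  by_cases hw : w ∈ U
  · simp [hw, take_eq_one hw.1.le hw.2]
  · simp [hw, take_nonneg]

theorem NegCorr.net_le_of_share_eq_zero (hM : M.NegCorr) {P m Q m' v : ℝ}
    (h : M.share P m Q m' = 0) (hv : v ∈ Icc 0 M.vbar) (h0 : 0 < M.net P m v) :
    M.net P m v ≤ M.net Q m' v := by
  by_contra hlt
  exact (hM.share_pos hv h0 (not_le.1 hlt)).ne' h

theorem NegCorr.reach_pos (hM : M.NegCorr) {P m : ℝ} (hm : 0 ≤ m) (hP : P < M.vbar) :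
    0 < M.reach P m := by
  have := hM.isProbabilityMeasure
  have hU : IsOpen {v | 0 < M.net P m v} := isOpen_lt continuous_const (hM.net_continuous P m)
  have hv : M.vbar ∈ Icc 0 M.vbar := ⟨hM.vbar_pos.le, le_rfl⟩
  have h0 : 0 < M.net P m M.vbar := by
    have := mul_nonneg hm (hM.gap_nonneg M.vbar)
    unfold net; linarith
  refine (ENNReal.toReal_pos (hM.valuation_pos_of_isOpen hU hv h0).ne' (measure_ne_top _ _)).trans_le ?_
  exact measureReal_mono fun w (hw : 0 < M.net P m w) => hw.le

/-- The highest valuations buy from somebody. This rules out that two bad types both charge less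
than their cost, since each would then have to sell nothing. -/
theorem NegCorr.share_add_share_pos (hM : M.NegCorr) {P m Q m' : ℝ} (hm : 0 ≤ m)
    (hP : P < M.vbar) : 0 < M.share P m Q m' + M.share Q m' P m := by
  have := hM.isProbabilityMeasure
  rw [hM.share_add_share]
  refine (hM.reach_pos hm hP).trans_le (measureReal_mono fun w (hw : 0 ≤ M.net P m w) => ?_)
  exact le_max_of_le_left hw

theorem NegCorr.reach_anti (hM : M.NegCorr) (m : ℝ) : Antitone fun P => M.reach P m := by
  have := hM.isProbabilityMeasure
  intro P Q hPQ
  exact measureReal_mono fun v hv => le_trans hv (hM.net_le_net hPQ le_rfl v)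

theorem reach_nonneg (P m : ℝ) : 0 ≤ M.reach P m := measureReal_nonneg

theorem NegCorr.continuous_reach (hM : M.NegCorr) {m : ℝ} (hm : 0 ≤ m) :
    Continuous fun P => M.reach P m := by
  have := hM.isProbabilityMeasure
  simp_rw [hM.reach_eq_integral]
  refine continuous_iff_continuousAt.2 fun P => continuousAt_of_dominated (bound := fun _ => 1) ?_ ?_
    (integrable_const _) ?_
  · refine Eventually.of_forall fun Q => Measurable.aestronglyMeasurable ?_
    exact Measurable.ite (hM.measurableSet_reach Q m) measurable_const measurable_const
  · refine Eventually.of_forall fun Q => ae_of_all _ fun v => ?_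
    split_ifs <;> simp
  -- Away from the marginal valuation the purchase decision is locally constant in the price.
  · filter_upwards [hM.ae_net_ne_zero P hm] with v hv
    have hc : Continuous fun Q => M.net Q m v := by unfold net; fun_prop
    rcases lt_or_gt_of_ne hv with h | h
    · refine (continuousAt_const (y := (0 : ℝ))).congr ?_
      filter_upwards [hc.continuousAt.eventually (gt_mem_nhds h)] with Q hQ
      simp [not_le.2 hQ]
    · refine (continuousAt_const (y := (1 : ℝ))).congr ?_
      filter_upwards [hc.continuousAt.eventually (lt_mem_nhds h)] with Q hQ
      simp [hQ.le]

/-- The set in the definition of `hInv` is an up-set, so `1 - F ∘ hInv` is the demand at belief 1. -/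
theorem NegCorr.one_sub_F_hInv (hM : M.NegCorr) {P : ℝ} (hP : P ≤ M.h M.vbar) :
    1 - M.F (M.hInv P) = M.reach P 1 := by
  have := hM.isProbabilityMeasure
  have hF : 1 - M.F (M.hInv P) = M.valuation.real (Ioi (M.hInv P)) := by
    rw [F, ← compl_Iic, measureReal_compl measurableSet_Iic, probReal_univ]
  rw [hF, reach]
  have hnet : ∀ v ∈ Icc 0 M.vbar, (0 ≤ M.net P 1 v ↔ P ≤ M.h v) := by
    intro v hv
    rw [net, gap_eq hv]; constructor <;> intro h <;> linarith
  have hne : {v ∈ Icc 0 M.vbar | P ≤ M.h v}.Nonempty := ⟨M.vbar, ⟨hM.vbar_pos.le, le_rfl⟩, hP⟩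
  have hbb : BddBelow {v ∈ Icc 0 M.vbar | P ≤ M.h v} := ⟨0, fun v hv => hv.1.1⟩
  refine measureReal_congr ?_
  filter_upwards [ae_mem_Icc, ae_ne (M.hInv P)] with v hv hvne
  refine propext ⟨fun h => ?_, fun h => ?_⟩
  · obtain ⟨w, hw, hwv⟩ := exists_lt_of_csInf_lt hne h
    exact ((hnet w hw.1).2 hw.2).trans ((hM.net_strictMono P zero_le_one).monotone hwv.le)
  · exact lt_of_le_of_ne (csInf_le hbb ⟨hv, (hnet v hv).1 h⟩) hvne.symm

theorem NegCorr.cost_le_h_vbar (hM : M.NegCorr) : M.cost .B ≤ M.h M.vbar :=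
  (hM.cost_B_lt.trans hM.h_vbar).le

theorem NegCorr.strictMonoOn_reach (hM : M.NegCorr) :
    StrictMonoOn (fun P => P * M.reach P 1) (Icc 0 (M.cost .B)) := by
  refine hM.profit_mono.congr fun P hP => ?_
  simp only [hM.one_sub_F_hInv (hP.2.trans hM.cost_le_h_vbar)]

end Market

/-! ### Optimal consumer behaviour expressed through market shares -/

@[simp] theorem Firm.other_other (i : Firm) : i.other.other = i := by cases i <;> rfl

theorem Firm.other_ne (i : Firm) : i.other ≠ i := by cases i <;> simp [Firm.other]

@[simp] theorem priceProfile_self (i : Firm) (P Q : ℝ) : priceProfile i P Q i = P := by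
  simp [priceProfile]

@[simp] theorem priceProfile_other (i : Firm) (P Q : ℝ) : priceProfile i P Q i.other = Q := by
  simp [priceProfile, i.other_ne]

theorem forall_priceProfile {i : Firm} {P Q : ℝ} {p : ℝ → Prop} (hP : p P) (hQ : p Q) (k : Firm) :
    p (priceProfile i P Q k) := by
  unfold priceProfile; split_ifs <;> assumption

namespace Market

variable {M : Market}

/-- Expected demand for the offer `(P, m)` when the rival's price has law `τ` and is
interpreted through `β`. -/
noncomputable def expDemand (M : Market) (τ : Measure ℝ) (β : ℝ → ℝ) (P m : ℝ) : ℝ :=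
  ∫ Q, M.share P m Q (β Q) ∂τ

theorem NegCorr.measurable_share_rival (hM : M.NegCorr) {β : ℝ → ℝ} (hβ : Measurable β) (P m : ℝ) :
    Measurable fun Q => M.share P m Q (β Q) :=
  hM.measurable_share.comp (measurable_const.prodMk (measurable_const.prodMk
    (measurable_id.prodMk hβ)))

theorem NegCorr.measurable_share_pair (hM : M.NegCorr) {β β' : ℝ → ℝ} (hβ : Measurable β)
    (hβ' : Measurable β') : Measurable fun z : ℝ × ℝ => M.share z.1 (β z.1) z.2 (β' z.2) :=
  hM.measurable_share.comp (measurable_fst.prodMk ((hβ.comp measurable_fst).prodMk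
    (measurable_snd.prodMk (hβ'.comp measurable_snd))))

theorem NegCorr.integrable_share (hM : M.NegCorr) (τ : Measure ℝ) [IsFiniteMeasure τ] {β : ℝ → ℝ}
    (hβ : Measurable β) (P m : ℝ) : Integrable (fun Q => M.share P m Q (β Q)) τ := by
  refine Integrable.of_bound (hM.measurable_share_rival hβ P m).aestronglyMeasurable 1
    (ae_of_all _ fun v => ?_)
  rw [Real.norm_of_nonneg (share_nonneg _ _ _ _)]
  exact hM.share_le_one _ _ _ _

theorem expDemand_nonneg (τ : Measure ℝ) (β : ℝ → ℝ) (P m : ℝ) : 0 ≤ M.expDemand τ β P m :=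
  integral_nonneg fun _ => share_nonneg _ _ _ _

theorem NegCorr.expDemand_le_one (hM : M.NegCorr) (τ : Measure ℝ) [IsProbabilityMeasure τ]
    {β : ℝ → ℝ} (hβ : Measurable β) (P m : ℝ) : M.expDemand τ β P m ≤ 1 := by
  calc M.expDemand τ β P m ≤ ∫ _, (1 : ℝ) ∂τ :=
        integral_mono (hM.integrable_share τ hβ P m) (integrable_const _)
          fun _ => hM.share_le_one _ _ _ _
    _ = 1 := by simp

theorem NegCorr.expDemand_mono (hM : M.NegCorr) (τ : Measure ℝ) [IsFiniteMeasure τ]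
    {β : ℝ → ℝ} (hβ : Measurable β) {P P' m m' : ℝ} (hP : P' ≤ P) (hm : m ≤ m') :
    M.expDemand τ β P m ≤ M.expDemand τ β P' m' :=
  integral_mono (hM.integrable_share τ hβ P m) (hM.integrable_share τ hβ P' m')
    fun _ => hM.share_mono hP hm le_rfl le_rfl

theorem NegCorr.ae_share_eq_zero (hM : M.NegCorr) {τ : Measure ℝ} [IsFiniteMeasure τ]
    {β : ℝ → ℝ} (hβ : Measurable β) {P m : ℝ} (h : M.expDemand τ β P m = 0) :
    ∀ᵐ Q ∂τ, M.share P m Q (β Q) = 0 :=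
  (integral_eq_zero_iff_of_nonneg (fun _ => share_nonneg _ _ _ _)
    (hM.integrable_share τ hβ P m)).1 h

theorem NegCorr.measurable_expDemand (hM : M.NegCorr) (τ : Measure ℝ) [IsFiniteMeasure τ]
    {β β' : ℝ → ℝ} (hβ : Measurable β) (hβ' : Measurable β') :
    Measurable fun P => M.expDemand τ β P (β' P) :=
  ((hM.measurable_share_pair hβ' hβ).stronglyMeasurable.integral_prod_right').measurable

theorem surplus_eq_net {β : Firm → ℝ → ℝ} {v : ℝ} (hv : v ∈ Icc 0 M.vbar) (p : Firm → ℝ)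
    (i : Firm) : M.surplus β v p (some i) = M.net (p i) (β i (p i)) v := by
  simp only [surplus, net, gap_eq hv]; ring

theorem IsConsumerBR.sum_other {β : Firm → ℝ → ℝ} {s : ConsumerStrategy} (hs : M.IsConsumerBR β s)
    (i : Firm) (v : ℝ) (p : Firm → ℝ) :
    s v p none + s v p (some i) + s v p (some i.other) = 1 := by
  have := hs.sum_one v p
  cases i <;> simp only [Firm.other] <;> linarith

/-- Optimality and equal splitting leave freedom only where the offer is worth exactly zero, so all
best replies generate the same demand. -/
theorem IsConsumerBR.buy_eq_take {β : Firm → ℝ → ℝ} {s : ConsumerStrategy}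
    (hs : M.IsConsumerBR β s) {v : ℝ} (hv : v ∈ Icc 0 M.vbar) {p : Firm → ℝ}
    (hp : ∀ i, p i ∈ Icc 0 M.Pmax) (i : Firm) (h0 : M.net (p i) (β i (p i)) v ≠ 0) :
    s v p (some i) =
      take (M.net (p i) (β i (p i)) v) (M.net (p i.other) (β i.other (p i.other)) v) := by
  have hopt := hs.optimal v hv p hp
  have hsplit := hs.split v hv p hp
  have hsum := hs.sum_other i v p
  have hn := hs.nonneg v p none
  have hi := hs.nonneg v p (some i)
  have hj := hs.nonneg v p (some i.other)
  rw [← surplus_eq_net hv] at h0 ⊢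
  rw [← surplus_eq_net hv]
  have hpos : ∀ a b, M.surplus β v p a < M.surplus β v p b → s v p a = 0 := by
    intro a b hab
    by_contra hne
    exact absurd (hopt a (lt_of_le_of_ne (hs.nonneg v p a) (Ne.symm hne)) b) (not_le.2 hab)
  have hnone : M.surplus β v p none = 0 := rfl
  rcases lt_or_gt_of_ne h0 with h | h
  · rw [take_eq_zero_of_neg h, hpos _ none (by rwa [hnone])]
  · have h1 : s v p none = 0 := hpos none (some i) (by rwa [hnone])
    rcases lt_trichotomy (M.surplus β v p (some i)) (M.surplus β v p (some i.other)) with h2 | h2 | h2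
    · rw [take_eq_zero_of_lt h2, hpos _ _ h2]
    · have : s v p (some i) = s v p (some i.other) := by
        cases i
        · exact hsplit h2
        · exact (hsplit h2.symm).symm
      rw [← h2]
      simp only [take, h.not_gt, lt_irrefl, if_false, if_true]
      linarith
    · rw [take_eq_one h.le h2]
      have := hpos _ _ h2
      linarith

theorem IsConsumerBR.demand_eq_share (hM : M.NegCorr) {β : Firm → ℝ → ℝ} {s : ConsumerStrategy}
    (hs : M.IsConsumerBR β s) (hβ : ∀ i P, 0 ≤ β i P) (i : Firm) {P Q : ℝ}
    (hP : P ∈ Icc 0 M.Pmax) (hQ : Q ∈ Icc 0 M.Pmax) :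
    M.demand s i (priceProfile i P Q) = M.share P (β i P) Q (β i.other Q) := by
  unfold demand share
  refine integral_congr_ae ?_
  filter_upwards [ae_mem_Icc, hM.ae_net_ne_zero P (hβ i P)] with v hv h0
  have := hs.buy_eq_take hv (forall_priceProfile (i := i) hP hQ) i (by simpa using h0)
  simpa using this

theorem IsConsumerBR.profit_eq (hM : M.NegCorr) {β : Firm → ℝ → ℝ} {s : ConsumerStrategy}
    (hs : M.IsConsumerBR β s) (hβ : ∀ i P, 0 ≤ β i P) (σ : Firm → Quality → Measure ℝ) (i : Firm)
    (hσ : ∀ᵐ Q ∂M.mix σ i.other, Q ∈ Icc 0 M.Pmax) (θ : Quality) {P : ℝ} (hP : P ∈ Icc 0 M.Pmax) :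
    M.profit σ s i θ P =
      (P - M.cost θ) * M.expDemand (M.mix σ i.other) (β i.other) P (β i P) := by
  unfold profit expDemand
  congr 1
  refine integral_congr_ae ?_
  filter_upwards [hσ] with Q hQ
  exact hs.demand_eq_share hM hβ i hP hQ

/-- Consumer behaviour that takes the best offer, splitting ties evenly. -/
noncomputable def bestReply (M : Market) (β : Firm → ℝ → ℝ) : ConsumerStrategy := fun v p a =>
  match a with
  | some i => take (M.net (p i) (β i (p i)) v) (M.net (p i.other) (β i.other (p i.other)) v)
  | none => 1 - take (M.net (p .X) (β .X (p .X)) v) (M.net (p .Y) (β .Y (p .Y)) v)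
      - take (M.net (p .Y) (β .Y (p .Y)) v) (M.net (p .X) (β .X (p .X)) v)

theorem NegCorr.isConsumerBR_bestReply (hM : M.NegCorr) {β : Firm → ℝ → ℝ}
    (hβ : ∀ i, Measurable (β i)) : M.IsConsumerBR β (M.bestReply β) := by
  have hnet : ∀ i, Measurable fun x : ℝ × (Firm → ℝ) => M.net (x.2 i) (β i (x.2 i)) x.1 := by
    intro i
    have h1 : Measurable fun x : ℝ × (Firm → ℝ) => x.2 i := (measurable_pi_apply i).comp measurable_snd
    exact hM.measurable_net.comp (h1.prodMk (((hβ i).comp h1).prodMk measurable_fst))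
  have htake : ∀ i j, Measurable fun x : ℝ × (Firm → ℝ) =>
      take (M.net (x.2 i) (β i (x.2 i)) x.1) (M.net (x.2 j) (β j (x.2 j)) x.1) := fun i j =>
    measurable_take.comp ((hnet i).prodMk (hnet j))
  have hadd : ∀ x y : ℝ, take x y + take y x ≤ 1 := by
    intro x y; rw [take_add]; split_ifs <;> norm_num
  refine ⟨?_, ?_, ?_, ?_, ?_⟩
  · rintro (_ | i)
    · exact (measurable_const.sub (htake .X .Y)).sub (htake .Y .X)
    · exact htake i i.other
  · rintro v p (_ | i)
    · have := hadd (M.net (p .X) (β .X (p .X)) v) (M.net (p .Y) (β .Y (p .Y)) v)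
      simp only [bestReply]; linarith
    · exact take_nonneg _ _
  · intro v p; simp only [bestReply, Firm.other]; ring
  · rintro v hv p - a ha b
    have key : ∀ i, 0 < M.bestReply β v p (some i) → 0 ≤ M.surplus β v p (some i) ∧
        M.surplus β v p (some i.other) ≤ M.surplus β v p (some i) := by
      intro i hi
      simp only [bestReply] at hi
      rw [surplus_eq_net hv, surplus_eq_net hv]
      refine ⟨le_of_not_gt fun h => ?_, le_of_not_gt fun h => ?_⟩
      · rw [take_eq_zero_of_neg h] at hi; exact lt_irrefl _ hi
      · rw [take_eq_zero_of_lt h] at hi; exact lt_irrefl _ hi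
    have h00 : M.surplus β v p none = 0 := rfl
    rcases a with _ | i
    · have hneg : M.surplus β v p (some .X) < 0 ∧ M.surplus β v p (some .Y) < 0 := by
        rw [surplus_eq_net hv, surplus_eq_net hv]
        have h2 := take_add (M.net (p .X) (β .X (p .X)) v) (M.net (p .Y) (β .Y (p .Y)) v)
        simp only [bestReply] at ha
        rw [← max_lt_iff]
        by_contra hcon
        rw [if_pos (not_lt.1 hcon)] at h2
        linarith
      rcases b with _ | _ | _ <;> simp only [h00, le_refl, hneg.1.le, hneg.2.le]
    · obtain ⟨h1, h2⟩ := key i ha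
      rcases b with _ | k
      · exact h1
      · by_cases hk : k = i
        · rw [hk]
        · have : k = i.other := by cases i <;> cases k <;> simp_all [Firm.other]
          rw [this]; exact h2
  · intro v hv p _ h
    rw [surplus_eq_net hv, surplus_eq_net hv] at h
    simp only [bestReply, Firm.other, h]

/-! ### Equilibrium in terms of prices, beliefs and profits -/

theorem mix_ae_iff (hM : M.NegCorr) {σ : Firm → Quality → Measure ℝ} {i : Firm} {p : ℝ → Prop} :
    (∀ᵐ P ∂M.mix σ i, p P) ↔ (∀ᵐ P ∂σ i .G, p P) ∧ ∀ᵐ P ∂σ i .B, p P := by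
  have h1 : ENNReal.ofReal M.prior ≠ 0 := by simpa using hM.prior_pos
  have h2 : ENNReal.ofReal (1 - M.prior) ≠ 0 := by simpa using hM.prior_lt_one
  simp [mix, ae_iff, h1, h2, -ENNReal.ofReal_eq_zero]

theorem mix_real (hM : M.NegCorr) {σ : Firm → Quality → Measure ℝ}
    (hσ : ∀ i θ, IsProbabilityMeasure (σ i θ)) (i : Firm) (S : Set ℝ) :
    (M.mix σ i).real S = M.prior * (σ i .G).real S + (1 - M.prior) * (σ i .B).real S := by
  have := hM.prior_pos
  have := hM.prior_lt_one
  have := hσ i .G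
  have := hσ i .B
  rw [mix, measureReal_add_apply (ENNReal.mul_ne_top ENNReal.ofReal_ne_top (measure_ne_top _ _))
    (ENNReal.mul_ne_top ENNReal.ofReal_ne_top (measure_ne_top _ _))]
  simp only [measureReal_ennreal_smul_apply]
  rw [ENNReal.toReal_ofReal (by linarith), ENNReal.toReal_ofReal (by linarith)]

theorem isProbabilityMeasure_mix (hM : M.NegCorr) {σ : Firm → Quality → Measure ℝ}
    (hσ : ∀ i θ, IsProbabilityMeasure (σ i θ)) (i : Firm) : IsProbabilityMeasure (M.mix σ i) := by
  constructor
  simp only [mix, Measure.coe_add, Measure.coe_smul, Pi.add_apply, Pi.smul_apply, measure_univ,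
    smul_eq_mul, mul_one]
  rw [← ENNReal.ofReal_add hM.prior_pos.le (by linarith [hM.prior_lt_one])]
  simp

/-- Prices, beliefs and profits of a perfect Bayesian equilibrium in which no good type can
profitably separate, with the consumers' behaviour integrated out. -/
structure OfferEquilibrium (M : Market) (σ : Firm → Quality → Measure ℝ) (β : Firm → ℝ → ℝ)
    (U : Firm → Quality → ℝ) : Prop where
  prob : ∀ i θ, IsProbabilityMeasure (σ i θ)
  feasible : ∀ i θ, ∀ᵐ P ∂σ i θ, P ∈ Icc 0 M.Pmax
  measurable : ∀ i, Measurable (β i)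
  nonneg : ∀ i P, 0 ≤ β i P
  le_one : ∀ i P, β i P ≤ 1
  optimal : ∀ i θ, ∀ P ∈ Icc 0 M.Pmax,
    (P - M.cost θ) * M.expDemand (M.mix σ i.other) (β i.other) P (β i P) ≤ U i θ
  attained : ∀ i θ, ∀ᵐ P ∂σ i θ,
    (P - M.cost θ) * M.expDemand (M.mix σ i.other) (β i.other) P (β i P) = U i θ
  bayes : ∀ i, ∀ S : Set ℝ, MeasurableSet S →
    ∫ P in S, β i P ∂(M.mix σ i) = M.prior * (σ i .G).real S
  intuitive : ∀ i, ∀ P ∈ Icc 0 M.Pmax, P ∉ (M.mix σ i).support →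
    ¬ (U i .G < P * M.expDemand (M.mix σ i.other) (β i.other) P 1 ∧
      (P - M.cost .B) * M.expDemand (M.mix σ i.other) (β i.other) P 1 < U i .B)

theorem IsPBE.feasible {A : Assessment} (hA : M.IsPBE A) (i : Firm) (θ : Quality) :
    ∀ᵐ P ∂A.price i θ, P ∈ Icc 0 M.Pmax := hA.price_feasible i θ

theorem measurable_replaceBelief {β : Firm → ℝ → ℝ} (hβ : ∀ i, Measurable (β i)) (i : Firm)
    (P m : ℝ) (k : Firm) : Measurable (replaceBelief β i P m k) := by
  unfold replaceBelief
  by_cases hk : k = i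
  · simp only [hk, true_and]
    exact Measurable.ite (measurableSet_eq) measurable_const (hβ i)
  · simpa [hk] using hβ k

theorem replaceBelief_self (β : Firm → ℝ → ℝ) (i : Firm) (P m : ℝ) :
    replaceBelief β i P m i P = m := by simp [replaceBelief]

theorem replaceBelief_other (β : Firm → ℝ → ℝ) (i : Firm) (P m : ℝ) :
    replaceBelief β i P m i.other = β i.other := by
  ext; simp [replaceBelief, i.other_ne]

theorem replaceBelief_nonneg {β : Firm → ℝ → ℝ} (hβ : ∀ i P, 0 ≤ β i P) (i : Firm)
    (P : ℝ) {m : ℝ} (hm : 0 ≤ m) (k : Firm) (Q : ℝ) : 0 ≤ replaceBelief β i P m k Q := by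
  unfold replaceBelief; split_ifs
  exacts [hm, hβ _ _]

theorem IsPBE.offerEquilibrium (hM : M.NegCorr) {A : Assessment} (hA : M.IsPBE A)
    (hIC : M.PassesIntuitiveCriterion A) :
    M.OfferEquilibrium A.price A.belief (M.eqProfit A) := by
  have hprob := hA.price_prob
  have hfeas : ∀ i, ∀ᵐ Q ∂M.mix A.price i, Q ∈ Icc 0 M.Pmax := fun i =>
    (mix_ae_iff hM).2 ⟨hA.feasible i _, hA.feasible i _⟩
  have hnn : ∀ i P, 0 ≤ A.belief i P := fun i P => (hA.belief_mem i P).1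
  have hprofit := fun i θ P hP =>
    hA.consumer_optimal.profit_eq hM hnn A.price i (hfeas i.other) θ (P := P) hP
  have hmix := isProbabilityMeasure_mix hM hprob
  have hopt : ∀ i θ, ∀ P ∈ Icc 0 M.Pmax,
      (P - M.cost θ) * M.expDemand (M.mix A.price i.other) (A.belief i.other) P (A.belief i P)
        ≤ M.eqProfit A i θ := fun i θ P hP => by
    rw [← hprofit i θ P hP]; exact hA.firm_optimal i θ P hP
  refine ⟨hprob, hA.feasible, hA.belief_measurable, hnn, fun i P => (hA.belief_mem i P).2, hopt, ?_,
    hA.bayes, ?_⟩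
  · intro i θ
    set g : ℝ → ℝ := fun P =>
      (P - M.cost θ) * M.expDemand (M.mix A.price i.other) (A.belief i.other) P (A.belief i P)
    have hgm : Measurable g := (measurable_id.sub_const _).mul
      (hM.measurable_expDemand _ (hA.belief_measurable _) (hA.belief_measurable _))
    have hint : Integrable g (A.price i θ) := by
      refine Integrable.of_bound hgm.aestronglyMeasurable (M.Pmax + |M.cost θ|) ?_
      filter_upwards [hA.feasible i θ] with P hP
      rw [norm_mul, Real.norm_eq_abs, Real.norm_of_nonneg (expDemand_nonneg _ _ _ _)]
      have h1 := hM.expDemand_le_one (M.mix A.price i.other) (hA.belief_measurable i.other) P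
        (A.belief i P)
      have h2 : |P - M.cost θ| ≤ M.Pmax + |M.cost θ| := by
        refine (abs_sub _ _).trans ?_
        rw [abs_of_nonneg hP.1]; linarith [hP.2]
      calc _ ≤ |P - M.cost θ| * 1 := mul_le_mul_of_nonneg_left h1 (abs_nonneg _)
        _ ≤ _ := by simpa using h2
    have hEq : M.eqProfit A i θ = ∫ P, g P ∂A.price i θ := by
      refine integral_congr_ae ?_
      filter_upwards [hA.feasible i θ] with P hP using hprofit i θ P hP
    -- Equilibrium profit is the mean of `g` and also an upper bound for it on feasible prices, so
    -- `g` attains it almost surely.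
    have hz : ∫ P, (M.eqProfit A i θ - g P) ∂A.price i θ = 0 := by
      rw [integral_sub (integrable_const _) hint, ← hEq]; simp
    have h0 : 0 ≤ᵐ[A.price i θ] fun P => M.eqProfit A i θ - g P := by
      filter_upwards [hA.feasible i θ] with P hP using sub_nonneg.2 (hopt i θ P hP)
    have := (integral_eq_zero_iff_of_nonneg_ae h0 ((integrable_const _).sub hint)).1 hz
    filter_upwards [this] with P hP
    exact (sub_eq_zero.1 hP).symm
  · rintro i P hP hsupp ⟨h1, h2⟩
    -- The criterion speaks about consumer best replies to the replaced belief, so an actual one has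
    -- to be exhibited.
    have hs := hM.isConsumerBR_bestReply (measurable_replaceBelief hA.belief_measurable i P 1)
    have hpr := fun θ => hs.profit_eq hM (replaceBelief_nonneg hnn i P zero_le_one) A.price i
      (hfeas i.other) θ hP
    simp only [replaceBelief_self, replaceBelief_other] at hpr
    refine hIC i .G P hP hsupp _ hs ⟨?_, ?_⟩
    · rw [hpr, hM.cost_G, sub_zero]; exact h1
    · rw [Quality.other, hpr]; exact h2

namespace OfferEquilibrium

variable {σ : Firm → Quality → Measure ℝ} {β : Firm → ℝ → ℝ} {U : Firm → Quality → ℝ}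

theorem isProbabilityMeasure (h : M.OfferEquilibrium σ β U) (hM : M.NegCorr) (i : Firm) :
    IsProbabilityMeasure (M.mix σ i) := isProbabilityMeasure_mix hM h.prob i

/-- Bayes' rule makes the belief the density of the good type's share in the price mixture. Null
sets of one type can then be read off the mixture: the good type charges where the belief is not
zero, the bad type where it is not one. -/
theorem withDensity_belief (h : M.OfferEquilibrium σ β U) (hM : M.NegCorr) (i : Firm) :
    (M.mix σ i).withDensity (fun P => ENNReal.ofReal (β i P)) =
      ENNReal.ofReal M.prior • σ i .G := by
  have := h.isProbabilityMeasure hM i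
  have := h.prob i .G
  have hint : Integrable (β i) (M.mix σ i) := by
    refine Integrable.of_bound (h.measurable i).aestronglyMeasurable 1 (ae_of_all _ fun P => ?_)
    rw [Real.norm_of_nonneg (h.nonneg i P)]; exact h.le_one i P
  ext S hS
  rw [withDensity_apply _ hS, ← ofReal_integral_eq_lintegral_ofReal hint.integrableOn
    (ae_of_all _ (h.nonneg i)), h.bayes i S hS, ENNReal.ofReal_mul hM.prior_pos.le]
  simp [Measure.real, ENNReal.ofReal_toReal]

theorem withDensity_one_sub_belief (h : M.OfferEquilibrium σ β U) (hM : M.NegCorr) (i : Firm) :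
    (M.mix σ i).withDensity (fun P => ENNReal.ofReal (1 - β i P)) =
      ENNReal.ofReal (1 - M.prior) • σ i .B := by
  have := h.isProbabilityMeasure hM i
  have := h.prob i .B
  have hint : Integrable (β i) (M.mix σ i) := by
    refine Integrable.of_bound (h.measurable i).aestronglyMeasurable 1 (ae_of_all _ fun P => ?_)
    rw [Real.norm_of_nonneg (h.nonneg i P)]; exact h.le_one i P
  have hint' : Integrable (fun P => 1 - β i P) (M.mix σ i) := (integrable_const _).sub hint
  ext S hS
  rw [withDensity_apply _ hS, ← ofReal_integral_eq_lintegral_ofReal hint'.integrableOn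
    (ae_of_all _ fun P => sub_nonneg.2 (h.le_one i P)),
    integral_sub (integrable_const _) hint.integrableOn, h.bayes i S hS]
  have h1 := mix_real hM h.prob i S
  have h2 : ∫ _ in S, (1 : ℝ) ∂M.mix σ i = (M.mix σ i).real S := by simp
  rw [h2, h1, add_sub_cancel_left, ENNReal.ofReal_mul (by linarith [hM.prior_lt_one])]
  simp [Measure.real, ENNReal.ofReal_toReal]

theorem good_ae_iff (h : M.OfferEquilibrium σ β U) (hM : M.NegCorr) {i : Firm} {p : ℝ → Prop} :
    (∀ᵐ P ∂σ i .G, p P) ↔ ∀ᵐ P ∂M.mix σ i, β i P ≠ 0 → p P := by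
  have h1 : ENNReal.ofReal M.prior ≠ 0 := by simpa using hM.prior_pos
  have h2 := ae_withDensity_iff (μ := M.mix σ i) (p := p) (h.measurable i).ennreal_ofReal
  rw [h.withDensity_belief hM i] at h2
  have h3 : (∀ᵐ P ∂ENNReal.ofReal M.prior • σ i .G, p P) ↔ ∀ᵐ P ∂σ i .G, p P := by
    simp [ae_iff, h1, -ENNReal.ofReal_eq_zero]
  rw [← h3, h2]
  refine eventually_congr (ae_of_all _ fun P => ?_)
  have h4 := h.nonneg i P
  simp only [ne_eq, ENNReal.ofReal_eq_zero]
  rw [show β i P ≤ 0 ↔ β i P = 0 from ⟨fun h => le_antisymm h h4, fun h => h.le⟩]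

theorem bad_ae_iff (h : M.OfferEquilibrium σ β U) (hM : M.NegCorr) {i : Firm} {p : ℝ → Prop} :
    (∀ᵐ P ∂σ i .B, p P) ↔ ∀ᵐ P ∂M.mix σ i, β i P ≠ 1 → p P := by
  have h1 : ENNReal.ofReal (1 - M.prior) ≠ 0 := by simpa using hM.prior_lt_one
  have h2 := ae_withDensity_iff (μ := M.mix σ i) (p := p)
    (f := fun P => ENNReal.ofReal (1 - β i P)) ((h.measurable i).const_sub 1).ennreal_ofReal
  rw [h.withDensity_one_sub_belief hM i] at h2
  have h3 : (∀ᵐ P ∂ENNReal.ofReal (1 - M.prior) • σ i .B, p P) ↔ ∀ᵐ P ∂σ i .B, p P := by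
    simp [ae_iff, h1, -ENNReal.ofReal_eq_zero]
  rw [← h3, h2]
  refine eventually_congr (ae_of_all _ fun P => ?_)
  have h4 := h.le_one i P
  simp only [ne_eq, ENNReal.ofReal_eq_zero, sub_nonpos]
  rw [show 1 ≤ β i P ↔ β i P = 1 from ⟨fun h => le_antisymm h4 h, fun h => h.ge⟩]

end OfferEquilibrium

end Market

/-! ### The Intuitive Criterion and prices shared by both types -/

namespace Market

variable {M : Market}

theorem take_eq_one_iff {x y : ℝ} : take x y = 1 ↔ 0 ≤ x ∧ y < x := by
  refine ⟨fun h => ?_, fun h => take_eq_one h.1 h.2⟩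
  unfold take at h
  split_ifs at h with h1 h2 h3
  · exact absurd h (by norm_num)
  · exact ⟨not_lt.1 h1, h2⟩
  · exact absurd h (by norm_num)
  · exact absurd h (by norm_num)

theorem le_of_take_ne_zero {x y : ℝ} (h : take x y ≠ 0) : 0 ≤ x ∧ y ≤ x := by
  constructor
  · by_contra hx; exact h (take_eq_zero_of_neg (not_le.1 hx))
  · by_contra hx; exact h (take_eq_zero_of_lt (not_le.1 hx))

/-- If raising the belief in the offer `(t, m)` to `1` gains no consumers against `(Q, m')`, then the
marginal consumer of `(t, m)` sees no quality premium. -/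
theorem NegCorr.gap_eq_zero_of_no_gain (hM : M.NegCorr) {t m Q m' : ℝ} (hm1 : m < 1) (hm'1 : m' ≤ 1)
    (ht : M.cost .B ≤ t)
    (hA : ∀ᵐ v ∂M.valuation, 0 ≤ M.net t 1 v ∧ M.net Q m' v ≤ M.net t 1 v →
      0 ≤ M.net t m v ∧ M.net Q m' v < M.net t m v)
    {v : ℝ} (hv : v ∈ Ico 0 M.vbar) (hv0 : 0 ≤ M.net t 1 v) (hv1 : M.net Q m' v ≤ M.net t 1 v) :
    M.gap t = 0 ∧ t < M.vbar ∧ t ≤ Q := by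
  have hcont := fun P m => hM.net_continuous P m
  set A : Set ℝ := {v | 0 ≤ M.net t 1 v} ∩ {v | M.net Q m' v ≤ M.net t 1 v} with hAdef
  have hAclosed : IsClosed A := (isClosed_le continuous_const (hcont t 1)).inter
    (isClosed_le (hcont Q m') (hcont t 1))
  -- Since `m' ≤ 1`, higher valuations gain at least as much from belief one as from the rival's
  -- belief. So `A` is determined by its least element `a` in `[0, vbar]`.
  have hAup : ∀ x ∈ A, ∀ y, x ≤ y → y ∈ A := by
    intro x hx y hxy
    have hg := hM.gap_mono hxy
    have h2 := mul_le_mul_of_nonneg_left hg (sub_nonneg.2 hm'1)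
    obtain ⟨h3, h4⟩ := hx
    simp only [mem_ofPred_eq, net] at h3 h4
    constructor <;> simp only [mem_ofPred_eq, net] <;> linarith
  have hmem : v ∈ Icc 0 M.vbar ∩ A := ⟨Ico_subset_Icc_self hv, hv0, hv1⟩
  have hbb : BddBelow (Icc 0 M.vbar ∩ A) := ⟨0, fun x hx => hx.1.1⟩
  set a := sInf (Icc 0 M.vbar ∩ A) with ha
  obtain ⟨haI, haA⟩ : a ∈ Icc 0 M.vbar ∩ A :=
    (isClosed_Icc.inter hAclosed).csInf_mem ⟨v, hmem⟩ hbb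
  have hav : a < M.vbar := (csInf_le hbb hmem).trans_lt hv.2
  set C : Set ℝ := {v | 0 ≤ M.net t m v} ∩ {v | M.net Q m' v ≤ M.net t m v}
  have hCclosed : IsClosed C := (isClosed_le continuous_const (hcont t m)).inter
    (isClosed_le (hcont Q m') (hcont t m))
  have hsub : Ioo a M.vbar ⊆ C := by
    intro w hw
    have hcl : IsClosed ((Ioo a M.vbar)ᶜ ∪ C) := isOpen_Ioo.isClosed_compl.union hCclosed
    have hae : ∀ᵐ w ∂M.valuation, w ∈ (Ioo a M.vbar)ᶜ ∪ C := by
      filter_upwards [hA] with w hw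
      by_cases hwI : w ∈ Ioo a M.vbar
      · have := hw (hAup a haA w hwI.1.le)
        exact Or.inr ⟨this.1, this.2.le⟩
      · exact Or.inl hwI
    rcases hM.forall_of_ae_isClosed hcl hae ⟨haI.1.trans hw.1.le, hw.2.le⟩ with h | h
    · exact absurd hw h
    · exact h
  obtain ⟨hC1, hC2⟩ : a ∈ C := by
    have := hCclosed.closure_subset_iff.2 hsub
    rw [closure_Ioo hav.ne] at this
    exact this ⟨le_rfl, hav.le⟩
  simp only [mem_ofPred_eq] at hC1 hC2
  -- By closedness the marginal valuation `a` itself accepts `(t, m)`. Without a premium at `a` this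
  -- says `t ≤ a` and `t ≤ Q`.
  rcases (hM.gap_nonneg a).eq_or_lt with h0 | h0
  · simp only [net, ← h0, mul_zero, zero_add] at hC1 hC2
    have hta : t ≤ a := by linarith
    exact ⟨le_antisymm (h0 ▸ hM.gap_mono hta) (hM.gap_nonneg t), hta.trans_lt hav, by linarith⟩
  · exfalso
    have hlt : M.net t m a < M.net t 1 a := by
      have := mul_lt_mul_of_pos_right hm1 h0
      unfold net; linarith
    -- With a premium at `a`, belief one makes acceptance strict there, so valuations below `a`
    -- would accept too. Only `a = 0` could prevent that, and it is excluded by `m < 1` and `h 0 ≤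
    -- c_B ≤ t`.
    rcases haI.1.eq_or_lt with ha0 | ha0
    · rw [← ha0] at hC1 h0
      have := mul_lt_mul_of_pos_right hm1 h0
      have := hM.gap_zero_le
      unfold net at hC1; linarith
    · set O : Set ℝ := {v | 0 < M.net t 1 v} ∩ {v | M.net Q m' v < M.net t 1 v}
      have hO : IsOpen O := (isOpen_lt continuous_const (hcont t 1)).inter
        (isOpen_lt (hcont Q m') (hcont t 1))
      have haO : a ∈ O := ⟨hC1.trans_lt hlt, hC2.trans_lt hlt⟩
      obtain ⟨ε, hε, hb⟩ := Metric.isOpen_iff.1 hO a haO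
      rw [Real.ball_eq_Ioo] at hb
      have hlt2 : max 0 (a - ε / 2) < a := max_lt ha0 (by linarith)
      have hbO := hb (show max 0 (a - ε / 2) ∈ Ioo (a - ε) (a + ε) from
        ⟨(by linarith : a - ε < a - ε / 2).trans_le (le_max_right _ _), by linarith⟩)
      have := csInf_le hbb (show max 0 (a - ε / 2) ∈ Icc 0 M.vbar ∩ A from
        ⟨⟨le_max_left _ _, (hlt2.trans hav).le⟩, (show 0 < M.net t 1 _ from hbO.1).le,
          (show M.net Q m' _ < M.net t 1 _ from hbO.2).le⟩)
      exact absurd hlt2 (not_lt.2 this)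

namespace OfferEquilibrium

variable {σ : Firm → Quality → Measure ℝ} {β : Firm → ℝ → ℝ} {U : Firm → Quality → ℝ}

theorem profit_good_le (h : M.OfferEquilibrium σ β U) (hM : M.NegCorr) (i : Firm) {P : ℝ}
    (hP : P ∈ Icc 0 M.Pmax) :
    P * M.expDemand (M.mix σ i.other) (β i.other) P (β i P) ≤ U i .G := by
  simpa [hM.cost_G] using h.optimal i .G P hP

theorem cost_mem (hM : M.NegCorr) : M.cost .B ∈ Icc 0 M.Pmax :=
  ⟨hM.cost_B_pos.le, (hM.cost_B_lt.trans hM.vbar_lt_Pmax).le⟩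

theorem bad_profit_nonneg (h : M.OfferEquilibrium σ β U) (hM : M.NegCorr) (i : Firm) :
    0 ≤ U i .B := by
  simpa using h.optimal i .B _ (cost_mem hM)

theorem ae_attained (h : M.OfferEquilibrium σ β U) (hM : M.NegCorr) (i : Firm) :
    ∀ᵐ P ∂M.mix σ i, P ∈ Icc 0 M.Pmax ∧
      (β i P ≠ 0 → P * M.expDemand (M.mix σ i.other) (β i.other) P (β i P) = U i .G) ∧
      (β i P ≠ 1 → (P - M.cost .B) * M.expDemand (M.mix σ i.other) (β i.other) P (β i P)
        = U i .B) := by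
  have h1 := (h.good_ae_iff hM).1 (h.attained i .G)
  have h2 := (h.bad_ae_iff hM).1 (h.attained i .B)
  have h3 := (mix_ae_iff hM).2 ⟨h.feasible i .G, h.feasible i .B⟩
  filter_upwards [h1, h2, h3] with P g1 g2 g3
  exact ⟨g3, fun hb => by simpa [hM.cost_G] using g1 hb, g2⟩

theorem ae_bad_of_ae_mix (hM : M.NegCorr) {i : Firm} {p : ℝ → Prop}
    (hp : ∀ᵐ P ∂M.mix σ i, p P) : ∀ᵐ P ∂σ i .B, p P := ((mix_ae_iff hM).1 hp).2

theorem ae_good_of_ae_mix (hM : M.NegCorr) {i : Firm} {p : ℝ → Prop}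
    (hp : ∀ᵐ P ∂M.mix σ i, p P) : ∀ᵐ P ∂σ i .G, p P := ((mix_ae_iff hM).1 hp).1

theorem ae_bad_belief_ne_one (h : M.OfferEquilibrium σ β U) (hM : M.NegCorr) (i : Firm) :
    ∀ᵐ P ∂σ i .B, β i P ≠ 1 :=
  (h.bad_ae_iff hM).2 (ae_of_all _ fun _ hP => hP)

/-- A whole interval of prices at which only the good type gains from separating is impossible. -/
theorem not_separating_interval (h : M.OfferEquilibrium σ β U) (hM : M.NegCorr) (i : Firm)
    {a b : ℝ} (hab : a < b) (ha : 0 ≤ a) (hb : b ≤ M.Pmax)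
    (hG : ∀ P ∈ Ioo a b, U i .G < P * M.expDemand (M.mix σ i.other) (β i.other) P 1)
    (hB : ∀ P ∈ Ioo a b,
      (P - M.cost .B) * M.expDemand (M.mix σ i.other) (β i.other) P 1 < U i .B)
    (h0 : ∀ᵐ P ∂σ i .B, P ∉ Ioo a b) : False := by
  -- A good type charging in the interval would be identified, as no bad type is there, and would
  -- exceed its equilibrium profit. The interval is therefore off the path.
  have hae : ∀ᵐ P ∂M.mix σ i, P ∉ Ioo a b := by
    filter_upwards [(h.bad_ae_iff hM).1 h0, h.ae_attained hM i] with P h1 h2 hP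
    have hβ : β i P = 1 := by
      by_contra hne; exact h1 hne hP
    have := h2.2.1 (by rw [hβ]; exact one_ne_zero)
    rw [hβ] at this
    exact (hG P hP).ne' this
  have hmid : (a + b) / 2 ∈ Ioo a b := ⟨by linarith, by linarith⟩
  refine h.intuitive i ((a + b) / 2) ⟨by linarith [hmid.1], by linarith [hmid.2]⟩ ?_
    ⟨hG _ hmid, hB _ hmid⟩
  rw [Measure.notMem_support_iff_exists]
  exact ⟨Ioo a b, Ioo_mem_nhds hmid.1 hmid.2, measure_eq_zero_iff_ae_notMem.2 hae⟩

/-- If bad types of firm `i` sell nothing at prices in `S`, then almost every price of the rival's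
bad type takes all sales away from some price in `S`. -/
theorem exists_share_eq_zero (h : M.OfferEquilibrium σ β U) (hM : M.NegCorr) (i : Firm)
    {S : Set ℝ} (hS : MeasurableSet S) (hpos : σ i .B S ≠ 0)
    (hzero : ∀ᵐ P ∂σ i .B, P ∈ S → M.expDemand (M.mix σ i.other) (β i.other) P (β i P) = 0) :
    ∀ᵐ Q ∂σ i.other .B, ∃ P ∈ S, M.share P (β i P) Q (β i.other Q) = 0 ∧
      (M.expDemand (M.mix σ i) (β i) Q (β i.other Q) = 0 →
        M.share Q (β i.other Q) P (β i P) = 0) := by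
  have := h.isProbabilityMeasure hM i
  have := h.isProbabilityMeasure hM i.other
  have := h.prob i .B
  have := h.prob i.other .B
  have hm : MeasurableSet {x : ℝ × ℝ | x.1 ∈ S → M.share x.1 (β i x.1) x.2 (β i.other x.2) = 0} := by
    have h1 : MeasurableSet {x : ℝ × ℝ | x.1 ∈ S} := measurable_fst hS
    have h2 : MeasurableSet {x : ℝ × ℝ | M.share x.1 (β i x.1) x.2 (β i.other x.2) = 0} :=
      hM.measurable_share_pair (h.measurable i) (h.measurable i.other) (measurableSet_singleton 0)
    exact h1.imp h2
  have h1 : ∀ᵐ P ∂σ i .B, ∀ᵐ Q ∂σ i.other .B,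
      P ∈ S → M.share P (β i P) Q (β i.other Q) = 0 := by
    filter_upwards [hzero] with P hP
    by_cases hPS : P ∈ S
    · filter_upwards [ae_bad_of_ae_mix hM
        (hM.ae_share_eq_zero (h.measurable i.other) (hP hPS))] with Q hQ _ using hQ
    · exact ae_of_all _ fun Q h => absurd h hPS
  -- Fubini: for almost every `Q` the share vanishes at almost every `P` in `S`, so the witness may
  -- also be chosen to satisfy the reverse condition.
  rw [Measure.ae_ae_comm hm] at h1
  filter_upwards [h1] with Q hQ
  by_cases hE : M.expDemand (M.mix σ i) (β i) Q (β i.other Q) = 0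
  · have h2 := ae_bad_of_ae_mix hM (hM.ae_share_eq_zero (h.measurable i) hE)
    obtain ⟨P, hPS, hP1, hP2⟩ :=
      ((frequently_ae_mem_iff.2 hpos).and_eventually (hQ.and h2)).exists
    exact ⟨P, hPS, hP1 hPS, fun _ => hP2⟩
  · obtain ⟨P, hPS, hP1⟩ := ((frequently_ae_mem_iff.2 hpos).and_eventually hQ).exists
    exact ⟨P, hPS, hP1 hPS, fun h => absurd h hE⟩

/-- A bad type can secure zero by charging its cost, so it can be optimal below cost only without
sales. -/
theorem expDemand_eq_zero_of_lt_cost (h : M.OfferEquilibrium σ β U) (hM : M.NegCorr) (i : Firm)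
    {P D : ℝ} (hD : 0 ≤ D) (hP : P < M.cost .B) (hU : (P - M.cost .B) * D = U i .B) : D = 0 := by
  have h1 := h.bad_profit_nonneg hM i
  rw [← hU] at h1
  by_contra hne
  have := mul_neg_of_neg_of_pos (sub_neg.2 hP) (lt_of_le_of_ne hD (Ne.symm hne))
  linarith

/-- With zero profit, firm `i` would sell nothing at any positive price. The rival must then serve
even valuation zero, so its bad type charges less than cost and sells nothing; neither does the bad
type of `i`, which contradicts `share_add_share_pos`. -/
theorem good_profit_pos (h : M.OfferEquilibrium σ β U) (hM : M.NegCorr) (i : Firm) :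
    0 < U i .G := by
  by_contra hU
  have hzero : ∀ P ∈ Ioc 0 M.Pmax,
      M.expDemand (M.mix σ i.other) (β i.other) P (β i P) = 0 := by
    intro P hP
    have h1 := h.profit_good_le hM i (Ioc_subset_Icc_self hP)
    have h2 := expDemand_nonneg (M := M) (M.mix σ i.other) (β i.other) P (β i P)
    by_contra hne
    have := mul_pos hP.1 (lt_of_le_of_ne h2 (Ne.symm hne))
    linarith
  have := h.isProbabilityMeasure hM i.other
  have := h.prob i .B
  have := h.prob i.other .B
  have hvb := hM.vbar_pos
  have hlow : ∀ᵐ Q ∂M.mix σ i.other, 0 ≤ M.net Q (β i.other Q) 0 := by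
    -- Test prices tending to zero. The consumer with twice the price as valuation would gain from
    -- firm `i`, hence gains at least as much from the rival; in the limit this reaches valuation
    -- zero.
    have hP : ∀ n : ℕ, M.vbar / 2 / (n + 1) ∈ Ioc 0 (M.vbar / 2) := fun n =>
      ⟨by positivity, div_le_self (by linarith) (by linarith [n.cast_nonneg (α := ℝ)])⟩
    have hall : ∀ᵐ Q ∂M.mix σ i.other, ∀ n : ℕ,
        M.share (M.vbar / 2 / (n + 1)) (β i (M.vbar / 2 / (n + 1))) Q (β i.other Q) = 0 := by
      rw [ae_all_iff]
      intro n
      exact hM.ae_share_eq_zero (h.measurable i.other)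
        (hzero _ ⟨(hP n).1, by linarith [(hP n).2, hM.vbar_lt_Pmax]⟩)
    filter_upwards [hall] with Q hQ
    have hnet : ∀ n : ℕ, 0 ≤ M.net Q (β i.other Q) (2 * (M.vbar / 2 / (n + 1))) := by
      intro n
      have h0 := mul_nonneg (h.nonneg i (M.vbar / 2 / (n + 1)))
        (hM.gap_nonneg (2 * (M.vbar / 2 / (n + 1))))
      have hpos : 0 < M.net (M.vbar / 2 / (n + 1)) (β i (M.vbar / 2 / (n + 1)))
          (2 * (M.vbar / 2 / (n + 1))) := by
        unfold net; linarith [(hP n).1]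
      exact hpos.le.trans (hM.net_le_of_share_eq_zero (hQ n)
        ⟨by linarith [(hP n).1], by linarith [(hP n).2]⟩ hpos)
    have hlim : Tendsto (fun n : ℕ => 2 * (M.vbar / 2 / ((n : ℝ) + 1))) atTop (𝓝 0) := by
      have := (tendsto_one_div_add_atTop_nhds_zero_nat (𝕜 := ℝ)).const_mul M.vbar
      rw [mul_zero] at this
      refine this.congr fun n => by ring
    exact ge_of_tendsto' (((hM.net_continuous Q (β i.other Q)).tendsto 0).comp hlim) hnet
  have hlt : ∀ᵐ Q ∂σ i.other .B, Q < M.cost .B := by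
    filter_upwards [ae_bad_of_ae_mix hM hlow, h.ae_bad_belief_ne_one hM i.other] with Q h1 h2
    have h3 := lt_of_le_of_ne (h.le_one i.other Q) h2
    have h4 := hM.gap_zero_le
    have h5 := hM.cost_B_pos
    unfold net at h1
    rcases (hM.gap_nonneg 0).eq_or_lt with h0 | h0
    · rw [← h0] at h1; linarith
    · have := mul_lt_mul_of_pos_right h3 h0
      linarith
  have hz : ∀ᵐ P ∂σ i .B, P ∈ univ →
      M.expDemand (M.mix σ i.other) (β i.other) P (β i P) = 0 := by
    filter_upwards [h.feasible i .B, h.attained i .B] with P h1 h2 _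
    rcases h1.1.eq_or_lt with h0 | h0
    · exact h.expDemand_eq_zero_of_lt_cost hM i (expDemand_nonneg _ _ _ _)
        (h0 ▸ hM.cost_B_pos) h2
    · exact hzero P ⟨h0, h1.2⟩
  obtain ⟨Q, ⟨P, -, h1, h2⟩, h3, h4⟩ := ((h.exists_share_eq_zero hM i MeasurableSet.univ
    (by simp) hz).and (hlt.and (h.attained i.other .B))).exists
  rw [Firm.other_other] at h4
  have h5 := h2 (h.expDemand_eq_zero_of_lt_cost hM i.other (expDemand_nonneg _ _ _ _) h3 h4)
  have := hM.share_add_share_pos (Q := P) (m' := β i P) (h.nonneg i.other Q)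
    (h3.trans hM.cost_B_lt)
  linarith

/-- At a price that both types find optimal, belief `1` cannot raise the demand at slightly lower
prices above the equilibrium demand. -/
theorem not_demand_jump (h : M.OfferEquilibrium σ β U) (hM : M.NegCorr) (i : Firm) {t D D' : ℝ}
    (ht : t ∈ Icc 0 M.Pmax) (hct : M.cost .B ≤ t) (hD : 0 < D) (hG : t * D = U i .G)
    (hB : (t - M.cost .B) * D = U i .B)
    (hlow : t = M.cost .B → ∀ᵐ P ∂σ i .B, M.cost .B ≤ P) (hDD : D < D')
    (hD' : ∀ P < t, D' ≤ M.expDemand (M.mix σ i.other) (β i.other) P 1) : False := by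
  have := h.isProbabilityMeasure hM i.other
  have hc := hM.cost_B_pos
  set c := M.cost .B with hcdef
  set g : ℝ → ℝ := fun P => M.expDemand (M.mix σ i.other) (β i.other) P 1 with hg
  have hg0 : ∀ P, 0 ≤ g P := fun P => expDemand_nonneg _ _ _ _
  have hganti : ∀ P Q, P ≤ Q → g Q ≤ g P := fun P Q hPQ =>
    hM.expDemand_mono _ (h.measurable _) hPQ le_rfl
  have hg1 : ∀ P, g P ≤ 1 := fun P => hM.expDemand_le_one _ (h.measurable _) _ _
  have hD'0 : 0 < D' := hD.trans hDD
  rcases hct.eq_or_lt with hct | hct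
  · have hlt : c * D / D' < c := by
      rw [div_lt_iff₀ hD'0]; exact mul_lt_mul_of_pos_left hDD hc
    refine h.not_separating_interval hM i hlt (by positivity) (hct ▸ ht.2) (fun P hP => ?_)
      (fun P hP => ?_) ?_
    · have h1 := hD' P (hct ▸ hP.2)
      have h2 := hP.1
      rw [div_lt_iff₀ hD'0] at h2
      have hP0 : 0 < P := lt_trans (by positivity) hP.1
      have h3 := mul_le_mul_of_nonneg_left h1 hP0.le
      rw [← hG, ← hct]; linarith
    · have h1 := hD' P (hct ▸ hP.2)
      rw [← hB, ← hct, sub_self, zero_mul]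
      exact mul_neg_of_neg_of_pos (sub_neg.2 hP.2) (hD'0.trans_le h1)
    · filter_upwards [hlow hct.symm] with P hP hPI
      exact absurd hPI.2 (not_lt.2 hP)
  · have hUB : 0 < U i .B := by rw [← hB]; exact mul_pos (sub_pos.2 hct) hD
    -- The supremum `s` of `S` is the first price, going up from cost, at which imitation at belief
    -- one stops being unattractive to the bad type.
    set S : Set ℝ := {P | P ∈ Icc c t ∧ ∀ P' ∈ Ico c P, (P' - c) * g P' < U i .B} with hS
    have hcS : c ∈ S := ⟨⟨le_rfl, hct.le⟩, fun P' hP' => absurd hP'.2 (not_lt.2 hP'.1)⟩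
    have hbdd : BddAbove S := ⟨t, fun P hP => hP.1.2⟩
    set s := sSup S with hs
    have hst : s ≤ t := csSup_le ⟨c, hcS⟩ fun P hP => hP.1.2
    have hcs : c ≤ s := le_csSup hbdd hcS
    have hbelow : ∀ P ∈ Ico c s, (P - c) * g P < U i .B := by
      intro P hP
      obtain ⟨x, hx, hPx⟩ := exists_lt_of_lt_csSup ⟨c, hcS⟩ hP.2
      exact hx.2 P ⟨hP.1, hPx⟩
    have hst' : s < t := by
      refine lt_of_le_of_ne hst fun hst => ?_
      have hpos : 0 < t - c := sub_pos.2 hct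
      have h1 : c + (t - c) * D / D' < t := by
        have : (t - c) * D / D' < t - c := by
          rw [div_lt_iff₀ hD'0]; exact mul_lt_mul_of_pos_left hDD hpos
        linarith
      have h2 : 0 ≤ (t - c) * D / D' := by positivity
      have h3 := hbelow (c + (t - c) * D / D') ⟨by linarith, hst ▸ h1⟩
      rw [add_sub_cancel_left] at h3
      have h4 := mul_le_mul_of_nonneg_left (hD' _ h1) h2
      rw [div_mul_cancel₀ _ hD'0.ne'] at h4
      exact absurd h3 (not_lt.2 (hB.symm.le.trans h4))
    -- Since `g` is antitone, the bad type's profit at belief one cannot jump upwards, so it reaches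
    -- `U i .B` already as a left limit at `s`.
    have hkey : ∀ P < s, U i .B ≤ (s - c) * g P := by
      intro P hP
      by_contra hlt
      push Not at hlt
      set δ := min (t - s) ((U i .B - (s - c) * g P) / 2) with hδ
      have hδ0 : 0 < δ := lt_min (by linarith) (by linarith)
      have hδ1 : δ ≤ (U i .B - (s - c) * g P) / 2 := min_le_right _ _
      have hδ2 : δ ≤ t - s := min_le_left _ _
      have hmem : s + δ ∈ S := by
        refine ⟨⟨by linarith, by linarith⟩, fun P' hP' => ?_⟩
        rcases lt_or_ge P' s with h1 | h1
        · exact hbelow P' ⟨hP'.1, h1⟩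
        · have h2 : (P' - c) * g P' ≤ (P' - c) * g P :=
            mul_le_mul_of_nonneg_left (hganti _ _ (hP.le.trans h1)) (by linarith [hP'.1])
          have h3 : (P' - c) * g P ≤ (s + δ - c) * g P :=
            mul_le_mul_of_nonneg_right (by linarith [hP'.2]) (hg0 P)
          have h4 : δ * g P ≤ δ * 1 := mul_le_mul_of_nonneg_left (hg1 P) hδ0.le
          nlinarith
      have := le_csSup hbdd hmem
      linarith
    have hcs' : c < s := by
      refine lt_of_le_of_ne hcs fun heq => ?_
      have := hkey (s - 1) (by linarith)
      rw [← heq, sub_self, zero_mul] at this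
      linarith
    have hsc : 0 < s - c := sub_pos.2 hcs'
    set e := U i .B / (s - c) with he
    have he0 : 0 < e := div_pos hUB hsc
    have hge : ∀ P < s, e ≤ g P := fun P hP => by
      rw [he, div_le_iff₀ hsc, mul_comm]; exact hkey P hP
    -- The bad type is indifferent between demand `D` at `t` and `e` at `s < t`; with zero cost the
    -- latter is strictly better, as `s / (s - c) > t / (t - c)`.
    have hgain : U i .G < s * e := by
      rw [he, ← hG, ← hB, ← mul_div_assoc, lt_div_iff₀ hsc]
      have : 0 < (t - s) * (c * D) := mul_pos (by linarith) (mul_pos hc hD)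
      nlinarith
    have hlt : max c (U i .G / e) < s := max_lt hcs' (by rwa [div_lt_iff₀ he0])
    refine h.not_separating_interval hM i hlt (hc.le.trans (le_max_left _ _)) (hst.trans ht.2)
      (fun P hP => ?_) (fun P hP => ?_) ?_
    · have h1 := (le_max_right _ _).trans_lt hP.1
      rw [div_lt_iff₀ he0] at h1
      have hP0 : 0 ≤ P := hc.le.trans ((le_max_left _ _).trans hP.1.le)
      exact h1.trans_le (mul_le_mul_of_nonneg_left (hge P hP.2) hP0)
    · exact hbelow P ⟨(le_max_left _ _).trans hP.1.le, hP.2⟩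
    · filter_upwards [h.attained i .B] with P h1 hP
      have hcP : c ≤ P := (le_max_left _ _).trans hP.1.le
      have h2 := hM.expDemand_mono (M.mix σ i.other) (h.measurable i.other) (le_refl P)
        (h.le_one i P)
      have h3 := mul_le_mul_of_nonneg_left h2 (sub_nonneg.2 hcP)
      have := hbelow P ⟨hcP, hP.2⟩
      linarith

/-- A price chosen by both types is below the valuations that see a quality premium, loses all
consumers to lower prices and takes all consumers from higher ones. -/
theorem pooled_price (h : M.OfferEquilibrium σ β U) (hM : M.NegCorr) (i : Firm) {t : ℝ}
    (ht : t ∈ Icc 0 M.Pmax) (h1 : β i t ≠ 1)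
    (hG : t * M.expDemand (M.mix σ i.other) (β i.other) t (β i t) = U i .G)
    (hB : (t - M.cost .B) * M.expDemand (M.mix σ i.other) (β i.other) t (β i t) = U i .B)
    (hlow : t = M.cost .B → ∀ᵐ P ∂σ i .B, M.cost .B ≤ P) :
    M.gap t = 0 ∧ t < M.vbar ∧ ∀ᵐ Q ∂M.mix σ i.other,
      (Q < t → M.share t (β i t) Q (β i.other Q) = 0) ∧
      (t ≤ Q → M.share Q (β i.other Q) t (β i t) = 0) := by
  have := hM.isProbabilityMeasure
  have := h.isProbabilityMeasure hM i.other
  set m := β i t with hm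
  set j := i.other with hj
  have hm1 : m < 1 := lt_of_le_of_ne (h.le_one i t) h1
  set D := M.expDemand (M.mix σ j) (β j) t m with hDdef
  have hD : 0 < D := by
    have h2 := h.good_profit_pos hM i
    rw [← hG] at h2
    exact pos_of_mul_pos_right h2 ht.1
  have hct : M.cost .B ≤ t := by
    by_contra hlt
    exact hD.ne' (h.expDemand_eq_zero_of_lt_cost hM i hD.le (not_le.1 hlt) hB)
  have hnetQ : Measurable fun z : ℝ × ℝ => M.net z.1 (β j z.1) z.2 :=
    hM.measurable_net.comp (measurable_fst.prodMk (((h.measurable j).comp measurable_fst).prodMk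
      measurable_snd))
  have hnett : Measurable fun z : ℝ × ℝ => M.net t 1 z.2 :=
    (hM.net_continuous t 1).measurable.comp measurable_snd
  -- The consumers for whom `(t, 1)` is weakly best: all of them buy once the price is slightly
  -- below `t` at belief one, so their mass bounds that demand from below.
  set A : ℝ → Set ℝ := fun Q => {v | 0 ≤ M.net t 1 v ∧ M.net Q (β j Q) v ≤ M.net t 1 v} with hA
  have hAm : MeasurableSet {z : ℝ × ℝ | 0 ≤ M.net t 1 z.2 ∧ M.net z.1 (β j z.1) z.2 ≤ M.net t 1 z.2} :=
    (measurableSet_le measurable_const hnett).inter (measurableSet_le hnetQ hnett)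
  have hAQ : ∀ Q, MeasurableSet (A Q) := fun Q => measurable_prodMk_left hAm
  have hWm : Measurable fun Q => M.valuation.real (A Q) :=
    (measurable_measure_prodMk_left hAm).ennreal_toReal
  have hWint : Integrable (fun Q => M.valuation.real (A Q)) (M.mix σ j) := by
    refine Integrable.of_bound hWm.aestronglyMeasurable 1 (ae_of_all _ fun Q => ?_)
    rw [Real.norm_of_nonneg measureReal_nonneg]; exact measureReal_le_one
  have hWi : ∀ Q, M.valuation.real (A Q) = ∫ v, (A Q).indicator 1 v ∂M.valuation := fun Q =>
    (integral_indicator_one (hAQ Q)).symm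
  have hindint : ∀ Q, Integrable ((A Q).indicator (1 : ℝ → ℝ)) M.valuation := fun Q =>
    (integrable_const (1 : ℝ)).indicator (hAQ Q)
  have htake : ∀ Q v, take (M.net t m v) (M.net Q (β j Q) v) ≤ (A Q).indicator (1 : ℝ → ℝ) v := by
    intro Q v
    by_cases hv : v ∈ A Q
    · simpa [hv] using take_le_one _ _
    · have : take (M.net t m v) (M.net Q (β j Q) v) = 0 := by
        by_contra hne
        obtain ⟨h2, h3⟩ := le_of_take_ne_zero hne
        have h4 := hM.net_le_net (le_refl t) hm1.le v
        exact hv ⟨h2.trans h4, h3.trans h4⟩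
      simp [this, hv]
  have hshareW : ∀ Q, M.share t m Q (β j Q) ≤ M.valuation.real (A Q) := fun Q => by
    rw [hWi]
    exact integral_mono (hM.integrable_take_net _ _ _ _) (hindint Q) (htake Q)
  have hWshare : ∀ P < t, ∀ Q, M.valuation.real (A Q) ≤ M.share P 1 Q (β j Q) := fun P hP Q => by
    rw [hWi]
    refine integral_mono (hindint Q) (hM.integrable_take_net _ _ _ _) fun v => ?_
    by_cases hv : v ∈ A Q
    · have h4 := hM.net_lt_net hP (le_refl 1) v
      simp [hv, take_eq_one (hv.1.trans h4.le) (hv.2.trans_lt h4)]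
    · simp [hv, take_nonneg]
  -- A larger value would be exactly the demand jump excluded by `not_demand_jump`.
  have hWD : ∫ Q, M.valuation.real (A Q) ∂M.mix σ j = D := by
    refine le_antisymm ?_ (integral_mono (hM.integrable_share _ (h.measurable j) _ _) hWint hshareW)
    by_contra hlt
    exact h.not_demand_jump hM i ht hct hD hG hB hlow (not_le.1 hlt) fun P hP =>
      integral_mono hWint (hM.integrable_share _ (h.measurable j) _ _) (hWshare P hP)
  have hae : ∀ᵐ Q ∂M.mix σ j, M.share t m Q (β j Q) = M.valuation.real (A Q) := by
    have h2 : ∫ Q, (M.valuation.real (A Q) - M.share t m Q (β j Q)) ∂M.mix σ j = 0 := by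
      rw [integral_sub hWint (hM.integrable_share _ (h.measurable j) _ _), hWD]
      exact sub_self D
    have h3 := (integral_eq_zero_iff_of_nonneg (fun Q => sub_nonneg.2 (hshareW Q))
      (hWint.sub (hM.integrable_share _ (h.measurable j) _ _))).1 h2
    filter_upwards [h3] with Q hQ
    exact (sub_eq_zero.1 hQ).symm
  have haeA : ∀ᵐ Q ∂M.mix σ j, ∀ᵐ v ∂M.valuation,
      0 ≤ M.net t 1 v ∧ M.net Q (β j Q) v ≤ M.net t 1 v →
        0 ≤ M.net t m v ∧ M.net Q (β j Q) v < M.net t m v := by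
    filter_upwards [hae] with Q hQ
    have h2 : ∫ v, ((A Q).indicator 1 v - take (M.net t m v) (M.net Q (β j Q) v)) ∂M.valuation = 0 := by
      rw [integral_sub (hindint Q) (hM.integrable_take_net _ _ _ _), ← hWi, ← hQ]
      exact sub_self _
    have h3 := (integral_eq_zero_iff_of_nonneg (fun v => sub_nonneg.2 (htake Q v))
      ((hindint Q).sub (hM.integrable_take_net _ _ _ _))).1 h2
    filter_upwards [h3] with v hv hvA
    have hvA' : v ∈ A Q := hvA
    have h4 := sub_eq_zero.1 hv
    rw [indicator_of_mem hvA'] at h4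
    exact take_eq_one_iff.1 h4.symm
  have hempty : ∀ Q, (∀ v ∈ Ico 0 M.vbar, v ∉ A Q) → M.share t m Q (β j Q) = 0 := by
    intro Q hQ
    refine integral_eq_zero_of_ae ?_
    filter_upwards [ae_mem_Icc, ae_ne M.vbar] with v hv hne
    have hvA : v ∉ A Q := hQ v ⟨hv.1, lt_of_le_of_ne hv.2 hne⟩
    have := htake Q v
    rw [indicator_of_notMem hvA] at this
    exact le_antisymm this (take_nonneg _ _)
  have hcase : ∀ᵐ Q ∂M.mix σ j, M.share t m Q (β j Q) ≠ 0 →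
      M.gap t = 0 ∧ t < M.vbar ∧ t ≤ Q := by
    filter_upwards [haeA] with Q hQ hne
    by_contra hcon
    refine hne (hempty Q fun v hv hvA => hcon ?_)
    exact hM.gap_eq_zero_of_no_gain hm1 (h.le_one j Q) hct hQ hv hvA.1 hvA.2
  obtain ⟨hgap, htv⟩ : M.gap t = 0 ∧ t < M.vbar := by
    by_contra hcon
    refine hD.ne' (integral_eq_zero_of_ae ?_)
    filter_upwards [hcase] with Q hQ
    by_contra hne
    exact hcon ⟨(hQ hne).1, (hQ hne).2.1⟩
  refine ⟨hgap, htv, ?_⟩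
  filter_upwards [hcase, haeA] with Q hQ hQA
  refine ⟨fun hlt => ?_, fun hle => ?_⟩
  · by_contra hne
    exact absurd (hQ hne).2.2 (not_le.2 hlt)
  · refine integral_eq_zero_of_ae ?_
    filter_upwards [hQA] with v hv
    -- Valuations below `t` see no premium and find `Q ≥ t` too dear. The others weakly prefer `(t,
    -- 1)` to `Q`, hence strictly prefer `(t, m)` by the absence of gain.
    rcases lt_or_ge v t with hvt | hvt
    · have h0 : M.gap v = 0 := le_antisymm (hgap ▸ hM.gap_mono hvt.le) (hM.gap_nonneg v)
      refine take_eq_zero_of_neg ?_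
      simp only [net, h0, mul_zero, zero_add]; linarith
    · refine take_eq_zero_of_lt (hv ⟨?_, ?_⟩).2
      · have := hM.gap_nonneg v
        simp only [net]; linarith
      · exact hM.net_le_net hle (h.le_one j Q) v

/-- A bad type below cost sells nothing. The rival's bad type cannot also be below cost, so it wins
these customers at a higher price, which needs a positive belief. Its price is then pooled and
carries no premium, a contradiction. -/
theorem ae_cost_le_bad (h : M.OfferEquilibrium σ β U) (hM : M.NegCorr) (i : Firm) :
    ∀ᵐ P ∂σ i .B, M.cost .B ≤ P := by
  have := h.prob i.other .B
  by_contra hcon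
  have hpos : σ i .B (Ico 0 (M.cost .B)) ≠ 0 := by
    intro h0
    refine hcon ?_
    filter_upwards [measure_eq_zero_iff_ae_notMem.1 h0, h.feasible i .B] with P h1 h2
    by_contra hlt
    exact h1 ⟨h2.1, not_le.1 hlt⟩
  have hz : ∀ᵐ P ∂σ i .B, P ∈ Ico 0 (M.cost .B) →
      M.expDemand (M.mix σ i.other) (β i.other) P (β i P) = 0 := by
    filter_upwards [h.attained i .B] with P hP hPS
    exact h.expDemand_eq_zero_of_lt_cost hM i (expDemand_nonneg _ _ _ _) hPS.2 hP
  have hex := h.exists_share_eq_zero hM i measurableSet_Ico hpos hz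
  have hbad := h.attained i.other .B
  rw [Firm.other_other] at hbad
  have hge : ∀ᵐ Q ∂σ i.other .B, M.cost .B ≤ Q := by
    filter_upwards [hex, hbad] with Q ⟨P, hPS, h1, h2⟩ h3
    by_contra hlt
    have h4 := h2 (h.expDemand_eq_zero_of_lt_cost hM i.other (expDemand_nonneg _ _ _ _)
      (not_le.1 hlt) h3)
    have := hM.share_add_share_pos (Q := Q) (m' := β i.other Q) (h.nonneg i P)
      (hPS.2.trans hM.cost_B_lt)
    linarith
  obtain ⟨Q, ⟨P, hPS, h1, -⟩, hQc, hatt, hne⟩ := (hex.and (hge.and ((ae_bad_of_ae_mix hM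
    (h.ae_attained hM i.other)).and (h.ae_bad_belief_ne_one hM i.other)))).exists
  -- The test valuation lies strictly between `P` and `c_B`: it gains from `P`, and can gain from `Q
  -- ≥ c_B` only through a premium.
  have hv : (P + M.cost .B) / 2 ∈ Icc 0 M.vbar :=
    ⟨by linarith [hPS.1, hM.cost_B_pos], by linarith [hPS.2, hM.cost_B_lt]⟩
  have h0 := mul_nonneg (h.nonneg i P) (hM.gap_nonneg ((P + M.cost .B) / 2))
  have h2 : 0 < M.net P (β i P) ((P + M.cost .B) / 2) := by
    unfold net; linarith [hPS.2]
  have h3 := hM.net_le_of_share_eq_zero h1 hv h2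
  unfold net at h3
  have h4 : 0 < β i.other Q * M.gap ((P + M.cost .B) / 2) := by linarith [hPS.2]
  have h5 : β i.other Q ≠ 0 := fun h => by rw [h, zero_mul] at h4; exact lt_irrefl _ h4
  have h6 := (h.pooled_price hM i.other hatt.1 hne (hatt.2.1 h5) (hatt.2.2 hne) fun _ => hge).1
  have h7 : M.gap ((P + M.cost .B) / 2) ≤ M.gap Q := hM.gap_mono (by linarith [hPS.2])
  have h8 : M.gap ((P + M.cost .B) / 2) = 0 :=
    le_antisymm (h6 ▸ h7) (hM.gap_nonneg _)
  rw [h8, mul_zero] at h4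
  exact lt_irrefl _ h4

end OfferEquilibrium

end Market

/-! ### Point masses and compact supports -/

theorem MeasureTheory.Measure.eq_dirac_of_ae_eq {μ : Measure ℝ} [IsProbabilityMeasure μ] {c : ℝ}
    (h : ∀ᵐ x ∂μ, x = c) : μ = Measure.dirac c := by
  ext S hS
  rw [Measure.dirac_apply' _ hS]
  by_cases hc : c ∈ S
  · rw [indicator_of_mem hc, Pi.one_apply, ← prob_compl_eq_zero_iff hS]
    refine measure_eq_zero_iff_ae_notMem.2 ?_
    filter_upwards [h] with x hx hxS
    exact hxS (hx ▸ hc)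
  · rw [indicator_of_notMem hc]
    refine measure_eq_zero_iff_ae_notMem.2 ?_
    filter_upwards [h] with x hx hxS
    exact hc (hx ▸ hxS)

theorem MeasureTheory.Measure.of_ae_of_singleton_ne_zero {μ : Measure ℝ} {b : ℝ} {p : ℝ → Prop}
    (h : ∀ᵐ x ∂μ, p x) (hb : μ {b} ≠ 0) : p b := by
  by_contra hpb
  refine hb (measure_eq_zero_iff_ae_notMem.2 ?_)
  filter_upwards [h] with x hx hxb
  exact hpb (hxb ▸ hx)

theorem MeasureTheory.Measure.exists_isGreatest_support {μ : Measure ℝ} [IsProbabilityMeasure μ]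
    {a b : ℝ} (h : ∀ᵐ x ∂μ, x ∈ Icc a b) : ∃ t ∈ μ.support, ∀ᵐ x ∂μ, x ≤ t := by
  have hsub : μ.support ⊆ Icc a b := Measure.support_subset_of_isClosed isClosed_Icc h
  have hc : IsCompact μ.support := isCompact_Icc.of_isClosed_subset Measure.isClosed_support hsub
  obtain ⟨t, ht, hmax⟩ := hc.exists_isGreatest
    (Measure.nonempty_support (IsProbabilityMeasure.ne_zero μ))
  refine ⟨t, ht, ?_⟩
  filter_upwards [Measure.support_mem_ae (μ := μ)] with x hx
  exact hmax hx

/-! ### Bertrand competition between the bad types -/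

namespace Market

variable {M : Market}

namespace OfferEquilibrium

variable {σ : Firm → Quality → Measure ℝ} {β : Firm → ℝ → ℝ} {U : Firm → Quality → ℝ}

/-- What bad types' prices look like, whether or not a good type also uses them. -/
theorem ae_bad_price (h : M.OfferEquilibrium σ β U) (hM : M.NegCorr) {i j : Firm}
    (hij : i.other = j) : ∀ᵐ P ∂σ i .B,
      (β i P = 0 ∨ M.gap P = 0 ∧ P < M.vbar ∧
        ∀ᵐ Q ∂M.mix σ j, P ≤ Q → M.share Q (β j Q) P (β i P) = 0) ∧
      ∀ᵐ Q ∂M.mix σ j, Q < P → M.share P (β i P) Q (β j Q) = 0 := by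
  subst hij
  filter_upwards [ae_bad_of_ae_mix hM (h.ae_attained hM i), h.ae_bad_belief_ne_one hM i]
    with P h1 h2
  by_cases h0 : β i P = 0
  · exact ⟨Or.inl h0, ae_of_all _ fun Q hQ => by
      rw [h0]; exact hM.share_eq_zero_of_lt hQ (h.nonneg _ _)⟩
  · obtain ⟨h3, h4, h5⟩ := h.pooled_price hM i h1.1 h2 (h1.2.1 h0) (h1.2.2 h2)
      fun _ => h.ae_cost_le_bad hM i
    exact ⟨Or.inr ⟨h3, h4, h5.mono fun Q hQ => hQ.2⟩, h5.mono fun Q hQ => hQ.1⟩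

/-- A bad price above `y` would lose a consumer to `y`: the top valuation if its belief is zero, the
valuation equal to the price if it is pooled and premium-free. -/
theorem ae_bad_le_of_expDemand_eq_zero (h : M.OfferEquilibrium σ β U) (hM : M.NegCorr)
    {i j : Firm} (hij : i.other = j) {y : ℝ} (hy : y ∈ Ico 0 M.vbar)
    (hE : M.expDemand (M.mix σ i) (β i) y (β j y) = 0) : ∀ᵐ P ∂σ i .B, P ≤ y := by
  have := h.isProbabilityMeasure hM i
  filter_upwards [h.ae_bad_price hM hij,
    ae_bad_of_ae_mix hM (hM.ae_share_eq_zero (h.measurable i) hE)] with P h1 h2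
  by_contra hlt
  push Not at hlt
  refine absurd h2 (ne_of_gt ?_)
  rcases h1.1 with h0 | ⟨h0, hP, -⟩
  · have h3 := mul_nonneg (h.nonneg j y) (hM.gap_nonneg M.vbar)
    refine hM.share_pos (v := M.vbar) ⟨hM.vbar_pos.le, le_rfl⟩ ?_ ?_
    · simp only [net]; linarith [hy.2]
    · simp only [net, h0, zero_mul, zero_add]; linarith
  · have h3 := mul_nonneg (h.nonneg j y) (hM.gap_nonneg P)
    refine hM.share_pos (v := P) ⟨hy.1.trans hlt.le, hP.le⟩ ?_ ?_
    · simp only [net]; linarith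
    · simp only [net, h0, mul_zero, zero_add]; linarith

/-- If the bad type of `j` earns zero, it sells nothing at prices slightly above cost, so the bad
type of `i` never charges more than those prices. -/
theorem bad_eq_dirac_of_rival (h : M.OfferEquilibrium σ β U) (hM : M.NegCorr)
    {i j : Firm} (hij : i.other = j) (hU : U j .B = 0) :
    σ i .B = Measure.dirac (M.cost .B) ∧ U i .B = 0 := by
  have := h.prob i .B
  have hji : j.other = i := by rw [← hij, Firm.other_other]
  have hcv := hM.cost_B_lt
  have hc := hM.cost_B_pos
  have hle : ∀ᵐ P ∂σ i .B, ∀ n : ℕ, P ≤ M.cost .B + (M.vbar - M.cost .B) / 2 * (1 / ((n : ℝ) + 1)) := by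
    rw [ae_all_iff]
    intro n
    set y := M.cost .B + (M.vbar - M.cost .B) / 2 * (1 / ((n : ℝ) + 1)) with hy
    have hpos : 0 < (M.vbar - M.cost .B) / 2 * (1 / ((n : ℝ) + 1)) :=
      mul_pos (by linarith) (by positivity)
    have hle : (M.vbar - M.cost .B) / 2 * (1 / ((n : ℝ) + 1)) ≤ (M.vbar - M.cost .B) / 2 := by
      refine mul_le_of_le_one_right (by linarith) ?_
      rw [div_le_one (by positivity)]; linarith [n.cast_nonneg (α := ℝ)]
    refine h.ae_bad_le_of_expDemand_eq_zero hM hij ⟨by linarith, by linarith⟩ ?_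
    have h1 := h.optimal j .B y ⟨by linarith, by linarith [hM.vbar_lt_Pmax]⟩
    rw [hji, hU] at h1
    have h2 := expDemand_nonneg (M := M) (M.mix σ i) (β i) y (β j y)
    by_contra hne
    have h3 : 0 < (y - M.cost .B) * M.expDemand (M.mix σ i) (β i) y (β j y) :=
      mul_pos (by linarith) (lt_of_le_of_ne h2 (Ne.symm hne))
    linarith
  have heq : ∀ᵐ P ∂σ i .B, P = M.cost .B := by
    filter_upwards [hle, h.ae_cost_le_bad hM i] with P h1 h2
    have hlim := ((tendsto_one_div_add_atTop_nhds_zero_nat (𝕜 := ℝ)).const_mul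
      ((M.vbar - M.cost .B) / 2)).const_add (M.cost .B)
    rw [mul_zero, add_zero] at hlim
    exact le_antisymm (ge_of_tendsto' hlim h1) h2
  refine ⟨Measure.eq_dirac_of_ae_eq heq, ?_⟩
  obtain ⟨P, h1, h2⟩ := (heq.and (h.attained i .B)).exists
  rw [← h2, h1, sub_self, zero_mul]

/-- Revealed preference: adding the two types' optimality inequalities shows that the good price
sells at least as much. If it were also the higher one, the bad type would switch to it. -/
theorem ae_good_le_bad (h : M.OfferEquilibrium σ β U) (hM : M.NegCorr) (i : Firm)
    (hU : 0 < U i .B) : ∀ᵐ P ∂σ i .G, ∀ᵐ P' ∂σ i .B, P ≤ P' := by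
  filter_upwards [h.feasible i .G, h.attained i .G] with P hP hG
  filter_upwards [h.feasible i .B, h.attained i .B] with P' hP' hB
  have h1 := h.optimal i .B P hP
  have h2 := h.profit_good_le hM i hP'
  rw [hM.cost_G, sub_zero] at hG
  set E := M.expDemand (M.mix σ i.other) (β i.other) P (β i P)
  set E' := M.expDemand (M.mix σ i.other) (β i.other) P' (β i P')
  have hE : 0 ≤ E := expDemand_nonneg _ _ _ _
  have hE' : 0 ≤ E' := expDemand_nonneg _ _ _ _
  have hc := hM.cost_B_pos
  by_contra hlt
  push Not at hlt
  have hE'0 : 0 < E' := by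
    refine lt_of_le_of_ne hE' fun h0 => ?_
    rw [← h0, mul_zero] at hB; linarith
  have hPc : 0 < P' - M.cost .B := by
    rw [← hB] at hU; exact pos_of_mul_pos_left hU hE'
  have h3 : E' ≤ E := by
    have : M.cost .B * E' ≤ M.cost .B * E := by nlinarith
    exact le_of_mul_le_mul_left this hc
  have h4 : (P' - M.cost .B) * E' < (P - M.cost .B) * E := by
    calc (P' - M.cost .B) * E' < (P - M.cost .B) * E' :=
          mul_lt_mul_of_pos_right (by linarith) hE'0
      _ ≤ (P - M.cost .B) * E := mul_le_mul_of_nonneg_left h3 (by linarith)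
  linarith

/-- A bad type sells only when the rival is not cheaper. -/
theorem ae_bad_profit_le (h : M.OfferEquilibrium σ β U) (hM : M.NegCorr) {i j : Firm}
    (hij : i.other = j) : ∀ᵐ P ∂σ i .B, U i .B ≤ M.Pmax * (M.mix σ j).real (Ici P) := by
  subst hij
  have := h.isProbabilityMeasure hM i.other
  filter_upwards [h.attained i .B, h.ae_bad_price hM rfl, h.feasible i .B,
    h.ae_cost_le_bad hM i] with P h1 h2 h3 h4
  have hE : M.expDemand (M.mix σ i.other) (β i.other) P (β i P) ≤
      (M.mix σ i.other).real (Ici P) := by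
    rw [← integral_indicator_one measurableSet_Ici]
    refine integral_mono_ae (hM.integrable_share _ (h.measurable _) _ _)
      ((integrable_const 1).indicator measurableSet_Ici) ?_
    filter_upwards [h2.2] with Q hQ
    by_cases hPQ : Q < P
    · simp [hQ hPQ, hPQ]
    · rw [indicator_of_mem (show Q ∈ Ici P from not_lt.1 hPQ)]
      exact hM.share_le_one _ _ _ _
  rw [← h1]
  exact mul_le_mul (by linarith [h3.2, hM.cost_B_pos]) hE (expDemand_nonneg _ _ _ _)
    (h3.1.trans h3.2)

theorem ae_mix_le_of_ae_bad_le (h : M.OfferEquilibrium σ β U) (hM : M.NegCorr) (i : Firm)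
    (hU : 0 < U i .B) {b : ℝ} (hb : ∀ᵐ P ∂σ i .B, P ≤ b) : ∀ᵐ P ∂M.mix σ i, P ≤ b := by
  have := h.prob i .B
  refine (mix_ae_iff hM).2 ⟨?_, hb⟩
  filter_upwards [h.ae_good_le_bad hM i hU] with P hP
  obtain ⟨P', h1, h2⟩ := (hP.and hb).exists
  exact h1.trans h2

/-- If the good type has an atom at the upper bound `b`, the bad prices lie weakly above it and
hence at `b`. -/
theorem bad_singleton_ne_zero (h : M.OfferEquilibrium σ β U) (hM : M.NegCorr) (i : Firm)
    (hU : 0 < U i .B) {b : ℝ} (hb : ∀ᵐ P ∂σ i .B, P ≤ b) (hmix : M.mix σ i {b} ≠ 0) :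
    σ i .B {b} ≠ 0 := by
  have := h.prob i .B
  intro h0
  have hG : σ i .G {b} ≠ 0 := fun hG => hmix (measure_eq_zero_iff_ae_notMem.2 ((mix_ae_iff hM).2
    ⟨measure_eq_zero_iff_ae_notMem.1 hG, measure_eq_zero_iff_ae_notMem.1 h0⟩))
  have h1 := Measure.of_ae_of_singleton_ne_zero (h.ae_good_le_bad hM i hU) hG
  obtain ⟨P, h2, h3, h4⟩ := (h1.and (hb.and (measure_eq_zero_iff_ae_notMem.1 h0))).exists
  exact h4 (le_antisymm h3 h2)

/-- At the highest price `b`, positive profit requires the rival to have an atom there, and then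
both bad types have one. Neither atom can be pooled, so both carry belief zero and tie, and
undercutting pays. -/
theorem not_bad_profits_pos_of_le (h : M.OfferEquilibrium σ β U) (hM : M.NegCorr) {i j : Firm}
    (hij : i.other = j) (hi : 0 < U i .B) (hj : 0 < U j .B) {b : ℝ}
    (hb : b ∈ (σ i .B).support) (hbi : ∀ᵐ P ∂σ i .B, P ≤ b) (hbj : ∀ᵐ P ∂σ j .B, P ≤ b) :
    False := by
  have hji : j.other = i := by rw [← hij, Firm.other_other]
  have hτi := h.isProbabilityMeasure hM i
  have hτj := h.isProbabilityMeasure hM j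
  have hPmax : 0 < M.Pmax := hM.vbar_pos.trans hM.vbar_lt_Pmax
  have hmi := h.ae_mix_le_of_ae_bad_le hM i hi hbi
  have hmj := h.ae_mix_le_of_ae_bad_le hM j hj hbj
  have hsingle : ∀ τ : Measure ℝ, IsProbabilityMeasure τ → (∀ᵐ P ∂τ, P ≤ b) →
      τ.real (Ici b) = τ.real {b} := fun τ _ hτ => measureReal_congr (by
    filter_upwards [hτ] with P hP
    exact propext ⟨fun hP' => le_antisymm hP hP', fun hP' => (Eq.ge hP' : b ≤ P)⟩)
  -- Bad prices of `i` accumulate at `b`, so the rival is at or above every `x < b` with probability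
  -- at least `U i .B / Pmax`; let `x` tend to `b`.
  have hj0 : M.mix σ j {b} ≠ 0 := by
    have hlow : ∀ x < b, U i .B / M.Pmax ≤ (M.mix σ j).real (Ici x) := by
      intro x hx
      have hpos := (Measure.mem_support_iff_forall b).1 hb (Ioi x) (Ioi_mem_nhds hx)
      obtain ⟨P, hPx, hP⟩ := ((frequently_ae_mem_iff.2 hpos.ne').and_eventually
        (h.ae_bad_profit_le hM hij)).exists
      rw [div_le_iff₀' hPmax]
      exact hP.trans (mul_le_mul_of_nonneg_left
        (measureReal_mono (Ici_subset_Ici.2 (le_of_lt hPx))) hPmax.le)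
    have hlim : Tendsto (fun x => (M.mix σ j).real (Ici x)) (𝓝[<] b)
        (𝓝 ((M.mix σ j).real (Ici b))) := by
      have hseq : Tendsto (fun n : ℕ => b - 1 / ((n : ℝ) + 1)) atTop (𝓝[<] b) := by
        refine tendsto_nhdsWithin_iff.2 ⟨?_, Eventually.of_forall fun n => ?_⟩
        · simpa using (tendsto_one_div_add_atTop_nhds_zero_nat (𝕜 := ℝ)).const_sub b
        · have : (0 : ℝ) < 1 / ((n : ℝ) + 1) := by positivity
          simp only [mem_Iio]; linarith
      have hanti : Antitone fun x => (M.mix σ j).real (Ici x) := fun x y hxy =>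
        measureReal_mono (Ici_subset_Ici.2 hxy)
      have hL := hanti.tendsto_nhdsLT b
      have hcont : Tendsto (fun n : ℕ => (M.mix σ j).real (Ici (b - 1 / ((n : ℝ) + 1)))) atTop
          (𝓝 ((M.mix σ j).real (Ici b))) := by
        have hI : Ici b = ⋂ n : ℕ, Ici (b - 1 / ((n : ℝ) + 1)) := by
          ext y; simp only [mem_Ici, mem_iInter]
          refine ⟨fun hy n => ?_, fun hy => le_of_tendsto' (tendsto_nhdsWithin_iff.1 hseq).1 hy⟩
          have : (0 : ℝ) < 1 / ((n : ℝ) + 1) := by positivity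
          linarith
        rw [hI]
        refine (ENNReal.tendsto_toReal (measure_ne_top _ _)).comp (tendsto_measure_iInter_atTop
          (fun n => measurableSet_Ici.nullMeasurableSet) (fun n m hnm => Ici_subset_Ici.2 ?_)
          ⟨0, measure_ne_top _ _⟩)
        exact sub_le_sub_left (one_div_le_one_div_of_le (by positivity)
          (by exact_mod_cast Nat.succ_le_succ hnm)) b
      rwa [tendsto_nhds_unique (hL.comp hseq) hcont] at hL
    have := ge_of_tendsto hlim (eventually_nhdsWithin_of_forall hlow)
    rw [hsingle _ hτj hmj] at this
    intro h0
    rw [Measure.real, h0, ENNReal.toReal_zero] at this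
    exact absurd (div_pos hi hPmax) (not_lt.2 this)
  have hBj := h.bad_singleton_ne_zero hM j hj hbj hj0
  have hi0 : M.mix σ i {b} ≠ 0 := by
    have := Measure.of_ae_of_singleton_ne_zero (h.ae_bad_profit_le hM hji) hBj
    rw [hsingle _ hτi hmi] at this
    intro h0
    rw [Measure.real, h0, ENNReal.toReal_zero, mul_zero] at this
    linarith
  have hBi := h.bad_singleton_ne_zero hM i hi hbi hi0
  -- a pooled price at the top would leave the rival without sales there
  have hzero : ∀ k l : Firm, k.other = l → 0 < U l .B → σ k .B {b} ≠ 0 → σ l .B {b} ≠ 0 →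
      M.mix σ l {b} ≠ 0 → (∀ᵐ P ∂M.mix σ k, P ≤ b) → β k b = 0 := by
    intro k l hkl hU hk hl hml hmk
    have hlk : l.other = k := by rw [← hkl, Firm.other_other]
    have h1 := Measure.of_ae_of_singleton_ne_zero (h.ae_bad_price hM hkl) hk
    have h2 := Measure.of_ae_of_singleton_ne_zero (h.ae_bad_price hM hlk) hl
    have h3 := Measure.of_ae_of_singleton_ne_zero (h.attained l .B) hl
    rcases h1.1 with h0 | ⟨-, -, h4⟩
    · exact h0
    · exfalso
      have h5 := Measure.of_ae_of_singleton_ne_zero h4 hml le_rfl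
      have : M.expDemand (M.mix σ k) (β k) b (β l b) = 0 := by
        refine integral_eq_zero_of_ae ?_
        filter_upwards [h2.2, hmk] with Q hQ hQb
        rcases hQb.lt_or_eq with hlt | heq
        · exact hQ hlt
        · rw [heq]; exact h5
      rw [hlk, this, mul_zero] at h3
      linarith
  have hβi := hzero i j hij hj hBi hBj hj0 hmi
  have hβj := hzero j i hji hi hBj hBi hi0 hmj
  have hatt := Measure.of_ae_of_singleton_ne_zero (h.attained i .B) hBi
  have hprice := Measure.of_ae_of_singleton_ne_zero (h.ae_bad_price hM hij) hBi
  have hfeas := Measure.of_ae_of_singleton_ne_zero (h.feasible i .B) hBi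
  rw [hij] at hatt
  set E := M.expDemand (M.mix σ j) (β j) b (β i b) with hE
  have hE0 : 0 ≤ E := expDemand_nonneg _ _ _ _
  have hcb : 0 < b - M.cost .B := by
    rw [← hatt] at hi; exact pos_of_mul_pos_left hi hE0
  have hEeq : E = (M.mix σ j).real {b} * (M.reach b 0 / 2) := by
    rw [hE, hβi]
    calc M.expDemand (M.mix σ j) (β j) b 0
        = ∫ Q, ({b} : Set ℝ).indicator (fun _ => M.reach b 0 / 2) Q ∂M.mix σ j := by
          refine integral_congr_ae ?_
          filter_upwards [hprice.2, hmj] with Q hQ hQb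
          rcases hQb.lt_or_eq with hlt | heq
          · have := hQ hlt
            rw [hβi] at this
            rwa [indicator_of_notMem (by simpa using hlt.ne)]
          · rw [heq, indicator_of_mem (mem_singleton b), hβj, hM.share_self]
      _ = _ := by
          rw [integral_indicator_const _ (measurableSet_singleton b), smul_eq_mul]
  -- Giving up a quarter of the margin at least doubles demand, since ties become wins, and `3/4 * 2
  -- > 1`.
  set y := b - (b - M.cost .B) / 4 with hy
  have hyb : y < b := by linarith
  have hylow : 2 * E ≤ M.expDemand (M.mix σ j) (β j) y (β i y) := by
    calc 2 * E = ∫ Q, ({b} : Set ℝ).indicator (fun _ => M.reach b 0) Q ∂M.mix σ j := by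
          rw [integral_indicator_const _ (measurableSet_singleton b), smul_eq_mul, hEeq]; ring
      _ ≤ _ := by
          refine integral_mono ((integrable_const _).indicator (measurableSet_singleton b))
            (hM.integrable_share _ (h.measurable j) _ _) fun Q => ?_
          by_cases hQ : Q = b
          · subst hQ
            rw [indicator_of_mem (mem_singleton Q), hβj]
            calc M.reach Q 0 ≤ M.reach y 0 := hM.reach_anti 0 hyb.le
              _ = M.share y 0 Q 0 := (hM.share_of_lt hyb le_rfl).symm
              _ ≤ _ := hM.share_mono le_rfl (h.nonneg i y) le_rfl le_rfl
          · rw [indicator_of_notMem (by simpa using hQ)]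
            exact share_nonneg _ _ _ _
  have hopt := h.optimal i .B y ⟨by linarith [hM.cost_B_pos], by linarith [hfeas.2]⟩
  rw [hij, ← hatt] at hopt
  have h1 : (y - M.cost .B) * (2 * E) ≤ (b - M.cost .B) * E :=
    (mul_le_mul_of_nonneg_left hylow (by linarith)).trans hopt
  have h2 : y - M.cost .B = 3 / 4 * (b - M.cost .B) := by rw [hy]; ring
  rw [h2] at h1
  rw [← hatt] at hi
  nlinarith

theorem exists_bad_profit_eq_zero (h : M.OfferEquilibrium σ β U) (hM : M.NegCorr) :
    ∃ i, U i .B = 0 := by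
  by_contra hcon
  push Not at hcon
  have hpos : ∀ i, 0 < U i .B := fun i => lt_of_le_of_ne (h.bad_profit_nonneg hM i) (hcon i).symm
  have := h.prob .X .B
  have := h.prob .Y .B
  obtain ⟨x, hx, hx'⟩ := Measure.exists_isGreatest_support (h.feasible .X .B)
  obtain ⟨y, hy, hy'⟩ := Measure.exists_isGreatest_support (h.feasible .Y .B)
  rcases le_total x y with hxy | hxy
  · exact h.not_bad_profits_pos_of_le hM (i := .Y) (j := .X) rfl (hpos _) (hpos _) hy hy'
      (hx'.mono fun P hP => hP.trans hxy)
  · exact h.not_bad_profits_pos_of_le hM (i := .X) (j := .Y) rfl (hpos _) (hpos _) hx hx'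
      (hy'.mono fun P hP => hP.trans hxy)

theorem bad_eq_dirac (h : M.OfferEquilibrium σ β U) (hM : M.NegCorr) (i : Firm) :
    σ i .B = Measure.dirac (M.cost .B) ∧ U i .B = 0 := by
  obtain ⟨k, hk⟩ := h.exists_bad_profit_eq_zero hM
  have h1 := h.bad_eq_dirac_of_rival hM (Firm.other_other k) hk
  have h2 := h.bad_eq_dirac_of_rival hM (i := k) rfl h1.2
  rcases eq_or_ne i k with rfl | hne
  · exact h2
  · have : i = k.other := by cases i <;> cases k <;> simp_all [Firm.other]
    rw [this]; exact h1

end OfferEquilibrium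

end Market

/-! ### Undercutting competition in mixed prices -/

theorem MeasureTheory.Measure.continuousAt_real_Iic {μ : Measure ℝ} [IsProbabilityMeasure μ] {x : ℝ}
    (hx : μ {x} = 0) : ContinuousAt (fun y => μ.real (Iic y)) x := by
  have heq : (fun y => μ.real (Iic y)) = ProbabilityTheory.cdf μ := by
    ext y; rw [ProbabilityTheory.cdf_eq_real]
  rw [heq]
  have hmono := (ProbabilityTheory.cdf μ).mono
  rw [hmono.continuousAt_iff_leftLim_eq_rightLim]
  have h1 := (ProbabilityTheory.cdf μ).measure_singleton x
  rw [ProbabilityTheory.measure_cdf, hx, eq_comm, ENNReal.ofReal_eq_zero, sub_nonpos] at h1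
  rw [StieltjesFunction.rightLim_eq]
  exact le_antisymm (hmono.leftLim_le le_rfl) h1

/-- Undercutting competition: `profit P` is the profit of a firm that sells to all consumers at
price `P ≤ c`, it is earned against an opponent of the other type, and against an opponent of the
same type when that opponent's price is higher (half of it when the prices are equal). -/
structure MixedPricing (profit : ℝ → ℝ) (c lam : ℝ) (σ : Firm → Measure ℝ) (U : Firm → ℝ) :
    Prop where
  lam_pos : 0 < lam
  lam_lt_one : lam < 1
  continuous : Continuous profit
  strictMonoOn : StrictMonoOn profit (Icc 0 c)
  profit_zero : profit 0 = 0
  prob : ∀ i, IsProbabilityMeasure (σ i)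
  ae_mem : ∀ i, ∀ᵐ P ∂σ i, P ∈ Icc 0 c
  pos : ∀ i, 0 < U i
  le : ∀ i, ∀ P ∈ Ioo 0 c,
    profit P * (1 - lam * ((σ i.other).real (Iio P) + (σ i.other).real {P} / 2)) ≤ U i
  attained : ∀ i, ∀ᵐ P ∂σ i, P < c →
    profit P * (1 - lam * ((σ i.other).real (Iio P) + (σ i.other).real {P} / 2)) = U i
  -- At `c` itself good types may pool with bad ones and the profit formula is unavailable;
  -- excluding a common atom is enough.
  top : ∀ i, σ i {c} = 0 ∨ σ i.other {c} = 0

namespace MixedPricing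

variable {profit : ℝ → ℝ} {c lam : ℝ} {σ : Firm → Measure ℝ} {U : Firm → ℝ}

theorem profit_nonneg (h : MixedPricing profit c lam σ U) {P : ℝ} (hP : P ∈ Icc 0 c) :
    0 ≤ profit P := by
  rw [← h.profit_zero]
  exact h.strictMonoOn.monotoneOn ⟨le_rfl, hP.1.trans hP.2⟩ hP hP.1

theorem profit_pos (h : MixedPricing profit c lam σ U) {P : ℝ} (hP : P ∈ Ioc 0 c) :
    0 < profit P := by
  rw [← h.profit_zero]
  exact h.strictMonoOn ⟨le_rfl, hP.1.le.trans hP.2⟩ ⟨hP.1.le, hP.2⟩ hP.1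

/-- An atom of `j` at `Q` makes undercutting strictly better for `i` than prices in some `[Q, e)`,
so `i` avoids them. Then `j` can raise its price within this gap without losing sales. -/
theorem singleton_eq_zero (h : MixedPricing profit c lam σ U) (j : Firm) {Q : ℝ} (hQ : Q < c) :
    σ j {Q} = 0 := by
  by_contra hne
  have := h.prob j
  have := h.prob j.other
  have hl := h.lam_pos
  set i := j.other with hi
  have hij : i.other = j := by rw [hi, Firm.other_other]
  have hQI := Measure.of_ae_of_singleton_ne_zero (h.ae_mem j) hne
  have hatt := Measure.of_ae_of_singleton_ne_zero (h.attained j) hne hQ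
  have hQ0 : 0 < Q := by
    refine lt_of_le_of_ne hQI.1 fun h0 => ?_
    rw [← h0, h.profit_zero, zero_mul] at hatt
    exact (h.pos j).ne hatt
  set F := (σ j).real (Iio Q) with hF
  set a := (σ j).real {Q} with ha
  have ha0 : 0 < a := ENNReal.toReal_pos hne (measure_ne_top _ _)
  have hIic : ∀ P, (σ j).real (Iic P) = (σ j).real (Iio P) + (σ j).real {P} := fun P => by
    rw [← Iio_union_right, measureReal_union (by simp) (measurableSet_singleton P)]
  have hleft : profit Q * (1 - lam * F) ≤ U i := by
    have ht : Tendsto (fun P => profit P * (1 - lam * F)) (𝓝[<] Q) (𝓝 (profit Q * (1 - lam * F))) :=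
      ((h.continuous.tendsto Q).mono_left nhdsWithin_le_nhds).mul_const _
    refine le_of_tendsto ht ?_
    filter_upwards [Ioo_mem_nhdsLT hQ0] with P hP
    have h1 := h.le i P ⟨hP.1, hP.2.trans hQ⟩
    rw [hij] at h1
    refine le_trans (mul_le_mul_of_nonneg_left ?_ (h.profit_nonneg ⟨hP.1.le, (hP.2.trans hQ).le⟩)) h1
    have h2 : (σ j).real (Iic P) ≤ F := measureReal_mono (Iic_subset_Iio.2 hP.2)
    have h3 : 0 ≤ (σ j).real {P} := measureReal_nonneg
    have h4 := hIic P
    have : (σ j).real (Iio P) + (σ j).real {P} / 2 ≤ F := by linarith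
    have := mul_le_mul_of_nonneg_left this hl.le
    linarith
  have hright : ∀ᶠ P in 𝓝 Q, profit P * (1 - lam * (F + a / 2)) < U i := by
    refine (h.continuous.mul continuous_const).continuousAt.eventually (gt_mem_nhds ?_)
    refine lt_of_lt_of_le (mul_lt_mul_of_pos_left ?_ (h.profit_pos ⟨hQ0, hQ.le⟩)) hleft
    have := mul_pos hl ha0
    linarith
  obtain ⟨ε, hε, hb⟩ := Metric.eventually_nhds_iff_ball.1 hright
  rw [Real.ball_eq_Ioo] at hb
  set e := min (Q + ε) c with he
  have hQe : Q < e := lt_min (by linarith) hQ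
  have hnull : ∀ᵐ P ∂σ i, P ∉ Ico Q e := by
    filter_upwards [h.attained i] with P hP hPI
    have hPc : P < c := hPI.2.trans_le (min_le_right _ _)
    have h1 := hP hPc
    rw [hij] at h1
    have h2 := hb P ⟨by linarith [hPI.1], hPI.2.trans_le (min_le_left _ _)⟩
    rw [← h1] at h2
    refine absurd h2 (not_lt.2 (mul_le_mul_of_nonneg_left ?_
      (h.profit_nonneg ⟨hQ0.le.trans hPI.1, hPc.le⟩)))
    have h3 : F + a / 2 ≤ (σ j).real (Iio P) + (σ j).real {P} / 2 := by
      rcases hPI.1.eq_or_lt with heq | hlt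
      · rw [← heq]
      · have h4 : (σ j).real (Iic Q) ≤ (σ j).real (Iio P) := measureReal_mono (Iic_subset_Iio.2 hlt)
        have h5 := hIic Q
        have h6 : 0 ≤ (σ j).real {P} := measureReal_nonneg
        linarith
    have := mul_le_mul_of_nonneg_left h3 hl.le
    linarith
  have hzero : ∀ P ∈ Ico Q e, (σ i).real {P} = 0 := fun P hP => by
    have : σ i {P} = 0 := measure_eq_zero_iff_ae_notMem.2 (hnull.mono fun x hx hxP =>
      hx ((show x = P from hxP) ▸ hP))
    rw [Measure.real, this, ENNReal.toReal_zero]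
  set P := (Q + e) / 2 with hP
  have hPI : P ∈ Ioo Q e := ⟨by linarith, by linarith⟩
  have hPc : P < c := hPI.2.trans_le (min_le_right _ _)
  have hIio : (σ i).real (Iio P) = (σ i).real (Iio Q) := by
    refine measureReal_congr ?_
    filter_upwards [hnull] with x hx
    refine propext ⟨fun hxP => ?_, fun hxQ => (lt_trans hxQ hPI.1 : x < P)⟩
    by_contra hxQ
    exact hx ⟨not_lt.1 hxQ, (lt_trans hxP hPI.2 : x < e)⟩
  have h1 := h.le j P ⟨hQ0.trans hPI.1, hPc⟩
  rw [hzero P ⟨hPI.1.le, hPI.2⟩, hIio, ← hatt, hzero Q ⟨le_rfl, hQe⟩] at h1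
  have h2 : 0 < 1 - lam * ((σ i).real (Iio Q) + 0 / 2) := by
    have h3 : (σ i).real (Iio Q) ≤ 1 := measureReal_le_one
    have := mul_le_mul_of_nonneg_left h3 hl.le
    have := h.lam_lt_one
    linarith
  have h3 := le_of_mul_le_mul_right h1 h2
  exact absurd h3 (not_le.2 (h.strictMonoOn ⟨hQ0.le, hQ.le⟩ ⟨(hQ0.trans hPI.1).le, hPc.le⟩ hPI.1))

theorem real_Iio_add (h : MixedPricing profit c lam σ U) (j : Firm) {P : ℝ} (hP : P < c) :
    (σ j).real (Iio P) + (σ j).real {P} / 2 = (σ j).real (Iic P) := by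
  have := h.prob j
  have h0 : (σ j).real {P} = 0 := by rw [Measure.real, h.singleton_eq_zero j hP, ENNReal.toReal_zero]
  rw [← Iio_union_right, measureReal_union (by simp) (measurableSet_singleton P), h0]
  simp

theorem le_cdf (h : MixedPricing profit c lam σ U) {i j : Firm} (hij : i.other = j) {P : ℝ}
    (hP : P ∈ Ioo 0 c) : profit P * (1 - lam * (σ j).real (Iic P)) ≤ U i := by
  have := h.le i P hP
  rwa [hij, h.real_Iio_add j hP.2] at this

theorem attained_cdf (h : MixedPricing profit c lam σ U) {i j : Firm} (hij : i.other = j) :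
    ∀ᵐ P ∂σ i, P < c → P ∈ Ioo 0 c ∧ profit P * (1 - lam * (σ j).real (Iic P)) = U i := by
  filter_upwards [h.attained i, h.ae_mem i] with P hP hPI hPc
  have h1 := hP hPc
  rw [hij, h.real_Iio_add j hPc] at h1
  refine ⟨⟨lt_of_le_of_ne hPI.1 fun h0 => ?_, hPc⟩, h1⟩
  rw [← h0, h.profit_zero, zero_mul] at h1
  exact (h.pos i).ne h1

theorem ae_le_profit (h : MixedPricing profit c lam σ U) (i : Firm) :
    ∀ᵐ P ∂σ i, P < c → U i ≤ profit P := by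
  have := h.prob i.other
  filter_upwards [h.attained_cdf (i := i) rfl] with P hP hPc
  obtain ⟨h1, h2⟩ := hP hPc
  rw [← h2]
  refine mul_le_of_le_one_right (h.profit_nonneg ⟨h1.1.le, h1.2.le⟩) ?_
  have := mul_nonneg h.lam_pos.le (measureReal_nonneg (μ := σ i.other) (s := Iic P))
  linarith

/-- Otherwise `i` charges `c` almost surely. The rival, having no atom at `c`, then charges less and
faces no competition below `c`, so it would gain by raising its price. -/
theorem lt_profit_top (h : MixedPricing profit c lam σ U) (i : Firm) : U i < profit c := by
  by_contra hU
  push Not at hU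
  have := h.prob i
  have := h.prob i.other
  have hc : ∀ᵐ P ∂σ i, P = c := by
    filter_upwards [h.ae_le_profit i, h.ae_mem i] with P h1 h2
    by_contra hne
    have hlt := lt_of_le_of_ne h2.2 hne
    have := h.strictMonoOn h2 ⟨h2.1.trans h2.2, le_rfl⟩ hlt
    linarith [h1 hlt]
  have htop : σ i.other {c} = 0 := by
    refine (h.top i).resolve_left fun h0 => ?_
    obtain ⟨P, h1, h2⟩ := (hc.and (measure_eq_zero_iff_ae_notMem.1 h0)).exists
    exact h2 h1
  have hF : ∀ P < c, (σ i).real (Iic P) = 0 := fun P hP => by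
    rw [Measure.real, measure_eq_zero_iff_ae_notMem.2, ENNReal.toReal_zero]
    filter_upwards [hc] with x hx hxP
    exact absurd hP (not_lt.2 (hx ▸ hxP))
  obtain ⟨P, h1, h2, h3⟩ := ((h.attained_cdf (Firm.other_other i)).and ((h.ae_mem i.other).and
    (measure_eq_zero_iff_ae_notMem.1 htop))).exists
  have hPc : P < c := lt_of_le_of_ne h2.2 h3
  obtain ⟨h4, h5⟩ := h1 hPc
  rw [hF P hPc] at h5
  have hQ : (P + c) / 2 ∈ Ioo 0 c := ⟨by linarith [h4.1], by linarith⟩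
  have h6 := h.le_cdf (Firm.other_other i) hQ
  rw [hF _ hQ.2] at h6
  have h7 := h.strictMonoOn ⟨h4.1.le, hPc.le⟩ ⟨hQ.1.le, hQ.2.le⟩ (by linarith : P < (P + c) / 2)
  linarith

theorem exists_profit_eq (h : MixedPricing profit c lam σ U) {w : ℝ} (hw : w ∈ Ioo 0 (profit c)) :
    ∃ P ∈ Ioo 0 c, profit P = w := by
  have hc : 0 ≤ c := by
    have := h.prob .X
    obtain ⟨P, hP⟩ := (h.ae_mem .X).exists
    exact hP.1.trans hP.2
  have := intermediate_value_Ioo hc h.continuous.continuousOn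
  rw [h.profit_zero] at this
  obtain ⟨P, hP, hPw⟩ := this hw
  exact ⟨P, hP, hPw⟩

/-- If `U i < U j`, choose `P` with `profit P` between them. Firm `j` never charges `P` or less, as
even full sales would not give it `U j`; so `i` would earn `profit P` there. -/
theorem profit_le_profit_other (h : MixedPricing profit c lam σ U) {i j : Firm} (hij : i.other = j) :
    U j ≤ U i := by
  by_contra hlt
  push Not at hlt
  have := h.prob j
  have hl : U i < min (U j) (profit c) := lt_min hlt (h.lt_profit_top i)
  have hi := h.pos i
  obtain ⟨P, hP, hPw⟩ := h.exists_profit_eq (w := (U i + min (U j) (profit c)) / 2)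
    ⟨by linarith, by linarith [min_le_right (U j) (profit c)]⟩
  have h1 : U i < profit P := by linarith
  have h2 : profit P < U j := by linarith [min_le_left (U j) (profit c)]
  have h3 := h.le_cdf hij hP
  have hne : σ j (Iic P) ≠ 0 := fun h0 => by
    rw [Measure.real, h0] at h3
    simp only [ENNReal.toReal_zero, mul_zero, sub_zero, mul_one] at h3
    linarith
  obtain ⟨Q, hQ, h4, h5⟩ := ((frequently_ae_mem_iff.2 hne).and_eventually
    ((h.ae_le_profit j).and (h.ae_mem j))).exists
  have hQP : Q ≤ P := hQ
  have h6 := h.strictMonoOn.monotoneOn h5 ⟨hP.1.le, hP.2.le⟩ hQP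
  linarith [h4 (hQP.trans_lt hP.2)]

theorem profit_eq_other (h : MixedPricing profit c lam σ U) (i : Firm) : U i.other = U i :=
  le_antisymm (h.profit_le_profit_other rfl) (h.profit_le_profit_other (Firm.other_other i))

/-- `Φ` is the rival cdf that makes a firm indifferent. Optimality gives `Φ` as a lower bound for
both cdfs, with equality at almost every price the opponent charges; it remains to exclude gaps in
the prices charged. -/
theorem cdf_eq (h : MixedPricing profit c lam σ U) (j : Firm) {p : ℝ} (hp : p ∈ Ioo 0 c)
    (hpU : profit p = U j) {P : ℝ} (hP : P ∈ Ico p c) :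
    (σ j).real (Iic P) = (1 - U j / profit P) / lam := by
  have hpr := h.prob
  have hl := h.lam_pos
  set i := j.other with hi
  have hij : i.other = j := by rw [hi, Firm.other_other]
  have hUi : U i = U j := h.profit_eq_other j
  set Φ : ℝ → ℝ := fun x => (1 - U j / profit x) / lam with hΦ
  have hpos : ∀ x ∈ Icc p c, 0 < profit x := fun x hx =>
    h.profit_pos ⟨hp.1.trans_le hx.1, hx.2⟩
  have hΦmono : ∀ x y, p ≤ x → x < y → y ≤ c → Φ x < Φ y := by
    intro x y hpx hxy hyc
    refine div_lt_div_of_pos_right (sub_lt_sub_left ?_ 1) hl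
    exact div_lt_div_of_pos_left (h.pos j) (hpos x ⟨hpx, hxy.le.trans hyc⟩)
      (h.strictMonoOn ⟨hp.1.le.trans hpx, hxy.le.trans hyc⟩ ⟨hp.1.le.trans (hpx.trans hxy.le), hyc⟩ hxy)
  have hlow : ∀ k, ∀ x ∈ Ico p c, Φ x ≤ (σ k).real (Iic x) := by
    intro k x hx
    have h1 := h.le_cdf (Firm.other_other k) ⟨hp.1.trans_le hx.1, hx.2⟩
    have hk : U k.other = U j := by cases k <;> cases j <;> simp_all [Firm.other]
    rw [hk, ← le_div_iff₀' (hpos x ⟨hx.1, hx.2.le⟩)] at h1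
    rw [hΦ, div_le_iff₀ hl]; linarith
  have hae : ∀ k l, k.other = l → ∀ᵐ x ∂σ k, x < c → p ≤ x ∧ (σ l).real (Iic x) = Φ x := by
    intro k l hkl
    have hk : U k = U j := by cases k <;> cases j <;> simp_all [Firm.other]
    filter_upwards [h.attained_cdf hkl, h.ae_le_profit k] with x h1 h2 hxc
    obtain ⟨h3, h4⟩ := h1 hxc
    have h5 := h2 hxc
    have hpx : p ≤ x := by
      by_contra hlt
      have := h.strictMonoOn ⟨h3.1.le, h3.2.le⟩ ⟨hp.1.le, hp.2.le⟩ (not_le.1 hlt)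
      rw [hpU, ← hk] at this; linarith
    refine ⟨hpx, ?_⟩
    have hx0 := hpos x ⟨hpx, hxc.le⟩
    rw [hk] at h4
    simp only [hΦ]
    rw [← h4, mul_div_cancel_left₀ _ hx0.ne']
    field_simp
    ring
  have hp0 : (σ j).real (Iic p) = Φ p := by
    have h1 : σ j (Iic p) = 0 := by
      rw [measure_eq_zero_iff_ae_notMem]
      filter_upwards [hae j i rfl,
        measure_eq_zero_iff_ae_notMem.1 (h.singleton_eq_zero j hp.2)] with x h1 h2 hx
      have hx' : x ≤ p := hx
      exact h2 (le_antisymm hx' (h1 (hx'.trans_lt hp.2)).1)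
    rw [Measure.real, h1, hΦ]
    simp only [hpU, div_self (h.pos j).ne', sub_self, zero_div, ENNReal.toReal_zero]
  have hIic : ∀ k x y, x ≤ y → (∀ᵐ z ∂σ k, z ∉ Ioc x y) → (σ k).real (Iic y) = (σ k).real (Iic x) := by
    intro k x y hxy hz
    refine measureReal_congr ?_
    filter_upwards [hz] with z hz
    refine propext ⟨fun hzy => ?_, fun hzx => (le_trans hzx hxy : z ≤ y)⟩
    by_contra hzx
    exact hz ⟨not_le.1 hzx, hzy⟩
  refine (eq_or_lt_of_le (hlow j P hP)).elim Eq.symm fun hlt => ?_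
  exfalso
  -- Let `a` be the last point of contact before `P`. Firm `i` has no mass on `(a, P]`, so its cdf
  -- there is at least `Φ P`, above `Φ` before `P`. Then `j` has no mass just above `a`, and its cdf
  -- falls below the increasing `Φ`.
  set T : Set ℝ := {x ∈ Icc p P | (σ j).real (Iic x) = Φ x} with hT
  have hcontΦ : ContinuousOn Φ (Icc p P) := by
    refine ContinuousOn.div_const (continuousOn_const.sub (continuousOn_const.div
      h.continuous.continuousOn fun x hx => (hpos x ⟨hx.1, hx.2.trans hP.2.le⟩).ne')) _
  have hcontF : ContinuousOn (fun x => (σ j).real (Iic x)) (Icc p P) := fun x hx =>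
    (Measure.continuousAt_real_Iic
      (h.singleton_eq_zero j (hx.2.trans_lt hP.2))).continuousWithinAt
  have hTclosed : IsClosed T := by
    have := (hcontF.sub hcontΦ).preimage_isClosed_of_isClosed isClosed_Icc (isClosed_singleton (x := 0))
    convert this using 1
    ext x; simp [hT, sub_eq_zero]
  have hTc : IsCompact T := isCompact_Icc.of_isClosed_subset hTclosed fun x hx => hx.1
  obtain ⟨a, ⟨haI, haF⟩, hamax⟩ := hTc.exists_isGreatest ⟨p, ⟨le_rfl, hP.1⟩, hp0⟩
  have haP : a < P := lt_of_le_of_ne haI.2 fun h0 => hlt.ne' (h0 ▸ haF)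
  have hFi : (σ i).real (Iic P) = (σ i).real (Iic a) := by
    refine hIic i a P haP.le ?_
    filter_upwards [hae i j hij] with x hx hxI
    have := hamax ⟨⟨haI.1.trans hxI.1.le, hxI.2⟩, (hx (hxI.2.trans_lt hP.2)).2⟩
    exact absurd hxI.1 (not_lt.2 this)
  set x := (a + P) / 2 with hx
  have hxa : a < x := by linarith
  have hxP : x < P := by linarith
  have hFj : (σ j).real (Iic x) = (σ j).real (Iic a) := by
    refine hIic j a x hxa.le ?_
    filter_upwards [hae j i rfl] with z hz hzI
    have hzP : z < P := hzI.2.trans_lt hxP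
    have h1 := (hz (hzP.trans hP.2)).2
    have h2 : (σ i).real (Iic a) ≤ (σ i).real (Iic z) :=
      measureReal_mono (Iic_subset_Iic.2 hzI.1.le)
    have h3 := hlow i P hP
    have h4 := hΦmono z P (haI.1.trans hzI.1.le) hzP hP.2.le
    linarith
  have h5 := hlow j x ⟨haI.1.trans hxa.le, hxP.trans hP.2⟩
  have h6 := hΦmono a x haI.1 hxa (hxP.trans hP.2).le
  rw [hFj, haF] at h5
  linarith

/-- For a firm without an atom at `c` the cdf tends to one at `c`; inserting this in `cdf_eq` yields
the common profit. -/
theorem equilibrium_profit_eq (h : MixedPricing profit c lam σ U) (i : Firm) :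
    U i = (1 - lam) * profit c := by
  obtain ⟨k, hk⟩ : ∃ k, σ k {c} = 0 := (h.top .X).elim (fun h => ⟨_, h⟩) fun h => ⟨_, h⟩
  have hki : U k = U i := by
    rcases eq_or_ne k i with rfl | hne
    · rfl
    · have : k = i.other := by cases i <;> cases k <;> simp_all [Firm.other]
      rw [this, h.profit_eq_other]
  have := h.prob k
  obtain ⟨p, hp, hpU⟩ := h.exists_profit_eq ⟨h.pos k, h.lt_profit_top k⟩
  have hc0 : 0 < profit c := (h.pos k).trans (h.lt_profit_top k)
  have h1 : Tendsto (fun x => (σ k).real (Iic x)) (𝓝[<] c) (𝓝 ((σ k).real (Iic c))) :=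
    (Measure.continuousAt_real_Iic hk).tendsto.mono_left nhdsWithin_le_nhds
  have h2 : Tendsto (fun x => (1 - U k / profit x) / lam) (𝓝[<] c) (𝓝 ((1 - U k / profit c) / lam)) := by
    refine Tendsto.mono_left ?_ nhdsWithin_le_nhds
    exact ((tendsto_const_nhds.div (h.continuous.tendsto c) hc0.ne').const_sub 1).div_const _
  have h3 : (σ k).real (Iic c) = 1 := by
    rw [← probReal_univ (μ := σ k)]
    refine measureReal_congr ?_
    filter_upwards [h.ae_mem k] with x hx
    exact propext ⟨fun _ => trivial, fun _ => hx.2⟩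
  have h4 := tendsto_nhds_unique (h2.congr' ?_) h1
  · rw [h3, div_eq_one_iff_eq h.lam_pos.ne'] at h4
    have h5 : U k / profit c = 1 - lam := by linarith
    rw [← hki, ← h5, div_mul_cancel₀ _ hc0.ne']
  · filter_upwards [Ioo_mem_nhdsLT hp.2] with x hx
    exact (h.cdf_eq k hp hpU ⟨hx.1.le, hx.2⟩).symm

end MixedPricing

/-- The cdf of equilibrium prices when `profit p = (1 - lam) * profit c`. -/
noncomputable def pricingCdf (profit : ℝ → ℝ) (c lam p x : ℝ) : ℝ :=
  (1 - (1 - lam) * profit c / profit (max p (min x c))) / lam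

theorem MixedPricing.real_Iic_eq_pricingCdf {profit : ℝ → ℝ} {c lam : ℝ} {σ : Firm → Measure ℝ}
    {U : Firm → ℝ} (h : MixedPricing profit c lam σ U) (i : Firm) {p : ℝ} (hp : p ∈ Ioo 0 c)
    (hpc : profit p = (1 - lam) * profit c) (x : ℝ) :
    (σ i).real (Iic x) = pricingCdf profit c lam p x := by
  have := h.prob i
  have hU := h.equilibrium_profit_eq i
  have hc0 : 0 < profit c := (h.pos i).trans (h.lt_profit_top i)
  have hl := h.lam_pos
  have hcdf := fun P hP => h.cdf_eq i hp (hpc.trans hU.symm) (P := P) hP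
  unfold pricingCdf
  rcases lt_or_ge x p with hx | hx
  · rw [min_eq_left (hx.trans hp.2).le, max_eq_left hx.le, hpc, div_self
      (by rw [← hU]; exact (h.pos i).ne'), sub_self, zero_div]
    refine le_antisymm ?_ measureReal_nonneg
    have h1 := hcdf p ⟨le_rfl, hp.2⟩
    rw [hU, hpc, div_self (by rw [← hU]; exact (h.pos i).ne'), sub_self, zero_div] at h1
    exact h1 ▸ measureReal_mono (Iic_subset_Iic.2 hx.le)
  · rcases lt_or_ge x c with hxc | hxc
    · rw [min_eq_left hxc.le, max_eq_right hx, hcdf x ⟨hx, hxc⟩, hU]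
    · rw [min_eq_right hxc, max_eq_right hp.2.le, mul_div_cancel_right₀ _ hc0.ne', sub_sub_cancel,
        div_self hl.ne', ← probReal_univ (μ := σ i)]
      refine measureReal_congr ?_
      filter_upwards [h.ae_mem i] with y hy
      exact propext ⟨fun _ => trivial, fun _ => hy.2.trans hxc⟩

/-! ### The good types as undercutting competitors -/

namespace Market

variable {M : Market}

theorem NegCorr.expDemand_one (hM : M.NegCorr) {τ : Measure ℝ} [IsProbabilityMeasure τ] {β : ℝ → ℝ}
    (hβ1 : ∀ Q, β Q ≤ 1) (hτ : ∀ᵐ Q ∂τ, Q < M.cost .B → β Q = 1) {P : ℝ}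
    (hP : P < M.cost .B) :
    M.expDemand τ β P 1 = M.reach P 1 * (τ.real (Ioi P) + τ.real {P} / 2) := by
  have h1 : M.expDemand τ β P 1 = ∫ Q, ((Ioi P).indicator (fun _ => M.reach P 1) Q +
      ({P} : Set ℝ).indicator (fun _ => M.reach P 1 / 2) Q) ∂τ := by
    refine integral_congr_ae ?_
    filter_upwards [hτ] with Q hQ
    rcases lt_trichotomy Q P with hlt | heq | hgt
    · rw [indicator_of_notMem (by simpa using hlt.le), indicator_of_notMem (by simpa using hlt.ne),
        hM.share_eq_zero_of_lt hlt (hQ (hlt.trans hP)).ge, add_zero]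
    · rw [heq] at hQ
      rw [heq, indicator_of_notMem (by simp), indicator_of_mem (mem_singleton P), hQ hP,
        hM.share_self, zero_add]
    · rw [indicator_of_mem (show Q ∈ Ioi P from hgt), indicator_of_notMem (by simpa using hgt.ne'),
        hM.share_of_lt hgt (hβ1 Q), add_zero]
  rw [h1, integral_add ((integrable_const _).indicator measurableSet_Ioi)
    ((integrable_const _).indicator (measurableSet_singleton P)),
    integral_indicator_const _ measurableSet_Ioi,
    integral_indicator_const _ (measurableSet_singleton P), smul_eq_mul, smul_eq_mul]
  ring

theorem mix_real_Ioi_add (hM : M.NegCorr) {σ : Firm → Quality → Measure ℝ}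
    (hσ : ∀ i θ, IsProbabilityMeasure (σ i θ)) {i : Firm}
    (hB : σ i .B = Measure.dirac (M.cost .B)) {P : ℝ} (hP : P < M.cost .B) :
    (M.mix σ i).real (Ioi P) + (M.mix σ i).real {P} / 2 =
      1 - M.prior * ((σ i .G).real (Iio P) + (σ i .G).real {P} / 2) := by
  have := hσ i .G
  have h1 : (σ i .B).real (Ioi P) = 1 := by
    simp [Measure.real, hB, hP]
  have h2 : (σ i .B).real {P} = 0 := by
    simp [Measure.real, hB, hP.ne']
  have h3 : (σ i .G).real (Ioi P) = 1 - ((σ i .G).real (Iio P) + (σ i .G).real {P}) := by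
    rw [← measureReal_union (by simp) (measurableSet_singleton P), Iio_union_right, ← compl_Iic,
      measureReal_compl measurableSet_Iic, probReal_univ]
  rw [mix_real hM hσ, mix_real hM hσ, h1, h2, h3]
  ring

/-- The good type's complete-information monopoly profit. -/
noncomputable def monopolyProfit (M : Market) (P : ℝ) : ℝ := P * M.reach P 1

theorem NegCorr.continuous_monopolyProfit (hM : M.NegCorr) : Continuous M.monopolyProfit :=
  continuous_id.mul (hM.continuous_reach zero_le_one)

theorem monopolyProfit_zero : M.monopolyProfit 0 = 0 := zero_mul _

namespace OfferEquilibrium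

variable {σ : Firm → Quality → Measure ℝ} {β : Firm → ℝ → ℝ} {U : Firm → Quality → ℝ}

theorem ae_mix_belief (h : M.OfferEquilibrium σ β U) (hM : M.NegCorr) (i : Firm) :
    ∀ᵐ P ∂M.mix σ i, P < M.cost .B → β i P = 1 := by
  have h1 : ∀ᵐ P ∂σ i .B, P = M.cost .B := by
    rw [(h.bad_eq_dirac hM i).1, ae_dirac_eq]; rfl
  filter_upwards [(h.bad_ae_iff hM).1 h1] with P hP hlt
  by_contra hne
  exact hlt.ne (hP hne)

/-- Any sale above `c_B` would give the bad type a positive profit, so a good type there would sell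
nothing and earn zero. -/
theorem ae_good_le_cost (h : M.OfferEquilibrium σ β U) (hM : M.NegCorr) (i : Firm) :
    ∀ᵐ P ∂σ i .G, P ∈ Icc 0 (M.cost .B) := by
  filter_upwards [h.feasible i .G, h.attained i .G] with P h1 h2
  refine ⟨h1.1, ?_⟩
  by_contra hlt
  push Not at hlt
  have h3 := h.optimal i .B P h1
  rw [(h.bad_eq_dirac hM i).2] at h3
  have h4 := expDemand_nonneg (M := M) (M.mix σ i.other) (β i.other) P (β i P)
  have h5 : M.expDemand (M.mix σ i.other) (β i.other) P (β i P) = 0 := by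
    by_contra hne
    have := mul_pos (sub_pos.2 hlt) (lt_of_le_of_ne h4 (Ne.symm hne))
    linarith
  rw [h5, mul_zero] at h2
  exact (h.good_profit_pos hM i).ne h2

theorem ae_mix_le_cost (h : M.OfferEquilibrium σ β U) (hM : M.NegCorr) (i : Firm) :
    ∀ᵐ P ∂M.mix σ i, P ≤ M.cost .B := by
  refine (mix_ae_iff hM).2 ⟨(h.ae_good_le_cost hM i).mono fun P hP => hP.2, ?_⟩
  rw [(h.bad_eq_dirac hM i).1]
  exact (ae_dirac_iff measurableSet_Iic).2 le_rfl

/-- The actual belief at `P` may be less than one, so optimality alone does not suffice. A gain at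
belief one would persist on an interval just below `P`, where the bad type makes a loss, against
`not_separating_interval`. -/
theorem profit_one_le (h : M.OfferEquilibrium σ β U) (hM : M.NegCorr) (i : Firm) {P : ℝ}
    (hP : P ∈ Ioo 0 (M.cost .B)) :
    P * M.expDemand (M.mix σ i.other) (β i.other) P 1 ≤ U i .G := by
  have := h.isProbabilityMeasure hM i.other
  by_contra hlt
  push Not at hlt
  set e := M.expDemand (M.mix σ i.other) (β i.other) P 1
  have hUG := h.good_profit_pos hM i
  have he : 0 < e := pos_of_mul_pos_right (hUG.trans hlt) hP.1.le
  have hge : ∀ Q < P, e ≤ M.expDemand (M.mix σ i.other) (β i.other) Q 1 := fun Q hQ =>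
    hM.expDemand_mono _ (h.measurable _) hQ.le le_rfl
  refine h.not_separating_interval hM i (a := U i .G / e) (b := P) (by rwa [div_lt_iff₀ he])
    (by positivity) ((hP.2.trans hM.cost_B_lt).trans hM.vbar_lt_Pmax).le (fun Q hQ => ?_)
    (fun Q hQ => ?_) ?_
  · have h1 := hQ.1
    rw [div_lt_iff₀ he] at h1
    have h2 : 0 < Q := lt_trans (by positivity) hQ.1
    exact h1.trans_le (mul_le_mul_of_nonneg_left (hge Q hQ.2) h2.le)
  · rw [(h.bad_eq_dirac hM i).2]
    exact mul_neg_of_neg_of_pos (by linarith [hQ.2, hP.2]) (he.trans_le (hge Q hQ.2))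
  · filter_upwards [h.ae_cost_le_bad hM i] with Q hQ hQI
    linarith [hQI.2, hP.2]

theorem profit_one_eq (h : M.OfferEquilibrium σ β U) (hM : M.NegCorr) (i : Firm) {P : ℝ}
    (hP : P < M.cost .B) :
    P * M.expDemand (M.mix σ i.other) (β i.other) P 1 = M.monopolyProfit P *
      (1 - M.prior * ((σ i.other .G).real (Iio P) + (σ i.other .G).real {P} / 2)) := by
  have := h.isProbabilityMeasure hM i.other
  rw [hM.expDemand_one (h.le_one _) (h.ae_mix_belief hM _) hP,
    mix_real_Ioi_add hM h.prob (h.bad_eq_dirac hM _).1 hP, monopolyProfit]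
  ring

/-- If both good types charged the bad type's cost with positive probability, each would prefer
to undercut. -/
theorem good_singleton_cost (h : M.OfferEquilibrium σ β U) (hM : M.NegCorr) (i : Firm) :
    σ i .G {M.cost .B} = 0 ∨ σ i.other .G {M.cost .B} = 0 := by
  by_contra hcon
  push Not at hcon
  set c := M.cost .B with hc
  have hc0 : 0 < c := hM.cost_B_pos
  have key : ∀ k l : Firm, k.other = l → σ k .G {c} ≠ 0 → σ l .G {c} ≠ 0 →
      M.reach c 1 ≤ M.share c (β k c) c (β l c) := by
    intro k l hkl hk hl
    subst hkl
    have := h.isProbabilityMeasure hM k.other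
    have hτ0 : 0 < (M.mix σ k.other).real {c} := by
      refine ENNReal.toReal_pos (fun h0 => hl ?_) (measure_ne_top _ _)
      rw [measure_eq_zero_iff_ae_notMem] at h0 ⊢
      exact ae_good_of_ae_mix hM h0
    have hatt := Measure.of_ae_of_singleton_ne_zero (h.attained k .G) hk
    rw [hM.cost_G, sub_zero] at hatt
    have hE : M.expDemand (M.mix σ k.other) (β k.other) c (β k c) =
        (M.mix σ k.other).real {c} * M.share c (β k c) c (β k.other c) := by
      rw [← smul_eq_mul, ← integral_indicator_const _ (measurableSet_singleton c)]
      refine integral_congr_ae ?_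
      filter_upwards [h.ae_mix_belief hM k.other, h.ae_mix_le_cost hM k.other] with Q h1 h2
      rcases h2.lt_or_eq with hlt | heq
      · rw [indicator_of_notMem (by simpa using hlt.ne)]
        exact hM.share_eq_zero_of_lt hlt (by rw [h1 hlt]; exact h.le_one _ _)
      · rw [heq, indicator_of_mem (mem_singleton _)]
    -- Undercutting `c` at belief one wins the whole market whenever the rival is at `c`.
    have hlow : ∀ P ∈ Ioo 0 c, P * ((M.mix σ k.other).real {c} * M.reach c 1) ≤ U k .G := by
      intro P hP
      refine le_trans (mul_le_mul_of_nonneg_left ?_ hP.1.le) (h.profit_one_le hM k hP)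
      rw [hM.expDemand_one (h.le_one _) (h.ae_mix_belief hM _) hP.2, mul_comm]
      refine mul_le_mul (hM.reach_anti 1 hP.2.le) ?_ measureReal_nonneg (reach_nonneg _ _)
      have h1 : (M.mix σ k.other).real {c} ≤ (M.mix σ k.other).real (Ioi P) :=
        measureReal_mono (singleton_subset_iff.2 hP.2)
      have h2 : 0 ≤ (M.mix σ k.other).real {P} := measureReal_nonneg
      linarith
    have hlim : c * ((M.mix σ k.other).real {c} * M.reach c 1) ≤ U k .G := by
      refine le_of_tendsto (f := fun P : ℝ => P * ((M.mix σ k.other).real {c} * M.reach c 1))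
        (x := 𝓝[<] c) ?_ ?_
      · exact Tendsto.mono_left ((continuous_id.mul continuous_const).tendsto c) nhdsWithin_le_nhds
      · filter_upwards [Ioo_mem_nhdsLT hc0] with P hP using hlow P hP
    rw [← hatt, hE] at hlim
    exact le_of_mul_le_mul_left (le_of_mul_le_mul_left hlim hc0) hτ0
  -- Each firm would need the entire belief-one market in the tie at `c`, but together they serve at
  -- most that market once.
  have h1 := key i i.other rfl hcon.1 hcon.2
  have h2 := key i.other i (Firm.other_other i) hcon.2 hcon.1
  have h3 := hM.share_add_share c (β i c) c (β i.other c)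
  have := hM.isProbabilityMeasure
  have h4 : M.valuation.real {v | 0 ≤ max (M.net c (β i c) v) (M.net c (β i.other c) v)} ≤
      M.reach c 1 := by
    refine measureReal_mono fun v hv => ?_
    exact le_trans (show (0 : ℝ) ≤ _ from hv) (max_le (hM.net_le_net le_rfl (h.le_one _ _) v)
      (hM.net_le_net le_rfl (h.le_one _ _) v))
  have h5 := hM.reach_pos zero_le_one hM.cost_B_lt
  linarith

theorem mixedPricing (h : M.OfferEquilibrium σ β U) (hM : M.NegCorr) :
    MixedPricing M.monopolyProfit (M.cost .B) M.prior (fun i => σ i .G) (fun i => U i .G) where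
  lam_pos := hM.prior_pos
  lam_lt_one := hM.prior_lt_one
  continuous := hM.continuous_monopolyProfit
  strictMonoOn := hM.strictMonoOn_reach
  profit_zero := monopolyProfit_zero
  prob i := h.prob i .G
  ae_mem i := h.ae_good_le_cost hM i
  pos i := h.good_profit_pos hM i
  le i P hP := by
    rw [← h.profit_one_eq hM i hP.2]; exact h.profit_one_le hM i hP
  attained i := by
    filter_upwards [h.attained i .G, ae_good_of_ae_mix hM (h.ae_mix_belief hM i)] with P h1 h2 hP
    rw [← h.profit_one_eq hM i hP]
    rwa [hM.cost_G, sub_zero, h2 hP] at h1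
  top i := h.good_singleton_cost hM i

end OfferEquilibrium

end Market

/-! ### The equilibrium price distribution -/

/-- Data for which `pricingCdf` is the cdf of an atomless distribution on `[p, c]`. -/
structure PricingData (profit : ℝ → ℝ) (c lam p : ℝ) : Prop where
  lam_pos : 0 < lam
  lam_lt_one : lam < 1
  continuous : Continuous profit
  strictMonoOn : StrictMonoOn profit (Icc 0 c)
  profit_zero : profit 0 = 0
  mem : p ∈ Ioo 0 c
  profit_eq : profit p = (1 - lam) * profit c

namespace PricingData

variable {profit : ℝ → ℝ} {c lam p : ℝ}

theorem profit_pos (h : PricingData profit c lam p) {x : ℝ} (hx : x ∈ Ioc 0 c) : 0 < profit x := by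
  rw [← h.profit_zero]
  exact h.strictMonoOn ⟨le_rfl, hx.1.le.trans hx.2⟩ ⟨hx.1.le, hx.2⟩ hx.1

theorem clamp_mem (h : PricingData profit c lam p) (x : ℝ) : max p (min x c) ∈ Icc p c :=
  ⟨le_max_left _ _, max_le h.mem.2.le (min_le_right _ _)⟩

theorem profit_clamp_pos (h : PricingData profit c lam p) (x : ℝ) :
    0 < profit (max p (min x c)) :=
  h.profit_pos ⟨h.mem.1.trans_le (h.clamp_mem x).1, (h.clamp_mem x).2⟩

theorem top_pos (h : PricingData profit c lam p) : 0 < (1 - lam) * profit c :=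
  h.profit_eq ▸ h.profit_pos ⟨h.mem.1, h.mem.2.le⟩

theorem continuous_pricingCdf (h : PricingData profit c lam p) :
    Continuous (pricingCdf profit c lam p) := by
  have := h.continuous
  unfold pricingCdf
  refine Continuous.div_const (continuous_const.sub (continuous_const.div ?_
    fun x => (h.profit_clamp_pos x).ne')) _
  fun_prop

theorem monotone_pricingCdf (h : PricingData profit c lam p) :
    Monotone (pricingCdf profit c lam p) := by
  intro x y hxy
  have hsub : Icc p c ⊆ Icc 0 c := Icc_subset_Icc_left h.mem.1.le
  refine div_le_div_of_nonneg_right (sub_le_sub_left ?_ 1) h.lam_pos.le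
  exact div_le_div_of_nonneg_left h.top_pos.le (h.profit_clamp_pos x)
    (h.strictMonoOn.monotoneOn (hsub (h.clamp_mem x)) (hsub (h.clamp_mem y))
      (max_le_max le_rfl (min_le_min_right _ hxy)))

theorem pricingCdf_of_mem {x : ℝ} (hx : x ∈ Icc p c) :
    pricingCdf profit c lam p x = (1 - (1 - lam) * profit c / profit x) / lam := by
  rw [pricingCdf, min_eq_left hx.2, max_eq_right hx.1]

theorem pricingCdf_of_le (h : PricingData profit c lam p) {x : ℝ} (hx : x ≤ p) :
    pricingCdf profit c lam p x = 0 := by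
  rw [pricingCdf, min_eq_left (hx.trans h.mem.2.le), max_eq_left hx, h.profit_eq,
    div_self h.top_pos.ne', sub_self, zero_div]

theorem pricingCdf_of_ge (h : PricingData profit c lam p) {x : ℝ} (hx : c ≤ x) :
    pricingCdf profit c lam p x = 1 := by
  have hc := h.profit_pos ⟨h.mem.1.trans h.mem.2, le_refl c⟩
  rw [pricingCdf, min_eq_right hx, max_eq_right h.mem.2.le, mul_div_cancel_right₀ _ hc.ne',
    sub_sub_cancel, div_self h.lam_pos.ne']

theorem strictMonoOn_pricingCdf (h : PricingData profit c lam p) :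
    StrictMonoOn (pricingCdf profit c lam p) (Icc p c) := by
  intro x hx y hy hxy
  have hsub : Icc p c ⊆ Icc 0 c := Icc_subset_Icc_left h.mem.1.le
  rw [pricingCdf_of_mem hx, pricingCdf_of_mem hy]
  refine div_lt_div_of_pos_right (sub_lt_sub_left ?_ 1) h.lam_pos
  exact div_lt_div_of_pos_left h.top_pos (h.profit_pos ⟨h.mem.1.trans_le hx.1, hx.2⟩)
    (h.strictMonoOn (hsub hx) (hsub hy) hxy)

/-- The cdf of equilibrium prices as a Stieltjes function. -/
noncomputable def stieltjes (h : PricingData profit c lam p) : StieltjesFunction ℝ where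
  toFun := pricingCdf profit c lam p
  mono' := h.monotone_pricingCdf
  right_continuous' _ := h.continuous_pricingCdf.continuousWithinAt

/-- The distribution of equilibrium prices. -/
noncomputable def law (h : PricingData profit c lam p) : Measure ℝ := h.stieltjes.measure

theorem tendsto_atBot (h : PricingData profit c lam p) : Tendsto h.stieltjes atBot (𝓝 0) :=
  tendsto_const_nhds.congr' ((eventually_le_atBot p).mono fun _ hx => (h.pricingCdf_of_le hx).symm)

theorem tendsto_atTop (h : PricingData profit c lam p) : Tendsto h.stieltjes atTop (𝓝 1) :=
  tendsto_const_nhds.congr' ((eventually_ge_atTop c).mono fun _ hx => (h.pricingCdf_of_ge hx).symm)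

theorem isProbabilityMeasure_law (h : PricingData profit c lam p) : IsProbabilityMeasure h.law :=
  h.stieltjes.isProbabilityMeasure h.tendsto_atBot h.tendsto_atTop

theorem law_Iic (h : PricingData profit c lam p) (x : ℝ) :
    h.law (Iic x) = ENNReal.ofReal (pricingCdf profit c lam p x) := by
  rw [law, StieltjesFunction.measure_Iic _ h.tendsto_atBot, sub_zero]; rfl

theorem pricingCdf_nonneg (h : PricingData profit c lam p) (x : ℝ) :
    0 ≤ pricingCdf profit c lam p x := by
  rcases le_total x p with hx | hx
  · exact (h.pricingCdf_of_le hx).ge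
  · exact (h.pricingCdf_of_le le_rfl).ge.trans (h.monotone_pricingCdf hx)

theorem law_real_Iic (h : PricingData profit c lam p) (x : ℝ) :
    h.law.real (Iic x) = pricingCdf profit c lam p x := by
  rw [Measure.real, h.law_Iic, ENNReal.toReal_ofReal (h.pricingCdf_nonneg x)]

theorem law_singleton (h : PricingData profit c lam p) (x : ℝ) : h.law {x} = 0 := by
  have h1 : Function.leftLim h.stieltjes x = h.stieltjes x :=
    h.continuous_pricingCdf.continuousAt.continuousWithinAt.leftLim_eq
  rw [law, StieltjesFunction.measure_singleton, h1, sub_self, ENNReal.ofReal_zero]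

theorem ae_mem_Ico (h : PricingData profit c lam p) : ∀ᵐ x ∂h.law, x ∈ Ico p c := by
  have := h.isProbabilityMeasure_law
  have h1 : h.law (Iic p) = 0 := by rw [h.law_Iic, h.pricingCdf_of_le le_rfl, ENNReal.ofReal_zero]
  have h2 : h.law (Iic c)ᶜ = 0 := by
    rw [prob_compl_eq_zero_iff measurableSet_Iic, h.law_Iic, h.pricingCdf_of_ge le_rfl,
      ENNReal.ofReal_one]
  filter_upwards [measure_eq_zero_iff_ae_notMem.1 h1, measure_eq_zero_iff_ae_notMem.1 h2,
    measure_eq_zero_iff_ae_notMem.1 (h.law_singleton c)] with x g1 g2 g3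
  exact ⟨(not_le.1 g1).le, lt_of_le_of_ne (not_not.1 g2) g3⟩

theorem support_law (h : PricingData profit c lam p) : h.law.support = Icc p c := by
  refine Subset.antisymm (Measure.support_subset_of_isClosed isClosed_Icc
    (h.ae_mem_Ico.mono fun x hx => Ico_subset_Icc_self hx)) fun x hx => ?_
  rw [Measure.mem_support_iff_forall]
  intro V hV
  obtain ⟨ε, hε, hb⟩ := Metric.mem_nhds_iff.1 hV
  rw [Real.ball_eq_Ioo] at hb
  have hpc := h.mem.2
  have hab : max p (x - ε / 2) < min c (x + ε / 2) := by
    rw [max_lt_iff, lt_min_iff, lt_min_iff]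
    exact ⟨⟨hpc, by linarith [hx.1]⟩, by linarith [hx.2], by linarith⟩
  have hpos : 0 < h.law (Ioc (max p (x - ε / 2)) (min c (x + ε / 2))) := by
    rw [law, StieltjesFunction.measure_Ioc, ENNReal.ofReal_pos, sub_pos]
    exact h.strictMonoOn_pricingCdf ⟨le_max_left _ _, hab.le.trans (min_le_left _ _)⟩
      ⟨(le_max_left _ _).trans hab.le, min_le_left _ _⟩ hab
  refine hpos.trans_le (measure_mono fun y hy => hb ⟨?_, ?_⟩)
  · have := (le_max_right p (x - ε / 2)).trans_lt hy.1; linarith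
  · have := hy.2.trans (min_le_right c (x + ε / 2)); linarith

theorem profit_mul_one_sub (h : PricingData profit c lam p) {x : ℝ} (hx : x ∈ Icc p c) :
    profit x * (1 - lam * pricingCdf profit c lam p x) = profit p := by
  have h0 := h.profit_pos ⟨h.mem.1.trans_le hx.1, hx.2⟩
  have := h.lam_pos
  rw [pricingCdf_of_mem hx, h.profit_eq]
  field_simp
  ring

end PricingData

/-! ### Existence of the signalling equilibrium and uniqueness on the path -/

namespace Market

variable {M : Market}

theorem NegCorr.exists_pricingData (hM : M.NegCorr) :
    ∃ p, PricingData M.monopolyProfit (M.cost .B) M.prior p := by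
  have hc : 0 < M.monopolyProfit (M.cost .B) :=
    mul_pos hM.cost_B_pos (hM.reach_pos zero_le_one hM.cost_B_lt)
  have h1 := hM.prior_pos
  have h2 := hM.prior_lt_one
  have hiv := intermediate_value_Ioo hM.cost_B_pos.le hM.continuous_monopolyProfit.continuousOn
  rw [monopolyProfit_zero] at hiv
  obtain ⟨p, hp, hpe⟩ := hiv (show (1 - M.prior) * M.monopolyProfit (M.cost .B) ∈
    Ioo 0 (M.monopolyProfit (M.cost .B)) from
      ⟨mul_pos (by linarith) hc, by nlinarith⟩)
  exact ⟨p, h1, h2, hM.continuous_monopolyProfit, hM.strictMonoOn_reach, monopolyProfit_zero, hp, hpe⟩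

/-- The equilibrium: bad types charge their cost, good types mix below it, and a price signals the
good type if and only if it is below the bad type's cost. -/
noncomputable def signallingEquilibrium {p : ℝ}
    (h : PricingData M.monopolyProfit (M.cost .B) M.prior p) : Assessment where
  price _ θ := match θ with
    | .G => h.law
    | .B => Measure.dirac (M.cost .B)
  belief _ P := if P < M.cost .B then 1 else 0
  buy := M.bestReply fun _ P => if P < M.cost .B then 1 else 0

section Signalling

variable {p : ℝ} (h : PricingData M.monopolyProfit (M.cost .B) M.prior p)

theorem signalling_prob (i : Firm) (θ : Quality) : IsProbabilityMeasure ((signallingEquilibrium h).price i θ) := by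
  cases θ
  · exact h.isProbabilityMeasure_law
  · exact Measure.dirac.isProbabilityMeasure

theorem signalling_ae_mix_le (hM : M.NegCorr) (i : Firm) :
    ∀ᵐ P ∂M.mix (signallingEquilibrium h).price i, P ∈ Icc 0 (M.cost .B) := by
  refine (mix_ae_iff hM).2 ⟨h.ae_mem_Ico.mono fun P hP => ⟨h.mem.1.le.trans hP.1, hP.2.le⟩, ?_⟩
  exact (ae_dirac_iff measurableSet_Icc).2 ⟨hM.cost_B_pos.le, le_rfl⟩

theorem signalling_ae_mix_feasible (hM : M.NegCorr) (i : Firm) :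
    ∀ᵐ P ∂M.mix (signallingEquilibrium h).price i, P ∈ Icc 0 M.Pmax :=
  (signalling_ae_mix_le h hM i).mono fun _ hP =>
    ⟨hP.1, hP.2.trans (hM.cost_B_lt.trans hM.vbar_lt_Pmax).le⟩

theorem signalling_belief_measurable (i : Firm) : Measurable ((signallingEquilibrium h).belief i) :=
  Measurable.ite measurableSet_Iio measurable_const measurable_const

theorem signalling_belief_of_lt {i : Firm} {P : ℝ} (hP : P < M.cost .B) : (signallingEquilibrium h).belief i P = 1 :=
  if_pos hP

theorem signalling_belief_of_ge {i : Firm} {P : ℝ} (hP : M.cost .B ≤ P) : (signallingEquilibrium h).belief i P = 0 :=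
  if_neg (not_lt.2 hP)

theorem signalling_belief_mem (i : Firm) (P : ℝ) : (signallingEquilibrium h).belief i P ∈ Icc (0 : ℝ) 1 := by
  rcases lt_or_ge P (M.cost .B) with hP | hP
  · rw [signalling_belief_of_lt h hP]; simp
  · rw [signalling_belief_of_ge h hP]; simp

theorem signalling_consumer_optimal (hM : M.NegCorr) : M.IsConsumerBR (signallingEquilibrium h).belief (signallingEquilibrium h).buy :=
  hM.isConsumerBR_bestReply (signalling_belief_measurable h)

/-- Revenue from a price below the bad type's cost that signals the good type. -/
theorem signalling_revenue_of_lt (hM : M.NegCorr) (i : Firm) {P : ℝ} (hP : P < M.cost .B) :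
    P * M.expDemand (M.mix (signallingEquilibrium h).price i) ((signallingEquilibrium h).belief i) P 1 =
      M.monopolyProfit P * (1 - M.prior * pricingCdf M.monopolyProfit (M.cost .B) M.prior p P) := by
  have := isProbabilityMeasure_mix hM (signalling_prob h) i
  have := h.isProbabilityMeasure_law
  rw [hM.expDemand_one (fun Q => (signalling_belief_mem h i Q).2)
    (ae_of_all _ fun Q hQ => signalling_belief_of_lt h hQ) hP,
    mix_real_Ioi_add hM (signalling_prob h) rfl hP]
  have h1 : ((signallingEquilibrium h).price i .G).real {P} = 0 := by
    change h.law.real {P} = 0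
    rw [Measure.real, h.law_singleton, ENNReal.toReal_zero]
  have h2 : ((signallingEquilibrium h).price i .G).real (Iio P) = pricingCdf M.monopolyProfit (M.cost .B) M.prior p P := by
    change h.law.real (Iio P) = _
    rw [← h.law_real_Iic]
    refine measureReal_congr ?_
    filter_upwards [measure_eq_zero_iff_ae_notMem.1 (h.law_singleton P)] with x hx
    exact propext ⟨fun hxP => le_of_lt hxP, fun hxP => lt_of_le_of_ne hxP hx⟩
  rw [h1, h2, monopolyProfit]
  ring

theorem signalling_expDemand_of_gt (hM : M.NegCorr) (i : Firm) {P : ℝ} (hP : M.cost .B < P) :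
    M.expDemand (M.mix (signallingEquilibrium h).price i) ((signallingEquilibrium h).belief i) P 0 = 0 := by
  refine integral_eq_zero_of_ae ?_
  filter_upwards [signalling_ae_mix_le h hM i] with Q hQ
  exact hM.share_eq_zero_of_lt (hQ.2.trans_lt hP) (signalling_belief_mem h i Q).1

/-- At `c_B` with belief zero only the tie with a bad rival yields sales. The bound is the one for
which `c_B` earns a good type no more than `profit p = (1 - μ₀) π(c_B)`. -/
theorem signalling_expDemand_cost (hM : M.NegCorr) (i : Firm) :
    M.expDemand (M.mix (signallingEquilibrium h).price i) ((signallingEquilibrium h).belief i) (M.cost .B) 0 ≤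
      (1 - M.prior) * M.reach (M.cost .B) 1 := by
  have := isProbabilityMeasure_mix hM (signalling_prob h) i
  have hmono : M.reach (M.cost .B) 0 ≤ M.reach (M.cost .B) 1 := by
    have := hM.isProbabilityMeasure
    exact measureReal_mono fun v hv => le_trans hv (hM.net_le_net le_rfl zero_le_one v)
  have hatom : (M.mix (signallingEquilibrium h).price i).real {M.cost .B} = 1 - M.prior := by
    rw [mix_real hM (signalling_prob h)]
    change M.prior * h.law.real {M.cost .B} +
      (1 - M.prior) * (Measure.dirac (M.cost .B)).real {M.cost .B} = 1 - M.prior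
    simp [Measure.real, h.law_singleton]
  have h1 : 0 ≤ M.reach (M.cost .B) 0 := reach_nonneg _ _
  calc M.expDemand (M.mix (signallingEquilibrium h).price i) ((signallingEquilibrium h).belief i) (M.cost .B) 0
      = ∫ Q, ({M.cost .B} : Set ℝ).indicator (fun _ => M.reach (M.cost .B) 0 / 2) Q
          ∂M.mix (signallingEquilibrium h).price i := by
        refine integral_congr_ae ?_
        filter_upwards [signalling_ae_mix_le h hM i] with Q hQ
        rcases hQ.2.lt_or_eq with hlt | heq
        · rw [indicator_of_notMem (by simpa using hlt.ne)]
          exact hM.share_eq_zero_of_lt hlt (signalling_belief_mem h i Q).1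
        · rw [heq, indicator_of_mem (mem_singleton _), signalling_belief_of_ge h le_rfl,
            hM.share_self]
    _ = (1 - M.prior) * (M.reach (M.cost .B) 0 / 2) := by
        rw [integral_indicator_const _ (measurableSet_singleton _), hatom, smul_eq_mul]
    _ ≤ _ := mul_le_mul_of_nonneg_left (by linarith) (by linarith [hM.prior_lt_one])

theorem signalling_profit_eq (hM : M.NegCorr) (i : Firm) (θ : Quality) {P : ℝ}
    (hP : P ∈ Icc 0 M.Pmax) : M.profit (signallingEquilibrium h).price (signallingEquilibrium h).buy i θ P =
      (P - M.cost θ) * M.expDemand (M.mix (signallingEquilibrium h).price i.other) ((signallingEquilibrium h).belief i.other) P ((signallingEquilibrium h).belief i P) :=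
  (signalling_consumer_optimal h hM).profit_eq hM (fun i P => (signalling_belief_mem h i P).1) _ i
    (signalling_ae_mix_feasible h hM i.other) θ hP

/-- On `[p, c_B)` the cdf keeps revenue constant; below `p` there is nobody left to undercut, and
monopoly profit is increasing. -/
theorem signalling_revenue_le (hM : M.NegCorr) (i : Firm) {P : ℝ} (hP : P ∈ Ico 0 (M.cost .B)) :
    P * M.expDemand (M.mix (signallingEquilibrium h).price i) ((signallingEquilibrium h).belief i) P 1 ≤ M.monopolyProfit p := by
  rw [signalling_revenue_of_lt h hM i hP.2]
  rcases le_total p P with hle | hle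
  · exact (h.profit_mul_one_sub ⟨hle, hP.2.le⟩).le
  · rw [h.pricingCdf_of_le hle, mul_zero, sub_zero, mul_one]
    exact h.strictMonoOn.monotoneOn ⟨hP.1, hP.2.le⟩ ⟨h.mem.1.le, h.mem.2.le⟩ hle

theorem signalling_eqProfit_good (hM : M.NegCorr) (i : Firm) :
    M.eqProfit (signallingEquilibrium h) i .G = M.monopolyProfit p := by
  have := h.isProbabilityMeasure_law
  change ∫ P, M.profit (signallingEquilibrium h).price (signallingEquilibrium h).buy i .G P ∂h.law = _
  have : ∀ᵐ P ∂h.law, M.profit (signallingEquilibrium h).price (signallingEquilibrium h).buy i .G P = M.monopolyProfit p := by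
    filter_upwards [h.ae_mem_Ico] with P hP
    have hP0 : 0 ≤ P := h.mem.1.le.trans hP.1
    rw [signalling_profit_eq h hM i .G ⟨hP0, (hP.2.trans (hM.cost_B_lt.trans hM.vbar_lt_Pmax)).le⟩,
      hM.cost_G, sub_zero, signalling_belief_of_lt h hP.2, signalling_revenue_of_lt h hM _ hP.2,
      h.profit_mul_one_sub ⟨hP.1, hP.2.le⟩]
  rw [integral_congr_ae this]
  simp

theorem signalling_eqProfit_bad (i : Firm) : M.eqProfit (signallingEquilibrium h) i .B = 0 := by
  change ∫ P, M.profit (signallingEquilibrium h).price (signallingEquilibrium h).buy i .B P ∂Measure.dirac (M.cost .B) = 0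
  rw [integral_dirac, profit, sub_self, zero_mul]

theorem signalling_isPBE (hM : M.NegCorr) : M.IsPBE (signallingEquilibrium h) where
  price_prob := signalling_prob h
  price_feasible i θ := by
    have h1 := (mix_ae_iff hM).1 (signalling_ae_mix_feasible h hM i)
    cases θ
    · exact h1.1
    · exact h1.2
  firm_optimal i θ P hP := by
    rw [signalling_profit_eq h hM i θ hP]
    have hE := fun m => expDemand_nonneg (M := M) (M.mix (signallingEquilibrium h).price i.other) ((signallingEquilibrium h).belief i.other) P m
    cases θ
    · rw [signalling_eqProfit_good h hM, hM.cost_G, sub_zero]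
      rcases lt_trichotomy P (M.cost .B) with hlt | heq | hgt
      · rw [signalling_belief_of_lt h hlt]
        exact signalling_revenue_le h hM _ ⟨hP.1, hlt⟩
      · rw [signalling_belief_of_ge h heq.ge, heq, h.profit_eq, monopolyProfit]
        have := mul_le_mul_of_nonneg_left (signalling_expDemand_cost h hM i.other) hM.cost_B_pos.le
        linarith
      · rw [signalling_belief_of_ge h hgt.le, signalling_expDemand_of_gt h hM _ hgt, mul_zero,
          h.profit_eq]
        exact h.top_pos.le
    · rw [signalling_eqProfit_bad h]
      rcases lt_or_ge (M.cost .B) P with hgt | hle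
      · rw [signalling_belief_of_ge h hgt.le, signalling_expDemand_of_gt h hM _ hgt, mul_zero]
      · exact mul_nonpos_of_nonpos_of_nonneg (sub_nonpos.2 hle) (hE _)
  belief_measurable := signalling_belief_measurable h
  belief_mem := signalling_belief_mem h
  bayes i S hS := by
    have := h.isProbabilityMeasure_law
    have hind : (signallingEquilibrium h).belief i = (Iio (M.cost .B)).indicator 1 := by
      ext P; simp [signallingEquilibrium, indicator_apply]
    rw [hind, integral_indicator_one measurableSet_Iio, measureReal_restrict_apply measurableSet_Iio,
      mix_real hM (signalling_prob h)]
    change M.prior * h.law.real _ + (1 - M.prior) * (Measure.dirac (M.cost .B)).real _ =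
      M.prior * h.law.real S
    have h1 : (Measure.dirac (M.cost .B)).real (Iio (M.cost .B) ∩ S) = 0 := by
      simp [Measure.real, Measure.dirac_apply' _ (measurableSet_Iio.inter hS)]
    have h2 : h.law.real (Iio (M.cost .B) ∩ S) = h.law.real S := by
      refine measureReal_congr ?_
      filter_upwards [h.ae_mem_Ico] with x hx
      exact propext ⟨fun hxS => hxS.2, fun hxS => ⟨hx.2, hxS⟩⟩
    rw [h1, h2, mul_zero, add_zero]
  consumer_optimal := signalling_consumer_optimal h hM

/-- A price that the bad type strictly avoids at belief one is below `c_B`, where belief is already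
one and the good type cannot gain. At belief zero the bad type cannot earn a positive profit
anywhere. -/
theorem signalling_passesIntuitiveCriterion (hM : M.NegCorr) : M.PassesIntuitiveCriterion (signallingEquilibrium h) := by
  rintro i θ P hP hsupp s hs ⟨h1, h2⟩
  have hnn : ∀ k Q, 0 ≤ (signallingEquilibrium h).belief k Q := fun k Q => (signalling_belief_mem h k Q).1
  have hsure : 0 ≤ θ.sure := by cases θ <;> simp [Quality.sure]
  have hpr := fun θ' => hs.profit_eq hM (replaceBelief_nonneg hnn i P hsure) (signallingEquilibrium h).price i
    (signalling_ae_mix_feasible h hM i.other) θ' hP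
  simp only [replaceBelief_self, replaceBelief_other] at hpr
  have hE := expDemand_nonneg (M := M) (M.mix (signallingEquilibrium h).price i.other) ((signallingEquilibrium h).belief i.other) P θ.sure
  rw [hpr] at h1 h2
  cases θ
  · simp only [Quality.other, Quality.sure] at h1 h2 hE
    rw [signalling_eqProfit_good h hM, hM.cost_G, sub_zero] at h1
    rw [signalling_eqProfit_bad h] at h2
    have hlt : P < M.cost .B := by
      by_contra hge
      exact absurd (mul_nonneg (sub_nonneg.2 (not_lt.1 hge)) hE) (not_le.2 h2)
    exact absurd (signalling_revenue_le h hM i.other ⟨hP.1, hlt⟩) (not_le.2 h1)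
  · simp only [Quality.sure] at h1 hE
    rw [signalling_eqProfit_bad h] at h1
    rcases lt_or_ge (M.cost .B) P with hgt | hle
    · rw [signalling_expDemand_of_gt h hM _ hgt, mul_zero] at h1
      exact lt_irrefl _ h1
    · exact absurd (mul_nonpos_of_nonpos_of_nonneg (sub_nonpos.2 hle) hE) (not_le.2 h1)

theorem signalling_price_eq (hM : M.NegCorr) {A : Assessment} (hA : M.IsPBE A)
    (hIC : M.PassesIntuitiveCriterion A) : A.price = (signallingEquilibrium h).price := by
  have hO := hA.offerEquilibrium hM hIC
  have := h.isProbabilityMeasure_law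
  ext1 i
  ext1 θ
  have := hO.prob i θ
  have := signalling_prob h i θ
  cases θ
  · refine Measure.ext_of_Iic _ _ fun x => ?_
    have h1 := (hO.mixedPricing hM).real_Iic_eq_pricingCdf i h.mem h.profit_eq x
    rw [← h.law_real_Iic] at h1
    exact (measureReal_eq_measureReal_iff (measure_ne_top _ _) (measure_ne_top _ _)).1 h1
  · exact (hO.bad_eq_dirac hM i).1

end Signalling

/-- Equal price laws give equal beliefs almost surely, as both have the same integrals over all
measurable sets. Choices then agree except at valuations indifferent to not buying, a null set. -/
theorem IsPBE.sameOnPath (hM : M.NegCorr) {A A' : Assessment} (hA : M.IsPBE A) (hA' : M.IsPBE A')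
    (hprice : A'.price = A.price) : M.SameOnPath A A' := by
  have hmix := isProbabilityMeasure_mix hM hA.price_prob
  have hint : ∀ {B : Assessment}, M.IsPBE B → ∀ i, Integrable (B.belief i) (M.mix A.price i) :=
    fun {B} hB i => by
      refine Integrable.of_bound (hB.belief_measurable i).aestronglyMeasurable 1
        (ae_of_all _ fun P => ?_)
      rw [Real.norm_of_nonneg (hB.belief_mem i P).1]; exact (hB.belief_mem i P).2
  have hbelief : ∀ i, ∀ᵐ P ∂M.mix A.price i, A'.belief i P = A.belief i P := by
    intro i
    refine Integrable.ae_eq_of_forall_setIntegral_eq _ _ (hint hA' i) (hint hA i) fun S hS _ => ?_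
    have h1 := hA'.bayes i S hS
    rw [hprice] at h1
    rw [h1, hA.bayes i S hS]
  have hfeas : ∀ i, ∀ᵐ P ∂M.mix A.price i, P ∈ Icc 0 M.Pmax := fun i =>
    (mix_ae_iff hM).2 ⟨hA.feasible i _, hA.feasible i _⟩
  refine ⟨hprice, hbelief, ?_⟩
  filter_upwards [hbelief .X, hfeas .X] with P hP hPI
  filter_upwards [hbelief .Y, hfeas .Y] with Q hQ hQI
  have hbel : ∀ k, A'.belief k (priceProfile .X P Q k) = A.belief k (priceProfile .X P Q k) := by
    intro k
    cases k
    · simpa [priceProfile] using hP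
    · simpa [priceProfile] using hQ
  have hp := forall_priceProfile (i := .X) hPI hQI
  have hne := fun k => hM.ae_net_ne_zero (priceProfile .X P Q k)
    (m := A.belief k (priceProfile .X P Q k)) (hA.belief_mem _ _).1
  filter_upwards [ae_mem_Icc, hne .X, hne .Y] with v hv hX hY
  have hsome : ∀ k, A'.buy v (priceProfile .X P Q) (some k) =
      A.buy v (priceProfile .X P Q) (some k) := by
    intro k
    have hk : M.net (priceProfile .X P Q k) (A.belief k (priceProfile .X P Q k)) v ≠ 0 := by
      cases k
      · exact hX
      · exact hY
    rw [hA.consumer_optimal.buy_eq_take hv hp k hk,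
      hA'.consumer_optimal.buy_eq_take hv hp k (by rwa [hbel]), hbel, hbel]
  ext1 a
  rcases a with _ | k
  · have h1 := hA.consumer_optimal.sum_one v (priceProfile .X P Q)
    have h2 := hA'.consumer_optimal.sum_one v (priceProfile .X P Q)
    rw [hsome, hsome] at h2
    linarith
  · exact hsome k

end Market

theorem theorem1 (M : Market) (hM : M.NegCorr) :
    ∃ PG ∈ Set.Ioo 0 (M.cost .B),
      PG * (1 - M.F (M.hInv PG)) =
        M.cost .B * (1 - M.prior) * (1 - M.F (M.hInv (M.cost .B))) ∧
      (∀ P ∈ Set.Icc 0 (M.cost .B), P * (1 - M.F (M.hInv P)) =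
        M.cost .B * (1 - M.prior) * (1 - M.F (M.hInv (M.cost .B))) → P = PG) ∧
      ∃ A : Assessment,
        M.IsPBE A ∧ M.PassesIntuitiveCriterion A ∧
        (∀ A' : Assessment, M.IsPBE A' → M.PassesIntuitiveCriterion A' → M.SameOnPath A A') ∧
        (∀ i, A.price i .B = MeasureTheory.Measure.dirac (M.cost .B)) ∧
        A.price .X .G = A.price .Y .G ∧
        ∀ i, (∀ P, A.price i .G {P} = 0) ∧
          A.price i .G (Set.Ico PG (M.cost .B))ᶜ = 0 ∧
          (A.price i .G).support = Set.Icc PG (M.cost .B) ∧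
          ∀ P ∈ Set.Ico PG (M.cost .B), (A.price i .G).real (Set.Iic P) =
            1 / M.prior - M.cost .B * (1 - M.prior) * (1 - M.F (M.hInv (M.cost .B))) /
              (M.prior * P * (1 - M.F (M.hInv P))) := by
  obtain ⟨p, h⟩ := hM.exists_pricingData
  have hF : ∀ P ≤ M.cost .B, 1 - M.F (M.hInv P) = M.reach P 1 := fun P hP =>
    hM.one_sub_F_hInv (hP.trans hM.cost_le_h_vbar)
  have hpe : p * M.reach p 1 = M.cost .B * (1 - M.prior) * M.reach (M.cost .B) 1 := by
    have := h.profit_eq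
    simp only [Market.monopolyProfit] at this
    rw [this]; ring
  refine ⟨p, h.mem, ?_, ?_, Market.signallingEquilibrium h, Market.signalling_isPBE h hM,
    Market.signalling_passesIntuitiveCriterion h hM, ?_, fun i => rfl, rfl, fun i =>
      ⟨h.law_singleton, h.ae_mem_Ico, h.support_law, ?_⟩⟩
  · rw [hF p h.mem.2.le, hF _ le_rfl, hpe]
  · intro P hP hPe
    rw [hF P hP.2, hF _ le_rfl, ← hpe] at hPe
    exact hM.strictMonoOn_reach.injOn hP (Set.Ioo_subset_Icc_self h.mem) hPe
  · intro A' hA' hIC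
    exact (Market.signalling_isPBE h hM).sameOnPath hM hA' (Market.signalling_price_eq h hM hA' hIC)
  · intro P hP
    have h1 := h.law_real_Iic P
    rw [PricingData.pricingCdf_of_mem ⟨hP.1, hP.2.le⟩] at h1
    change h.law.real (Set.Iic P) = _
    rw [h1, hF P hP.2.le, hF _ le_rfl]
    have hP0 : 0 < P := h.mem.1.trans_le hP.1
    have hr := hM.reach_pos zero_le_one (hP.2.trans hM.cost_B_lt)
    have hl := hM.prior_pos
    simp only [Market.monopolyProfit]
    field_simp
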